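/- A directed clique-width $k$-expression $X$ is built from the operations: creation of a new vertex with label $a$; disjoint union $\oplus$ of two labeled digraphs; insertion $\alpha_{a,b}$ ($a\neq b$) of an arc from every vertex with label $a$ to every vertex with label $b$; and change $\rho_{a\to b}$ of label $a$ into label $b$, where all labels come from a set of $k$ labels. Write $|X|$ for the number of operations in $X$. An oriented $r$-coloring of a digraph $G=(V,E)$ is a map $c:V\to\{1,\dots,r\}$ such that $c(u)\neq c(v)$ for every arc $(u,v)\in E$, and $c(u)\neq c(y)$ for all arcs $(u,v),(x,y)\in E$ with $c(v)=c(x)$ (only oriented graphs, i.e. digraphs without loops and opposite arcs, can have one). **Theorem.** The Oriented Chromatic Number problem on digraphs on $n$ vertices given by a directed clique-width $k$-expression can be solved in $\mathcal{O}(n\cdot k^2\cdot 2^{r(r+k)})$ time, plus time linear in the length of the expression. That is, there are a single algorithm and a constant $C$ such that for all $k$ and $r$, every directed clique-width $k$-expression $X$ and every digraph $G$ on $n$ vertices defined by $X$, the algorithm, given $r$, $k$ and $X$, decides in at most $$C\cdot\bigl(|X|+n\cdot k^2\cdot 2^{r(r+k)}\bigr)$$ steps whether $G$ has an oriented $r$-coloring.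 (In particular the time is $\mathcal{O}(n\cdot k^2\cdot 2^{r(r+k)})$ for expressions with $\mathcal{O}(n\cdot k^2)$ operations.) Here an algorithm is a program of a random access machine that performs one arithmetic operation, comparison or memory access on words per step, and whose words need only hold numbers up to $C\cdot(|X|+n\cdot k^2\cdot 2^{r(r+k)})$. -/

import Mathlib

/-! ### Directed clique-width expressions -/

/-- Directed clique-width `k`-expressions, over the labels `0, …, k - 1`. -/
inductive CWExpr (k : ℕ) : Type
  /-- creation of a new vertex with label `a` -/
  | vertex (a : Fin k) : CWExpr k
  /-- disjoint union -/
  | union (X Y : CWExpr k) : CWExpr k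
  /-- insertion of an arc from every vertex with label `a` to every vertex with label `b` -/
  | arcs (a b : Fin k) (hab : a ≠ b) (X : CWExpr k) : CWExpr k
  /-- change of label `a` into label `b` -/
  | relabel (a b : Fin k) (X : CWExpr k) : CWExpr k

namespace CWExpr

variable {k : ℕ}

/-- The vertices of the digraph defined by an expression: the leaves of its expression tree. -/
def Vertex : CWExpr k → Type
  | vertex _ => Unit
  | union X Y => X.Vertex ⊕ Y.Vertex
  | arcs _ _ _ X => X.Vertex
  | relabel _ _ X => X.Vertex

/-- The labels of the vertices of the digraph defined by an expression. -/
def label : (X : CWExpr k) → X.Vertex → Fin k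
  | vertex a => fun _ => a
  | union X Y => Sum.elim X.label Y.label
  | arcs _ _ _ X => X.label
  | relabel a b X => fun v => if X.label v = a then b else X.label v

/-- The arcs of the digraph defined by an expression. -/
def Arc : (X : CWExpr k) → X.Vertex → X.Vertex → Prop
  | vertex _ => fun _ _ => False
  | union X Y => fun u v =>
      match u, v with
      | Sum.inl u, Sum.inl v => X.Arc u v
      | Sum.inr u, Sum.inr v => Y.Arc u v
      | _, _ => False
  | arcs a b _ X => fun u v => X.Arc u v ∨ (X.label u = a ∧ X.label v = b)
  | relabel _ _ X => X.Arc

/-- `X.Defines G`: the expression `X` defines the digraph `G`, where the bijection says which leaf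
of `X` creates which vertex of `G`. -/
def Defines (X : CWExpr k) {V : Type} (G : Digraph V) : Prop :=
  ∃ e : X.Vertex ≃ V, ∀ u v : X.Vertex, G.Adj (e u) (e v) ↔ X.Arc u v

/-- The number of operations of an expression (the number of nodes of its expression tree). -/
def size : CWExpr k → ℕ
  | vertex _ => 1
  | union X Y => X.size + Y.size + 1
  | arcs _ _ _ X => X.size + 1
  | relabel _ _ X => X.size + 1

/-- An expression written as a word over `ℕ`: its operations in postfix order, each operation as
three numbers (the kind of the operation, followed by its labels, padded with `0`). -/
def code : CWExpr k → List ℕ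
  | vertex a => [0, (a : ℕ), 0]
  | union X Y => X.code ++ Y.code ++ [1, 0, 0]
  | arcs a b _ X => X.code ++ [2, (a : ℕ), (b : ℕ)]
  | relabel a b X => X.code ++ [3, (a : ℕ), (b : ℕ)]

end CWExpr

/-! ### Oriented colorings -/

/-- `c` is an oriented coloring of `G`. (If `G` has a loop or two opposite arcs, that is, if it is
not an oriented graph, then it has no such coloring.) -/
def IsOrientedColoring {V : Type} (G : Digraph V) {r : ℕ} (c : V → Fin r) : Prop :=
  (∀ u v, G.Adj u v → c u ≠ c v) ∧
    ∀ u v x y, G.Adj u v → G.Adj x y → c v = c x → c u ≠ c y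

/-- The question of the Oriented Chromatic Number problem: is there an oriented `r`-coloring? -/
def HasOrientedColoring {V : Type} (G : Digraph V) (r : ℕ) : Prop :=
  ∃ c : V → Fin r, IsOrientedColoring G c

/-! ### The machine model: programs of a random access machine with words of bounded length -/

namespace WordRAM

/-- The arithmetic operations that the machine performs in one step. -/
inductive ArithOp : Type
  | add | sub | mul | div | mod | lt | eq

/-- The value of an arithmetic operation. Subtraction is truncated at `0`, division by `0` gives
`0`, and the comparisons give `1` for true and `0` for false. -/
def ArithOp.eval : ArithOp → ℕ → ℕ → ℕ
  | add, a, b => a + b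
  | sub, a, b => a - b
  | mul, a, b => a * b
  | div, a, b => a / b
  | mod, a, b => a % b
  | lt, a, b => if a < b then 1 else 0
  | eq, a, b => if a = b then 1 else 0

/-- Programs. A program mentions only finitely many registers, by fixed numbers; the memory is
addressed through the contents of registers. -/
inductive Prog : Type
  /-- do nothing -/
  | skip : Prog
  /-- register `x` := the constant `c` -/
  | const (x c : ℕ) : Prog
  /-- register `x` := register `y` ∘ register `z` -/
  | arith (o : ArithOp) (x y z : ℕ) : Prog
  /-- register `x` := the memory cell whose address is in register `y` -/
  | load (x y : ℕ) : Prog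
  /-- the memory cell whose address is in register `x` := register `y` -/
  | store (x y : ℕ) : Prog
  /-- first `p`, then `q` -/
  | seq (p q : Prog) : Prog
  /-- if register `x` is not `0` then `p` else `q` -/
  | ite (x : ℕ) (p q : Prog) : Prog
  /-- while register `x` is not `0` do `p` -/
  | loop (x : ℕ) (p : Prog) : Prog

/-- The contents of the registers and of the memory cells. -/
structure State : Type where
  reg : ℕ → ℕ
  mem : ℕ → ℕ

/-- `s` with register `x` set to `a`. -/
def State.setReg (s : State) (x a : ℕ) : State := ⟨Function.update s.reg x a, s.mem⟩

/-- `s` with memory cell `x` set to `a`. -/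
def State.setMem (s : State) (x a : ℕ) : State := ⟨s.reg, Function.update s.mem x a⟩

/-- `Exec W p s s' t`: on a machine whose words hold the numbers from `0` to `W`, the program `p`
started in the state `s` halts in the state `s'` after exactly `t` steps. Each instruction and each
test of a branch or of a loop is one step. There is no run in which a number greater than `W` would
have to be put into a register or be used as an address (the word length is respected,
nothing is cut off). -/
inductive Exec (W : ℕ) : Prog → State → State → ℕ → Prop
  | skip (s : State) : Exec W .skip s s 1
  | const (x c : ℕ) (s : State) (h : c ≤ W) : Exec W (.const x c) s (s.setReg x c) 1
  | arith (o : ArithOp) (x y z : ℕ) (s : State) (h : o.eval (s.reg y) (s.reg z) ≤ W) :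
      Exec W (.arith o x y z) s (s.setReg x (o.eval (s.reg y) (s.reg z))) 1
  | load (x y : ℕ) (s : State) (hadr : s.reg y ≤ W) (hval : s.mem (s.reg y) ≤ W) :
      Exec W (.load x y) s (s.setReg x (s.mem (s.reg y))) 1
  | store (x y : ℕ) (s : State) (hadr : s.reg x ≤ W) (hval : s.reg y ≤ W) :
      Exec W (.store x y) s (s.setMem (s.reg x) (s.reg y)) 1
  | seq {p q : Prog} {s s' s'' : State} {t t' : ℕ} (hp : Exec W p s s' t)
      (hq : Exec W q s' s'' t') : Exec W (.seq p q) s s'' (t + t')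
  | ite_true {x : ℕ} {p q : Prog} {s s' : State} {t : ℕ} (hx : s.reg x ≠ 0)
      (hp : Exec W p s s' t) : Exec W (.ite x p q) s s' (t + 1)
  | ite_false {x : ℕ} {p q : Prog} {s s' : State} {t : ℕ} (hx : s.reg x = 0)
      (hq : Exec W q s s' t) : Exec W (.ite x p q) s s' (t + 1)
  | loop_done {x : ℕ} {p : Prog} {s : State} (hx : s.reg x = 0) : Exec W (.loop x p) s s 1
  | loop_step {x : ℕ} {p : Prog} {s s' s'' : State} {t t' : ℕ} (hx : s.reg x ≠ 0)
      (hp : Exec W p s s' t) (hl : Exec W (.loop x p) s' s'' t') :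
      Exec W (.loop x p) s s'' (t + t' + 1)

/-- The state in which all registers are `0` and the memory holds the word `w` in its first cells
and `0` elsewhere. -/
def initial (w : List ℕ) : State := ⟨fun _ => 0, fun i => w.getD i 0⟩

/-- With words for the numbers from `0` to `W`, the program `p` on input `w` halts after at most `T`
steps and answers whether `Q` holds, by `1` (yes) or `0` (no) in register `0`. -/
def Answers (W : ℕ) (p : Prog) (w : List ℕ) (T : ℕ) (Q : Prop) : Prop :=
  ∃ (s : State) (t : ℕ), Exec W p (initial w) s t ∧ t ≤ T ∧
    (Q → s.reg 0 = 1) ∧ (¬ Q → s.reg 0 = 0)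

end WordRAM

/-- The input for the Oriented Chromatic Number problem on a digraph that is given by a directed
clique-width `k`-expression: the numbers `r`, `k`, the number of operations, and the expression. -/
def ocnInput {k : ℕ} (r : ℕ) (X : CWExpr k) : List ℕ :=
  r :: k :: X.size :: X.code

/-!
Two digraphs defined by expressions behave alike in all larger expressions if the same pairs
`(F, s)` occur for them, where `F` is a tournament on the colors and `s` says which colors occur at
the vertices of each label. There are `2 ^ (r.choose 2 + k * r)` such pairs, and the set of those
that occur is a table that each operation updates. A disjoint union multiplies two tables
pointwise. An arc insertion runs through all pairs of colors, and a relabeling through all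
entries.

An expression may contain far more arc insertions and relabelings than vertices. They are charged
to the vertices by storing tables in terms of slots instead of labels: a relabeling to an
unused label only renames slots, and an arc insertion that has been carried out is flagged, so that
its repetition costs constant time. All other operations decrease a potential of order `k ^ 2` that
only new vertices and unions raise.
-/

namespace WordRAM

/-! ### Structured programs -/

section Language

/-- Expressions over a type `V` of variables, a type `A` of arrays, and the input word. -/
inductive Expr (V A : Type) : Type
  | lit (c : ℕ)
  | var (x : V)
  | bin (o : ArithOp) (a b : Expr V A)
  | read (ρ : A) (i : Expr V A)
  | input (i : Expr V A)

/-- Structured programs over variables and arrays. `forTo x y p` runs `p` for `x = 0, 1, …, y - 1`,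
where `p` must change neither `x` nor `y`. -/
inductive Cmd (V A : Type) : Type
  | skip
  | assign (x : V) (e : Expr V A)
  | write (ρ : A) (i e : Expr V A)
  | seq (p q : Cmd V A)
  | ite (e : Expr V A) (p q : Cmd V A)
  | forTo (x y : V) (p : Cmd V A)

/-- The values of the variables and of the array cells. -/
@[ext] structure Store (V A : Type) : Type where
  var : V → ℕ
  arr : A → ℕ → ℕ

/-- What stays fixed during a run: the word bound, the input, and the number of cells reserved for
each array. -/
structure Env (A : Type) [Fintype A] : Type where
  bound : ℕ
  inputLength : ℕ
  input : ℕ → ℕ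
  cells : ℕ
  one_le_bound : 1 ≤ bound
  fits : inputLength + Fintype.card A * cells ≤ bound

variable {V A : Type}

instance (n : ℕ) : OfNat (Expr V A) n := ⟨.lit n⟩
instance : Coe V (Expr V A) := ⟨.var⟩
instance : Add (Expr V A) := ⟨.bin .add⟩
instance : Sub (Expr V A) := ⟨.bin .sub⟩
instance : Mul (Expr V A) := ⟨.bin .mul⟩
instance : Div (Expr V A) := ⟨.bin .div⟩
instance : Mod (Expr V A) := ⟨.bin .mod⟩

infixr:30 " ;; " => Cmd.seq

namespace Store

/-- The store with variable `x` set to `a`. -/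
def set [DecidableEq V] (h : Store V A) (x : V) (a : ℕ) : Store V A :=
  ⟨Function.update h.var x a, h.arr⟩

/-- The store with cell `i` of array `ρ` set to `a`. -/
def put [DecidableEq A] (h : Store V A) (ρ : A) (i a : ℕ) : Store V A :=
  ⟨h.var, Function.update h.arr ρ (Function.update (h.arr ρ) i a)⟩

@[simp] theorem set_var [DecidableEq V] (h : Store V A) (x : V) (a : ℕ) :
    (h.set x a).var = Function.update h.var x a := rfl

@[simp] theorem set_arr [DecidableEq V] (h : Store V A) (x : V) (a : ℕ) : 
    (h.set x a).arr = h.arr := rfl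

@[simp] theorem put_var [DecidableEq A] (h : Store V A) (ρ : A) (i a : ℕ) : 
    (h.put ρ i a).var = h.var := rfl

@[simp] theorem put_arr [DecidableEq A] (h : Store V A) (ρ : A) (i a : ℕ) :
    (h.put ρ i a).arr = Function.update h.arr ρ (Function.update (h.arr ρ) i a) := rfl

end Store

/-- No word overflow: the condition under which `o` keeps words within the bound `W`. -/
def ArithOp.Fits (W : ℕ) : ArithOp → ℕ → ℕ → Prop
  | add, a, b => a + b ≤ W
  | mul, a, b => a * b ≤ W
  | _, _, _ => True

theorem ArithOp.Fits.eval_le {W a b : ℕ} {o : ArithOp} (ho : o.Fits W a b) (hW : 1 ≤ W)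
    (ha : a ≤ W) : o.eval a b ≤ W := by
  cases o with
  | add | mul => exact ho
  | sub => exact (Nat.sub_le a b).trans ha
  | div => exact (Nat.div_le_self a b).trans ha
  | mod => exact (Nat.mod_le a b).trans ha
  | lt | eq => simp only [eval]; split_ifs <;> omega

namespace Expr

/-- The value of an expression in a store. -/
def val [Fintype A] (E : Env A) (h : Store V A) : Expr V A → ℕ
  | lit c => c
  | var x => h.var x
  | bin o a b => o.eval (a.val E h) (b.val E h)
  | read ρ i => h.arr ρ (i.val E h)
  | input i => E.input (i.val E h)

/-- The number of machine steps for the evaluation of an expression. -/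
def cost : Expr V A → ℕ
  | lit _ => 1
  | var _ => 2
  | bin _ a b => a.cost + b.cost + 1
  | read _ i => i.cost + 6
  | input i => i.cost + 1

/-- The evaluation of an expression respects the word bound and the bounds of the arrays. -/
def Safe [Fintype A] (E : Env A) (h : Store V A) : Expr V A → Prop
  | lit c => c ≤ E.bound
  | var _ => True
  | bin o a b => a.Safe E h ∧ b.Safe E h ∧ o.Fits E.bound (a.val E h) (b.val E h)
  | read _ i => i.Safe E h ∧ i.val E h < E.cells
  | input i => i.Safe E h ∧ i.val E h < E.inputLength

/-- The expression with value `1` if `a < b` and `0` otherwise. -/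
protected def lt (a b : Expr V A) : Expr V A := .bin .lt a b

/-- The expression with value `1` if `a = b` and `0` otherwise. -/
protected def eq (a b : Expr V A) : Expr V A := .bin .eq a b

section Simp

variable (a b : Expr V A)

@[simp] theorem cost_lit (n : ℕ) : (lit n : Expr V A).cost = 1 := rfl
@[simp] theorem cost_ofNat (n : ℕ) : (ofNat(n) : Expr V A).cost = 1 := rfl
@[simp] theorem cost_var (x : V) : (var x : Expr V A).cost = 2 := rfl
@[simp] theorem cost_add : (a + b).cost = a.cost + b.cost + 1 := rfl
@[simp] theorem cost_sub : (a - b).cost = a.cost + b.cost + 1 := rfl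
@[simp] theorem cost_mul : (a * b).cost = a.cost + b.cost + 1 := rfl
@[simp] theorem cost_div : (a / b).cost = a.cost + b.cost + 1 := rfl
@[simp] theorem cost_mod : (a % b).cost = a.cost + b.cost + 1 := rfl
@[simp] theorem cost_lt : (a.lt b).cost = a.cost + b.cost + 1 := rfl
@[simp] theorem cost_eq : (a.eq b).cost = a.cost + b.cost + 1 := rfl
@[simp] theorem cost_read (ρ : A) : (a.read ρ).cost = a.cost + 6 := rfl
@[simp] theorem cost_input : a.input.cost = a.cost + 1 := rfl

variable [Fintype A] (E : Env A) (h : Store V A)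

@[simp] theorem val_lit (n : ℕ) : (lit n : Expr V A).val E h = n := rfl
@[simp] theorem val_ofNat (n : ℕ) : (ofNat(n) : Expr V A).val E h = n := rfl
@[simp] theorem val_var (x : V) : (var x : Expr V A).val E h = h.var x := rfl
@[simp] theorem val_add : (a + b).val E h = a.val E h + b.val E h := rfl
@[simp] theorem val_sub : (a - b).val E h = a.val E h - b.val E h := rfl
@[simp] theorem val_mul : (a * b).val E h = a.val E h * b.val E h := rfl
@[simp] theorem val_div : (a / b).val E h = a.val E h / b.val E h := rfl
@[simp] theorem val_mod : (a % b).val E h = a.val E h % b.val E h := rfl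
@[simp] theorem val_lt : (a.lt b).val E h = if a.val E h < b.val E h then 1 else 0 := rfl
@[simp] theorem val_eq : (a.eq b).val E h = if a.val E h = b.val E h then 1 else 0 := rfl
@[simp] theorem val_read (ρ : A) : (a.read ρ).val E h = h.arr ρ (a.val E h) := rfl
@[simp] theorem val_input : a.input.val E h = E.input (a.val E h) := rfl

@[simp] theorem safe_lit (n : ℕ) : (lit n : Expr V A).Safe E h ↔ n ≤ E.bound := .rfl
@[simp] theorem safe_ofNat (n : ℕ) : (ofNat(n) : Expr V A).Safe E h ↔ n ≤ E.bound := .rfl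
@[simp] theorem safe_var (x : V) : (var x : Expr V A).Safe E h ↔ True := .rfl
@[simp] theorem safe_add : (a + b).Safe E h ↔
    a.Safe E h ∧ b.Safe E h ∧ a.val E h + b.val E h ≤ E.bound := .rfl
@[simp] theorem safe_mul : (a * b).Safe E h ↔
    a.Safe E h ∧ b.Safe E h ∧ a.val E h * b.val E h ≤ E.bound := .rfl
@[simp] theorem safe_sub : (a - b).Safe E h ↔ a.Safe E h ∧ b.Safe E h :=
  and_congr_right' (and_iff_left trivial)
@[simp] theorem safe_div : (a / b).Safe E h ↔ a.Safe E h ∧ b.Safe E h :=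
  and_congr_right' (and_iff_left trivial)
@[simp] theorem safe_mod : (a % b).Safe E h ↔ a.Safe E h ∧ b.Safe E h :=
  and_congr_right' (and_iff_left trivial)
@[simp] theorem safe_lt : (a.lt b).Safe E h ↔ a.Safe E h ∧ b.Safe E h :=
  and_congr_right' (and_iff_left trivial)
@[simp] theorem safe_eq : (a.eq b).Safe E h ↔ a.Safe E h ∧ b.Safe E h :=
  and_congr_right' (and_iff_left trivial)
@[simp] theorem safe_read (ρ : A) : (a.read ρ).Safe E h ↔
    a.Safe E h ∧ a.val E h < E.cells := .rfl
@[simp] theorem safe_input : a.input.Safe E h ↔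
    a.Safe E h ∧ a.val E h < E.inputLength := .rfl

end Simp

end Expr

namespace Cmd

/-- The variables that a program may change. -/
def assigned : Cmd V A → List V
  | skip => []
  | assign x _ => [x]
  | write _ _ _ => []
  | seq p q => p.assigned ++ q.assigned
  | ite _ p q => p.assigned ++ q.assigned
  | forTo x _ p => x :: p.assigned

/-- The arrays that a program may change. -/
def written : Cmd V A → List A
  | skip => []
  | assign _ _ => []
  | write ρ _ _ => [ρ]
  | seq p q => p.written ++ q.written
  | ite _ p q => p.written ++ q.written
  | forTo _ _ p => p.written

/-- The stores `h` and `h'` differ at most in what `p` may change. -/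
structure Preserves (p : Cmd V A) (h h' : Store V A) : Prop where
  var : ∀ x ∉ p.assigned, h'.var x = h.var x
  arr : ∀ ρ ∉ p.written, h'.arr ρ = h.arr ρ

variable [DecidableEq V] [DecidableEq A] [Fintype A]

/-- The store after a run of a program. -/
def run (E : Env A) : Cmd V A → Store V A → Store V A
  | skip, h => h
  | assign x e, h => h.set x (e.val E h)
  | write ρ i e, h => h.put ρ (i.val E h) (e.val E h)
  | seq p q, h => q.run E (p.run E h)
  | ite e p q, h => if e.val E h ≠ 0 then p.run E h else q.run E h
  | forTo x y p, h =>
      (fun h' => (p.run E h').set x (h'.var x + 1))^[h.var y] (h.set x 0)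

/-- The store before round `i` of the loop `forTo x y p` started in `h`. -/
def round (E : Env A) (x : V) (p : Cmd V A) (h : Store V A) (i : ℕ) : Store V A :=
  (fun h' => (p.run E h').set x (h'.var x + 1))^[i] (h.set x 0)

/-- The number of machine steps in a run of a program. -/
def time (E : Env A) : Cmd V A → Store V A → ℕ
  | skip, _ => 1
  | assign _ e, _ => e.cost + 2
  | write _ i e, _ => i.cost + e.cost + 6
  | seq p q, h => p.time E h + q.time E (p.run E h)
  | ite e p q, h => e.cost + 1 + if e.val E h ≠ 0 then p.time E h else q.time E h
  | forTo x y p, h => ∑ i ∈ Finset.range (h.var y), (p.time E (round E x p h i) + 4) + 3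

/-- A run of a program respects the word bound and the bounds of the arrays, and no loop body
changes the counter or the bound of its loop. -/
def Safe (E : Env A) : Cmd V A → Store V A → Prop
  | skip, _ => True
  | assign _ e, h => e.Safe E h
  | write _ i e, h => i.Safe E h ∧ e.Safe E h ∧ i.val E h < E.cells
  | seq p q, h => p.Safe E h ∧ q.Safe E (p.run E h)
  | ite e p q, h => e.Safe E h ∧ if e.val E h ≠ 0 then p.Safe E h else q.Safe E h
  | forTo x y p, h => (x ≠ y ∧ x ∉ p.assigned ∧ y ∉ p.assigned) ∧
      ∀ i < h.var y, p.Safe E (round E x p h i)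

variable {E : Env A} {p : Cmd V A} {h : Store V A}

theorem round_succ (x : V) (i : ℕ) :
    round E x p h (i + 1) = (p.run E (round E x p h i)).set x ((round E x p h i).var x + 1) :=
  Function.iterate_succ_apply' _ _ _

theorem round_var_self (x : V) (i : ℕ) : (round E x p h i).var x = i := by
  induction i with
  | zero => simp [round]
  | succ i ih => simp [round_succ, ih]

theorem round_var {x y : V} (hyx : y ≠ x) (hp : ∀ h, (p.run E h).var y = h.var y) (i : ℕ) :
    (round E x p h i).var y = h.var y := by
  induction i with
  | zero => simp [round, hyx]
  | succ i ih => simp [round_succ, hyx, hp, ih]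

theorem round_arr {ρ : A} (hp : ∀ h, (p.run E h).arr ρ = h.arr ρ) (x : V) (i : ℕ) :
    (round E x p h i).arr ρ = h.arr ρ := by
  induction i with
  | zero => rfl
  | succ i ih => rw [round_succ, Store.set_arr, hp, ih]

theorem run_var {x : V} (hx : x ∉ p.assigned) : (p.run E h).var x = h.var x := by
  induction p generalizing h with
  | skip => rfl
  | assign y e => exact Function.update_of_ne (by simpa [assigned] using hx) _ _
  | write => rfl
  | seq p q hp hq =>
    simp only [assigned, List.mem_append, not_or] at hx
    exact (hq hx.2).trans (hp hx.1)
  | ite e p q hp hq =>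
    simp only [assigned, List.mem_append, not_or] at hx
    simp only [run]
    split_ifs
    exacts [hp hx.1, hq hx.2]
  | forTo y z p hp =>
    simp only [assigned, List.mem_cons, not_or] at hx
    exact round_var hx.1 (fun _ => hp hx.2) _

theorem run_arr {ρ : A} (hρ : ρ ∉ p.written) : (p.run E h).arr ρ = h.arr ρ := by
  induction p generalizing h with
  | skip => rfl
  | assign => rfl
  | write ρ' i e => exact Function.update_of_ne (by simpa [written] using hρ) _ _
  | seq p q hp hq =>
    simp only [written, List.mem_append, not_or] at hρ
    exact (hq hρ.2).trans (hp hρ.1)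
  | ite e p q hp hq =>
    simp only [written, List.mem_append, not_or] at hρ
    simp only [run]
    split_ifs
    exacts [hp hρ.1, hq hρ.2]
  | forTo y z p hp => exact round_arr (fun _ => hp hρ) y _

end Cmd

end Language

section Compilation

variable {V A : Type} [Fintype V] [Fintype A]

/-- The register that holds variable `x`. -/
noncomputable def varReg (x : V) : ℕ := Fintype.equivFin V x

variable (V) in
/-- The register that holds the length of the input; all higher ones are for temporary results. -/
def baseReg : ℕ := Fintype.card V

theorem varReg_lt (x : V) : varReg x < baseReg V := (Fintype.equivFin V x).2

theorem varReg_injective : Function.Injective (varReg : V → ℕ) :=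
  Fin.val_injective.comp (Fintype.equivFin V).injective

/-- The memory cell that holds cell `i` of array `ρ`: the arrays are interleaved behind the
input. -/
noncomputable def Env.address (E : Env A) (ρ : A) (i : ℕ) : ℕ :=
  i * Fintype.card A + Fintype.equivFin A ρ + E.inputLength

theorem Env.address_injective (E : Env A) {ρ ρ' : A} {i j : ℕ}
    (h : E.address ρ i = E.address ρ' j) : ρ = ρ' ∧ i = j := by
  have hA := (Fintype.equivFin A ρ).2
  have hA' := (Fintype.equivFin A ρ').2
  have heq : i * Fintype.card A + Fintype.equivFin A ρ =
      j * Fintype.card A + Fintype.equivFin A ρ' := by simpa [address] using h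
  have hij : i = j := by
    have hdiv := congrArg (· / Fintype.card A) heq
    simpa only [Nat.mul_comm _ (Fintype.card A), Nat.mul_add_div (Nat.zero_lt_of_lt hA),
      Nat.div_eq_of_lt hA, Nat.div_eq_of_lt hA', Nat.add_zero] using hdiv
  subst hij
  exact ⟨(Fintype.equivFin A).injective (Fin.val_injective (Nat.add_left_cancel heq)), rfl⟩

/-- The machine state `s` represents the store `h`. -/
structure Represents (E : Env A) (s : State) (h : Store V A) : Prop where
  var : ∀ x, s.reg (varReg x) = h.var x
  base : s.reg (baseReg V) = E.inputLength
  reg_le : ∀ n, s.reg n ≤ E.bound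
  arr : ∀ ρ i, s.mem (E.address ρ i) = h.arr ρ i
  input : ∀ i < E.inputLength, s.mem i = E.input i
  mem_le : ∀ a, s.mem a ≤ E.bound

/-- Turns an index of array `ρ` in register `d` into an address, with the help of register
`d + 1`. -/
noncomputable def addressCode (V : Type) [Fintype V] (ρ : A) (d : ℕ) : Prog :=
  .seq (.const (d + 1) (Fintype.card A)) (.seq (.arith .mul d d (d + 1))
    (.seq (.const (d + 1) (Fintype.equivFin A ρ)) (.seq (.arith .add d d (d + 1))
      (.arith .add d d (baseReg V)))))

/-- Evaluates an expression into register `d`, with the help of higher registers only. -/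
noncomputable def Expr.code : Expr V A → ℕ → Prog
  | lit c, d => .const d c
  | var x, d => .seq (.const d 0) (.arith .add d (varReg x) d)
  | bin o a b, d => .seq (a.code d) (.seq (b.code (d + 1)) (.arith o d d (d + 1)))
  | read ρ i, d => .seq (i.code d) (.seq (addressCode V ρ d) (.load d d))
  | input i, d => .seq (i.code d) (.load d d)

/-- The machine program for a structured program. -/
noncomputable def Cmd.compile : Cmd V A → Prog
  | skip => .skip
  | assign x e => .seq (e.code (baseReg V + 1)) (.seq (.const (baseReg V + 2) 0)
      (.arith .add (varReg x) (baseReg V + 1) (baseReg V + 2)))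
  | write ρ i e => .seq (i.code (baseReg V + 1)) (.seq (addressCode V ρ (baseReg V + 1))
      (.seq (e.code (baseReg V + 2)) (.store (baseReg V + 1) (baseReg V + 2))))
  | seq p q => .seq p.compile q.compile
  | ite e p q => .seq (e.code (baseReg V + 1)) (.ite (baseReg V + 1) p.compile q.compile)
  | forTo x y p => .seq (.const (varReg x) 0)
      (.seq (.arith .lt (baseReg V + 1) (varReg x) (varReg y))
        (.loop (baseReg V + 1) (.seq p.compile (.seq (.const (baseReg V + 1) 1)
          (.seq (.arith .add (varReg x) (varReg x) (baseReg V + 1))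
            (.arith .lt (baseReg V + 1) (varReg x) (varReg y)))))))

variable {E : Env A} {s s' : State} {h : Store V A}

theorem Env.card_le_bound (E : Env A) {i : ℕ} (hi : i < E.cells) : Fintype.card A ≤ E.bound :=
  (Nat.le_mul_of_pos_right _ (Nat.zero_lt_of_lt hi)).trans
    ((Nat.le_add_left _ _).trans E.fits)

theorem Env.address_lt (E : Env A) (ρ : A) {i : ℕ} (hi : i < E.cells) :
    E.address ρ i < E.bound := by
  have hρ := (Fintype.equivFin A ρ).2
  have hmul : (i + 1) * Fintype.card A ≤ Fintype.card A * E.cells := by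
    rw [Nat.mul_comm]; exact Nat.mul_le_mul_left _ hi
  have hfits := E.fits
  rw [Nat.succ_mul] at hmul
  unfold Env.address
  omega

theorem Represents.setReg_temp (hs : Represents E s h) {d a : ℕ} (hd : baseReg V < d)
    (ha : a ≤ E.bound) : Represents E (s.setReg d a) h where
  var x := by simp [State.setReg, ((varReg_lt x).trans hd).ne, hs.var]
  base := by simp [State.setReg, hd.ne, hs.base]
  reg_le n := by
    by_cases hn : n = d <;> simp [State.setReg, hn, ha, hs.reg_le]
  arr := hs.arr
  input := hs.input
  mem_le := hs.mem_le

theorem Represents.setReg_var [DecidableEq V] (hs : Represents E s h) (x : V) {a : ℕ}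
    (ha : a ≤ E.bound) : Represents E (s.setReg (varReg x) a) (h.set x a) where
  var y := by
    by_cases hy : y = x
    · simp [State.setReg, hy]
    · simp [State.setReg, hy, varReg_injective.eq_iff, hs.var]
  base := by simp [State.setReg, (varReg_lt x).ne', hs.base]
  reg_le n := by
    by_cases hn : n = varReg x <;> simp [State.setReg, hn, ha, hs.reg_le]
  arr := hs.arr
  input := hs.input
  mem_le := hs.mem_le

theorem Represents.setMem [DecidableEq A] (hs : Represents E s h) (ρ : A) (i : ℕ) {a : ℕ}
    (ha : a ≤ E.bound) : Represents E (s.setMem (E.address ρ i) a) (h.put ρ i a) where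
  var := hs.var
  base := hs.base
  reg_le := hs.reg_le
  arr ρ' j := by
    by_cases hρ : ρ' = ρ
    · subst hρ
      by_cases hj : j = i
      · simp [State.setMem, hj]
      · have : E.address ρ' j ≠ E.address ρ' i := fun h => hj (E.address_injective h).2
        simp [State.setMem, Function.update_of_ne this, hj, hs.arr]
    · have : E.address ρ' j ≠ E.address ρ i := fun h => hρ (E.address_injective h).1
      simp [State.setMem, Function.update_of_ne this, hρ, hs.arr]
  input j hj := by
    have : j ≠ E.address ρ i := (hj.trans_le (Nat.le_add_left _ _)).ne
    simp [State.setMem, this, hs.input j hj]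
  mem_le b := by
    by_cases hb : b = E.address ρ i <;> simp [State.setMem, hb, ha, hs.mem_le]

theorem Exec.arith_of_eq {W x y z a : ℕ} {o : ArithOp}
    (ha : o.eval (s.reg y) (s.reg z) = a) (hW : a ≤ W) :
    Exec W (.arith o x y z) s (s.setReg x a) 1 := by
  subst ha; exact .arith o x y z s hW

theorem Exec.load_of_eq {W x y a b : ℕ} (ha : s.reg y = a) (hb : s.mem a = b) (haW : a ≤ W)
    (hbW : b ≤ W) : Exec W (.load x y) s (s.setReg x b) 1 := by
  subst ha hb; exact .load x y s haW hbW

theorem exec_addressCode (hs : Represents E s h) {d : ℕ} (hd : baseReg V < d) (ρ : A)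
    (hi : s.reg d < E.cells) :
    ∃ s', Exec E.bound (addressCode V ρ d) s s' 5 ∧ s'.reg d = E.address ρ (s.reg d) ∧
      (∀ n < d, s'.reg n = s.reg n) ∧ s'.mem = s.mem ∧ Represents E s' h := by
  have haddr := (E.address_lt ρ hi).le
  have hcard := E.card_le_bound hi
  have hρ := (Fintype.equivFin A ρ).2
  have hd' : baseReg V < d + 1 := by omega
  have haddr' := haddr
  unfold Env.address at haddr'
  have hrep := (((((hs.setReg_temp hd' hcard).setReg_temp hd
    (a := s.reg d * Fintype.card A) (by omega)).setReg_temp hd' (hρ.le.trans hcard)).setReg_temp hd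
    (a := s.reg d * Fintype.card A + Fintype.equivFin A ρ) (by omega)).setReg_temp hd haddr)
  refine ⟨_, .seq (.const _ _ _ hcard) (.seq (.arith_of_eq (by simp [State.setReg, ArithOp.eval])
    (by omega)) (.seq (.const _ _ _ (hρ.le.trans hcard)) (.seq (.arith_of_eq
      (by simp [State.setReg, ArithOp.eval]) (by omega)) (.arith_of_eq ?_ haddr)))), ?_, ?_, rfl,
    hrep⟩
  · simp [State.setReg, ArithOp.eval, hs.base, hd.ne, hd'.ne, Env.address]
  · simp [State.setReg]
  · intro n hn
    simp [State.setReg, hn.ne, (hn.trans (Nat.lt_succ_self d)).ne]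

theorem exec_var (hs : Represents E s h) (x : V) {d : ℕ} (hd : baseReg V < d) :
    ∃ s', Exec E.bound ((Expr.var x : Expr V A).code d) s s' 2 ∧ s'.reg d = h.var x ∧
      (∀ n < d, s'.reg n = s.reg n) ∧ Represents E s' h := by
  have hx := (varReg_lt x).trans hd
  have hle : h.var x ≤ E.bound := hs.var x ▸ hs.reg_le _
  refine ⟨_, .seq (.const d 0 s (Nat.zero_le _)) (.arith_of_eq (a := h.var x) ?_ hle), ?_, ?_,
    (hs.setReg_temp hd (Nat.zero_le _)).setReg_temp hd hle⟩
  · simp [State.setReg, ArithOp.eval, hx.ne, hs.var]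
  · simp [State.setReg]
  · intro n hn; simp [State.setReg, hn.ne]

theorem Expr.exec (e : Expr V A) (hs : Represents E s h) (he : e.Safe E h) {d : ℕ}
    (hd : baseReg V < d) :
    ∃ s', Exec E.bound (e.code d) s s' e.cost ∧ s'.reg d = e.val E h ∧
      (∀ n < d, s'.reg n = s.reg n) ∧ Represents E s' h := by
  induction e generalizing s d with
  | lit c =>
    exact ⟨_, .const d c s he, by simp [State.setReg, val],
      fun n hn => by simp [State.setReg, hn.ne], hs.setReg_temp hd he⟩
  | var x => exact exec_var hs x hd
  | bin o a b iha ihb =>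
    obtain ⟨s₁, hexec₁, hval₁, hreg₁, hs₁⟩ := iha hs he.1 hd
    obtain ⟨s₂, hexec₂, hval₂, hreg₂, hs₂⟩ := ihb hs₁ he.2.1 (hd.trans (Nat.lt_succ_self d))
    have ha : s₂.reg d = a.val E h := by rw [hreg₂ d (Nat.lt_succ_self d), hval₁]
    have hle := he.2.2.eval_le E.one_le_bound (ha ▸ hs₂.reg_le _)
    have hexec := hexec₁.seq (hexec₂.seq (.arith_of_eq (x := d)
      (z := d + 1) (by rw [ha, hval₂]) hle))
    rw [← Nat.add_assoc] at hexec
    refine ⟨_, hexec, ?_, ?_, hs₂.setReg_temp hd hle⟩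
    · simp [State.setReg, val]
    · intro n hn
      simp [State.setReg, hn.ne, hreg₂ n (by omega), hreg₁ n hn]
  | read ρ i ih =>
    obtain ⟨s₁, hexec₁, hval₁, hreg₁, hs₁⟩ := ih hs he.1 hd
    obtain ⟨s₂, hexec₂, hval₂, hreg₂, -, hs₂⟩ := exec_addressCode hs₁ hd ρ (hval₁ ▸ he.2)
    rw [hval₁] at hval₂
    refine ⟨_, .seq hexec₁ (.seq hexec₂ (.load_of_eq hval₂ (hs₂.arr ρ _) ?_ ?_)), ?_, ?_,
      hs₂.setReg_temp hd ?_⟩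
    · exact (E.address_lt ρ he.2).le
    · exact hs₂.arr ρ _ ▸ hs₂.mem_le _
    · simp [State.setReg, val]
    · intro n hn; simp [State.setReg, hn.ne, hreg₂ n hn, hreg₁ n hn]
    · exact hs₂.arr ρ _ ▸ hs₂.mem_le _
  | input i ih =>
    obtain ⟨s₁, hexec₁, hval₁, hreg₁, hs₁⟩ := ih hs he.1 hd
    have hle : E.inputLength ≤ E.bound := (Nat.le_add_right _ _).trans E.fits
    refine ⟨_, .seq hexec₁ (.load_of_eq hval₁ (hs₁.input _ he.2) (he.2.le.trans hle) ?_), ?_, ?_,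
      hs₁.setReg_temp hd ?_⟩
    · exact hs₁.input _ he.2 ▸ hs₁.mem_le _
    · simp [State.setReg, val]
    · intro n hn; simp [State.setReg, hn.ne, hreg₁ n hn]
    · exact hs₁.input _ he.2 ▸ hs₁.mem_le _

variable [DecidableEq V] [DecidableEq A]

namespace Cmd

theorem exec_assign (x : V) (e : Expr V A) (hs : Represents E s h) (he : e.Safe E h) :
    ∃ s', Exec E.bound (assign x e).compile s s' ((assign x e).time E h) ∧
      Represents E s' ((assign x e).run E h) := by
  obtain ⟨s₁, hexec₁, hval₁, -, hs₁⟩ := e.exec hs he (Nat.lt_succ_self _)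
  have hle : e.val E h ≤ E.bound := hval₁ ▸ hs₁.reg_le _
  refine ⟨_, .seq hexec₁ (.seq (.const _ _ _ (Nat.zero_le _)) (.arith_of_eq ?_ hle)),
    (hs₁.setReg_temp (by omega) (Nat.zero_le _)).setReg_var x hle⟩
  simp [State.setReg, ArithOp.eval, hval₁]

theorem exec_write (ρ : A) (i e : Expr V A) (hs : Represents E s h)
    (hsafe : (write ρ i e).Safe E h) :
    ∃ s', Exec E.bound (write ρ i e).compile s s' ((write ρ i e).time E h) ∧
      Represents E s' ((write ρ i e).run E h) := by
  obtain ⟨hi, he, hlt⟩ := hsafe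
  obtain ⟨s₁, hexec₁, hval₁, -, hs₁⟩ := i.exec hs hi (Nat.lt_succ_self _)
  obtain ⟨s₂, hexec₂, hval₂, -, -, hs₂⟩ :=
    exec_addressCode hs₁ (Nat.lt_succ_self _) ρ (hval₁ ▸ hlt)
  obtain ⟨s₃, hexec₃, hval₃, hreg₃, hs₃⟩ := e.exec hs₂ he (d := baseReg V + 2) (by omega)
  have haddr : s₃.reg (baseReg V + 1) = E.address ρ (i.val E h) := by
    rw [hreg₃ _ (Nat.lt_succ_self _), hval₂, hval₁]
  refine ⟨_, ?_, hs₃.setMem ρ (i.val E h) (a := e.val E h) (hval₃ ▸ hs₃.reg_le _)⟩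
  have hstore := Exec.store (baseReg V + 1) (baseReg V + 2) s₃ (hs₃.reg_le _) (hs₃.reg_le _)
  rw [haddr, hval₃] at hstore
  have hexec := hexec₁.seq (hexec₂.seq (hexec₃.seq hstore))
  rwa [show i.cost + (5 + (e.cost + 1)) = i.cost + e.cost + 6 by omega] at hexec

theorem exec_loop {x y : V} {p : Cmd V A} (hxy : y ≠ x) (hy : y ∉ p.assigned)
    (hp : ∀ i < h.var y, ∀ s, Represents E s (round E x p h i) →
      ∃ s', Exec E.bound p.compile s s' (p.time E (round E x p h i)) ∧
        Represents E s' (p.run E (round E x p h i)))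
    (hx : x ∉ p.assigned) (m i : ℕ) (him : i + m = h.var y) {s : State}
    (hs : Represents E s (round E x p h i))
    (htest : s.reg (baseReg V + 1) = if i < h.var y then 1 else 0) :
    ∃ s', Exec E.bound (.loop (baseReg V + 1) (.seq p.compile (.seq (.const (baseReg V + 1) 1)
        (.seq (.arith .add (varReg x) (varReg x) (baseReg V + 1))
          (.arith .lt (baseReg V + 1) (varReg x) (varReg y)))))) s s'
        (∑ j ∈ Finset.range m, (p.time E (round E x p h (i + j)) + 4) + 1) ∧
      Represents E s' (round E x p h (i + m)) := by
  induction m generalizing i s with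
  | zero => exact ⟨s, .loop_done (by rw [htest, if_neg (by omega)]), hs⟩
  | succ m ih =>
    have hi : i < h.var y := by omega
    obtain ⟨s₁, hexec₁, hs₁⟩ := hp i hi s hs
    have hxi : s₁.reg (varReg x) = i := by rw [hs₁.var, run_var hx, round_var_self]
    have hyn : s₁.reg (varReg y) = h.var y := by
      rw [hs₁.var, run_var hy, round_var hxy fun _ => run_var hy]
    have hbound : h.var y ≤ E.bound := hyn ▸ hs₁.reg_le _
    have hxt := (varReg_lt x).ne
    have hs₂ := (((hs₁.setReg_temp (d := baseReg V + 1) (by omega) E.one_le_bound).setReg_var x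
      (hi.trans_le hbound)).setReg_temp (d := baseReg V + 1) (by omega)
      (a := if i + 1 < h.var y then 1 else 0) (by split_ifs; exacts [E.one_le_bound, by omega]))
    obtain ⟨s', hexec', hs'⟩ := ih (i + 1) (by omega) (s := _)
      (by rw [round_succ, round_var_self]; exact hs₂) (by simp [State.setReg])
    refine ⟨s', ?_, by rwa [← Nat.add_assoc, Nat.add_right_comm]⟩
    have hexec := Exec.loop_step (by rw [htest, if_pos hi]; exact one_ne_zero)
      (hexec₁.seq (.seq (.const (baseReg V + 1) 1 _ E.one_le_bound)
        (.seq (.arith_of_eq (x := varReg x) (a := i + 1) ?_ (by omega))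
          (.arith_of_eq ?_ ?_)))) hexec'
    · rw [Finset.sum_range_succ']
      convert hexec using 1
      simp only [Nat.add_zero, Nat.add_right_comm i 1, ← Nat.add_assoc]
      omega
    · have := varReg_lt x
      simp [State.setReg, ArithOp.eval, hxi, show varReg x ≠ baseReg V + 1 by omega]
    · have := varReg_lt x
      have := varReg_lt y
      simp [State.setReg, ArithOp.eval, hyn, varReg_injective.eq_iff, hxy,
        show varReg y ≠ baseReg V + 1 by omega]
    · split_ifs; exacts [E.one_le_bound, by omega]

theorem exec (p : Cmd V A) (hs : Represents E s h) (hp : p.Safe E h) :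
    ∃ s', Exec E.bound p.compile s s' (p.time E h) ∧ Represents E s' (p.run E h) := by
  induction p generalizing s h with
  | skip => exact ⟨s, .skip s, hs⟩
  | assign x e => exact exec_assign x e hs hp
  | write ρ i e => exact exec_write ρ i e hs hp
  | seq p q ihp ihq =>
    obtain ⟨s₁, hexec₁, hs₁⟩ := ihp hs hp.1
    obtain ⟨s₂, hexec₂, hs₂⟩ := ihq hs₁ hp.2
    exact ⟨s₂, hexec₁.seq hexec₂, hs₂⟩
  | ite e p q ihp ihq =>
    obtain ⟨s₁, hexec₁, hval₁, -, hs₁⟩ := e.exec hs hp.1 (Nat.lt_succ_self _)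
    obtain ⟨-, hp⟩ := hp
    simp only [time, run, Nat.add_assoc, Nat.add_comm 1]
    split_ifs at hp ⊢ with he
    · obtain ⟨s₂, hexec₂, hs₂⟩ := ihp hs₁ hp
      exact ⟨s₂, hexec₁.seq (.ite_true (by rwa [hval₁]) hexec₂), hs₂⟩
    · obtain ⟨s₂, hexec₂, hs₂⟩ := ihq hs₁ hp
      exact ⟨s₂, hexec₁.seq (.ite_false (by rwa [hval₁, ← not_ne_iff]) hexec₂), hs₂⟩
  | forTo x y p ih =>
    obtain ⟨⟨hxy, hx, hy⟩, hp⟩ := hp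
    have hs₁ := hs.setReg_var x (Nat.zero_le _)
    have htest : (if 0 < h.var y then 1 else 0) ≤ E.bound := by
      split_ifs; exacts [E.one_le_bound, Nat.zero_le _]
    have hs₂ := hs₁.setReg_temp (d := baseReg V + 1) (by omega) htest
    obtain ⟨s', hexec', hs'⟩ := exec_loop hxy.symm hy (fun i hi s hs => ih hs (hp i hi)) hx
      (h.var y) 0 (Nat.zero_add _) (s := _) hs₂ (by simp [State.setReg])
    rw [Nat.zero_add] at hs'
    have hlt : Exec E.bound (.arith .lt (baseReg V + 1) (varReg x) (varReg y)) _ _ 1 :=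
      .arith_of_eq (s := s.setReg (varReg x) 0)
        (by simp [State.setReg, ArithOp.eval, varReg_injective.ne hxy.symm, hs.var]) htest
    have htime : (forTo x y p).time E h = 1 + (1 +
        (∑ j ∈ Finset.range (h.var y), (p.time E (round E x p h (0 + j)) + 4) + 1)) := by
      simp only [time, Nat.zero_add]
      omega
    exact ⟨s', htime ▸ (Exec.const (varReg x) 0 s (Nat.zero_le _)).seq (hlt.seq hexec'), hs'⟩

end Cmd

end Compilation

section Triples

variable {V A : Type} [DecidableEq V] [DecidableEq A] [Fintype A] {E : Env A} {h : Store V A}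
  {p q : Cmd V A} {Q Q' : Store V A → ℕ → Prop}

namespace Cmd

/-- Total correctness with running time: from `h`, the program `p` runs safely into a store `h'`
in a time `t` with `Q h' t`. -/
def Ensures (E : Env A) (p : Cmd V A) (h : Store V A) (Q : Store V A → ℕ → Prop) : Prop :=
  p.Safe E h ∧ Q (p.run E h) (p.time E h)

theorem Ensures.mono (hp : p.Ensures E h Q) (hQ : ∀ h' t, Q h' t → Q' h' t) :
    p.Ensures E h Q' :=
  ⟨hp.1, hQ _ _ hp.2⟩

theorem Ensures.frame (hp : p.Ensures E h Q) :
    p.Ensures E h fun h' t => p.Preserves h h' ∧ Q h' t :=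
  ⟨hp.1, ⟨fun _ => run_var, fun _ => run_arr⟩, hp.2⟩

theorem ensures_seq (hp : p.Ensures E h fun h' t => q.Ensures E h' fun h'' t' => Q h'' (t + t')) :
    (p ;; q).Ensures E h Q :=
  ⟨⟨hp.1, hp.2.1⟩, hp.2.2⟩

theorem ensures_skip (hQ : Q h 1) : skip.Ensures E h Q := ⟨trivial, hQ⟩

theorem ensures_assign {x : V} {e : Expr V A} (he : e.Safe E h)
    (hQ : Q (h.set x (e.val E h)) (e.cost + 2)) : (assign x e).Ensures E h Q :=
  ⟨he, hQ⟩

theorem ensures_write {ρ : A} {i e : Expr V A} (hi : i.Safe E h) (he : e.Safe E h)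
    (hcells : i.val E h < E.cells)
    (hQ : Q (h.put ρ (i.val E h) (e.val E h)) (i.cost + e.cost + 6)) :
    (write ρ i e).Ensures E h Q :=
  ⟨⟨hi, he, hcells⟩, hQ⟩

theorem ensures_ite {e : Expr V A} (he : e.Safe E h)
    (hp : e.val E h ≠ 0 → p.Ensures E h fun h' t => Q h' (e.cost + 1 + t))
    (hq : e.val E h = 0 → q.Ensures E h fun h' t => Q h' (e.cost + 1 + t)) :
    (ite e p q).Ensures E h Q := by
  by_cases hval : e.val E h = 0
  · exact ⟨⟨he, by simpa [hval] using (hq hval).1⟩, by simpa [run, time, hval] using (hq hval).2⟩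
  · exact ⟨⟨he, by simpa [hval] using (hp hval).1⟩, by simpa [run, time, hval] using (hp hval).2⟩

/-- `I i h' t` is an invariant for the store and the time before round `i`. -/
theorem ensures_forTo {x y : V} (hxy : x ≠ y) (hx : x ∉ p.assigned) (hy : y ∉ p.assigned)
    (I : ℕ → Store V A → ℕ → Prop) (hzero : I 0 (h.set x 0) 0)
    (hsucc : ∀ i < h.var y, ∀ h' t, (forTo x y p).Preserves h h' → h'.var x = i → I i h' t →
      p.Ensures E h' fun h'' t' => I (i + 1) (h''.set x (i + 1)) (t + (t' + 4)))
    (hQ : ∀ h' t, I (h.var y) h' t → Q h' (t + 3)) :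
    (forTo x y p).Ensures E h Q := by
  have hpres : ∀ i, (forTo x y p).Preserves h (round E x p h i) := fun i =>
    ⟨fun z hz => by
      simp only [assigned, List.mem_cons, not_or] at hz
      exact round_var hz.1 (fun _ => run_var hz.2) i,
    fun ρ hρ => round_arr (fun _ => run_arr (p := p) hρ) x i⟩
  have hround : ∀ i ≤ h.var y, I i (round E x p h i)
      (∑ j ∈ Finset.range i, (p.time E (round E x p h j) + 4)) := by
    intro i hi
    induction i with
    | zero => exact hzero
    | succ i ih =>
      have := (hsucc i hi _ _ (hpres i) (round_var_self x i) (ih (by omega))).2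
      rwa [Finset.sum_range_succ, round_succ, round_var_self]
  exact ⟨⟨⟨hxy, hx, hy⟩, fun i hi =>
    (hsucc i hi _ _ (hpres i) (round_var_self x i) (hround i hi.le)).1⟩,
    hQ _ _ (hround _ le_rfl)⟩

/-- Total correctness of `m` rounds of a loop with counter `x`, started with any value of the
counter. -/
def EnsuresRounds (E : Env A) (x : V) (p : Cmd V A) (m : ℕ) (h : Store V A)
    (Q : Store V A → ℕ → Prop) : Prop :=
  let next h' := (p.run E h').set x (h'.var x + 1)
  (∀ i < m, p.Safe E (next^[i] h)) ∧
    Q (next^[m] h) (∑ i ∈ Finset.range m, (p.time E (next^[i] h) + 4))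

theorem EnsuresRounds.mono {x : V} {m : ℕ} {Q' : Store V A → ℕ → Prop}
    (hp : EnsuresRounds E x p m h Q) (hQ : ∀ h' t, Q h' t → Q' h' t) :
    EnsuresRounds E x p m h Q' :=
  ⟨hp.1, hQ _ _ hp.2⟩

theorem ensuresRounds_one {x : V}
    (hp : p.Ensures E h fun h' t => Q (h'.set x (h.var x + 1)) (t + 4)) :
    EnsuresRounds E x p 1 h Q := by
  simpa [EnsuresRounds, Ensures] using hp

theorem ensuresRounds_add {x : V} {m n : ℕ}
    (hm : EnsuresRounds E x p m h fun h' t =>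
      EnsuresRounds E x p n h' fun h'' t' => Q h'' (t + t')) :
    EnsuresRounds E x p (m + n) h Q := by
  obtain ⟨hsafe, hsafe', hQ⟩ := hm
  refine ⟨fun i hi => ?_, ?_⟩
  · rcases lt_or_ge i m with him | him
    · exact hsafe i him
    · have := hsafe' (i - m) (by omega)
      rwa [← Function.iterate_add_apply, Nat.sub_add_cancel him] at this
  · simpa only [← Function.iterate_add_apply, Nat.add_comm _ m, Finset.sum_range_add] using hQ

theorem ensures_forTo_of_rounds {x y : V} (hxy : x ≠ y) (hx : x ∉ p.assigned)
    (hy : y ∉ p.assigned)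
    (hp : EnsuresRounds E x p (h.var y) (h.set x 0) fun h' t => Q h' (t + 3)) :
    (forTo x y p).Ensures E h Q :=
  ⟨⟨⟨hxy, hx, hy⟩, hp.1⟩, hp.2⟩

end Cmd

/-- The function `f` with its values at `b, …, b + n - 1` replaced by `g 0, …, g (n - 1)`. -/
def fill (f : ℕ → ℕ) (b n : ℕ) (g : ℕ → ℕ) (a : ℕ) : ℕ :=
  if b ≤ a ∧ a < b + n then g (a - b) else f a

theorem fill_zero (f : ℕ → ℕ) (b : ℕ) (g : ℕ → ℕ) : fill f b 0 g = f := by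
  ext a; exact if_neg (by omega)

theorem update_fill (f : ℕ → ℕ) (b n : ℕ) (g : ℕ → ℕ) :
    Function.update (fill f b n g) (b + n) (g n) = fill f b (n + 1) g := by
  ext a
  rcases eq_or_ne a (b + n) with rfl | ha
  · simp [fill]
  · rw [Function.update_of_ne ha]
    exact if_congr (by omega) rfl rfl

theorem fill_add {f : ℕ → ℕ} {b n : ℕ} {g : ℕ → ℕ} {x : ℕ} (hx : x < n) :
    fill f b n g (b + x) = g x := by
  simp [fill, hx]

theorem fill_of_lt {f : ℕ → ℕ} {b n : ℕ} {g : ℕ → ℕ} {a : ℕ} (ha : a < b) :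
    fill f b n g a = f a :=
  if_neg (by omega)

theorem Cmd.ensures_fill {x y : V} {ρ : A} {b T : ℕ} {g : ℕ → ℕ} (hxy : x ≠ y)
    (hx : x ∉ p.assigned) (hy : y ∉ p.assigned)
    (hp : ∀ i < h.var y, ∀ h', (forTo x y p).Preserves h h' → h'.var x = i →
      h'.arr ρ = fill (h.arr ρ) b i g → p.Ensures E h' fun h'' t =>
        h''.arr ρ = Function.update (h'.arr ρ) (b + i) (g i) ∧ t ≤ T) :
    (forTo x y p).Ensures E h fun h' t =>
      h'.arr ρ = fill (h.arr ρ) b (h.var y) g ∧ t ≤ h.var y * (T + 4) + 3 := by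
  refine ensures_forTo hxy hx hy (fun i h' t => h'.arr ρ = fill (h.arr ρ) b i g ∧
    t ≤ i * (T + 4)) ⟨(fill_zero _ _ _).symm, Nat.zero_le _⟩ ?_
    fun h' t ht => ⟨ht.1, Nat.add_le_add_right ht.2 3⟩
  rintro i hi h' t hpres hxi ⟨harr, ht⟩
  refine (hp i hi h' hpres hxi harr).mono ?_
  rintro h'' t' ⟨harr', ht'⟩
  exact ⟨by rw [Store.set_arr, harr', harr, update_fill], by rw [Nat.succ_mul]; omega⟩

end Triples

section Decider

variable {V A : Type} [Fintype V] [Fintype A] [DecidableEq V] [DecidableEq A] {E : Env A}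

/-- Sets register `b` to the length of the input and uses register `b + 1`, for inputs of length
`3 * m + 3` where `m` is the third number. -/
def measureInput (b : ℕ) : Prog :=
  .seq (.const b 2) (.seq (.load b b) (.seq (.const (b + 1) 3)
    (.seq (.arith .mul b b (b + 1)) (.arith .add b b (b + 1)))))

theorem exec_measureInput {W : ℕ} {w : List ℕ} (b : ℕ) (hlen : w.length = 3 * w.getD 2 0 + 3)
    (hW : w.length ≤ W) :
    ∃ s, Exec W (measureInput b) (initial w) s 5 ∧ s.mem = (initial w).mem ∧
      s.reg b = w.length ∧ (∀ x < b, s.reg x = 0) ∧ ∀ x, s.reg x ≤ W := by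
  set m := w.getD 2 0
  refine ⟨_, .seq (.const b 2 _ (by omega)) (.seq
    (.load_of_eq (a := 2) (b := m) (by simp [State.setReg]) rfl (by omega) (by omega))
    (.seq (.const (b + 1) 3 _ (by omega)) (.seq
      (.arith_of_eq (a := m * 3) (by simp [ArithOp.eval, State.setReg]) (by omega))
      (.arith_of_eq (a := m * 3 + 3) (by simp [ArithOp.eval, State.setReg]) (by omega))))), ?_⟩
  refine ⟨rfl, by simp only [State.setReg, Function.update_self]; omega, fun x hx => ?_,
    fun x => ?_⟩
  · simp [State.setReg, initial, hx.ne, show x ≠ b + 1 by omega]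
  · simp only [State.setReg, initial, Function.update_apply]
    split_ifs <;> omega

/-- Runs `p` on the input and answers with the value of `x`. -/
noncomputable def Cmd.decider (p : Cmd V A) (x : V) : Prog :=
  .seq (measureInput (baseReg V)) (.seq p.compile
    (.seq (.const (baseReg V) 0) (.arith .add 0 (varReg x) (baseReg V))))

theorem Cmd.Ensures.answers {p : Cmd V A} {x : V} {w : List ℕ} {T : ℕ} {Q : Prop}
    (hp : p.Ensures E ⟨fun _ => 0, fun _ _ => 0⟩ fun h t =>
      (Q → h.var x = 1) ∧ (¬ Q → h.var x = 0) ∧ t + 7 ≤ T)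
    (hlen : w.length = 3 * w.getD 2 0 + 3) (hE : E.inputLength = w.length)
    (hinput : ∀ i < w.length, E.input i = w.getD i 0) (hbound : ∀ i, w.getD i 0 ≤ E.bound) :
    Answers E.bound (p.decider x) w T Q := by
  have hfits := E.fits
  obtain ⟨s, hs, hmem, hbase, hreg, hreg_le⟩ :=
    exec_measureInput (W := E.bound) (baseReg V) hlen (by omega)
  have hrep : Represents E s (⟨fun _ => 0, fun _ _ => 0⟩ : Store V A) := by
    refine ⟨fun y => hreg _ (varReg_lt y), by rw [hbase, hE], hreg_le, fun ρ i => ?_,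
      fun i hi => ?_, fun a => ?_⟩
    · rw [hmem]
      exact List.getD_eq_default _ _ (by simp [Env.address]; omega)
    · rw [hmem, hinput i (hE ▸ hi)]
      rfl
    · rw [hmem]
      exact hbound a
  obtain ⟨s', hs', hrep'⟩ := p.exec hrep hp.1
  obtain ⟨hyes, hno, ht⟩ := hp.2
  have hne : varReg x ≠ baseReg V := (varReg_lt x).ne
  refine ⟨_, _, .seq hs (.seq hs' (.seq (.const _ 0 _ (Nat.zero_le _))
    (.arith_of_eq (a := s'.reg (varReg x)) (by simp [ArithOp.eval, State.setReg, hne])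
      (hrep'.reg_le _)))),
    by omega, fun hQ => ?_, fun hQ => ?_⟩
  · simpa [State.setReg, hrep'.var] using hyes hQ
  · simpa [State.setReg, hrep'.var] using hno hQ

end Decider

end WordRAM

theorem HasOrientedColoring.of_hom {V V' : Type} {G : Digraph V} {G' : Digraph V'} {r : ℕ}
    (f : V' → V) (hf : ∀ u v, G'.Adj u v → G.Adj (f u) (f v)) (hG : HasOrientedColoring G r) :
    HasOrientedColoring G' r := by
  obtain ⟨c, hne, hop⟩ := hG
  exact ⟨c ∘ f, fun u v huv => hne _ _ (hf u v huv),
    fun u v x y huv hxy => hop _ _ _ _ (hf u v huv) (hf x y hxy)⟩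

namespace OrientedColoring

/-! ### Tables of partial colorings -/

/-- The position of the pair `i < j` in the colexicographic order. -/
def pairIndex (i j : ℕ) : ℕ := j.choose 2 + i

theorem choose_two_succ (j : ℕ) : (j + 1).choose 2 = j + j.choose 2 := by
  rw [Nat.choose_succ_succ' j 1, Nat.choose_one_right]

theorem pairIndex_lt {i j n : ℕ} (hij : i < j) (hjn : j < n) : pairIndex i j < n.choose 2 := by
  have hle := Nat.choose_le_choose 2 (show j + 1 ≤ n from hjn)
  rw [choose_two_succ] at hle
  unfold pairIndex
  omega

theorem pairIndex_injective {i j i' j' : ℕ} (hij : i < j) (hij' : i' < j')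
    (h : pairIndex i j = pairIndex i' j') : i = i' ∧ j = j' := by
  rcases lt_trichotomy j j' with hj | rfl | hj
  · have := pairIndex_lt hij hj; unfold pairIndex at *; omega
  · unfold pairIndex at h; omega
  · have := pairIndex_lt hij' hj; unfold pairIndex at *; omega

theorem block_injective {r s t i j : ℕ} (hi : i < r) (hj : j < r) (h : r * s + i = r * t + j) :
    s = t ∧ i = j := by
  have hst : s = t := by
    simpa [Nat.mul_add_div (Nat.zero_lt_of_lt hi), Nat.div_eq_of_lt, hi, hj] using
      congrArg (· / r) h
  subst hst
  exact ⟨rfl, Nat.add_left_cancel h⟩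

theorem block_le {r s k : ℕ} (hs : s < k) : r * s + r ≤ r * k :=
  Nat.mul_le_mul_left r hs

/-- The `s`-th digit of `x` in base `2 ^ r`, whose bits tell which of the `r` colors are allowed in
slot `s`. -/
def colorSet (r x s : ℕ) : ℕ := x / 2 ^ (r * s) % 2 ^ r

theorem colorSet_lt (r x s : ℕ) : colorSet r x s < 2 ^ r := Nat.mod_lt _ (Nat.two_pow_pos r)

theorem testBit_colorSet {r i : ℕ} (hi : i < r) (x s : ℕ) :
    (colorSet r x s).testBit i = x.testBit (r * s + i) := by
  simp [colorSet, Nat.testBit_mod_two_pow, Nat.testBit_div_two_pow, hi, Nat.add_comm]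

theorem colorSet_eq_zero_iff {r x s : ℕ} :
    colorSet r x s = 0 ↔ ∀ i < r, x.testBit (r * s + i) = false := by
  refine ⟨fun h i hi => by rw [← testBit_colorSet hi, h, Nat.zero_testBit], fun h => ?_⟩
  refine Nat.eq_of_testBit_eq fun i => ?_
  by_cases hi : i < r
  · rw [testBit_colorSet hi, h i hi, Nat.zero_testBit]
  · simp [colorSet, Nat.testBit_mod_two_pow, hi]

/-- `x` with the color set of slot `s` replaced by `D`. -/
def setColorSet (r s D x : ℕ) : ℕ := x - colorSet r x s * 2 ^ (r * s) + D * 2 ^ (r * s)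

theorem testBit_setColorSet {r D : ℕ} (hD : D < 2 ^ r) (s x m : ℕ) :
    (setColorSet r s D x).testBit m =
      if r * s ≤ m ∧ m < r * s + r then D.testBit (m - r * s) else x.testBit m := by
  set low := x % 2 ^ (r * s)
  set high := x / 2 ^ (r * s) / 2 ^ r
  have hlow : low < 2 ^ (r * s) := Nat.mod_lt _ (by positivity)
  have hx : x = 2 ^ (r * s) * (2 ^ r * high + colorSet r x s) + low := by
    rw [colorSet, Nat.div_add_mod, Nat.div_add_mod]
  have hset : setColorSet r s D x = 2 ^ (r * s) * (2 ^ r * high + D) + low := by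
    have hsub : x - colorSet r x s * 2 ^ (r * s) = 2 ^ (r * s) * (2 ^ r * high) + low := by
      conv_lhs => enter [1]; rw [hx]
      rw [Nat.mul_add, Nat.mul_comm (colorSet r x s)]
      omega
    rw [setColorSet, hsub]
    ring
  rw [hset, Nat.testBit_two_pow_mul_add _ hlow, Nat.testBit_two_pow_mul_add _ hD]
  conv_rhs => rw [hx, Nat.testBit_two_pow_mul_add _ hlow,
    Nat.testBit_two_pow_mul_add _ (colorSet_lt r x s)]
  split_ifs <;> first | rfl | omega

theorem testBit_setColorSet_self {r D i : ℕ} (hD : D < 2 ^ r) (hi : i < r) (s x : ℕ) :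
    (setColorSet r s D x).testBit (r * s + i) = D.testBit i := by
  rw [testBit_setColorSet hD, if_pos (by omega), Nat.add_sub_cancel_left]

theorem testBit_setColorSet_of_ne {r s t D i : ℕ} (hD : D < 2 ^ r) (hi : i < r) (hst : s ≠ t)
    (x : ℕ) : (setColorSet r s D x).testBit (r * t + i) = x.testBit (r * t + i) := by
  rw [testBit_setColorSet hD, if_neg]
  rintro ⟨hle, hlt⟩
  exact hst (block_injective (i := r * t + i - r * s) (by omega) hi (by omega)).1

theorem testBit_sub_two_pow {x n : ℕ} (h : x.testBit n = true) (m : ℕ) :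
    (x - 2 ^ n).testBit m = (decide (m ≠ n) && x.testBit m) := by
  have hset : x - 2 ^ n = setColorSet 1 n 0 x := by
    rw [Nat.testBit_eq_decide_div_mod_eq, decide_eq_true_eq] at h
    simp [setColorSet, colorSet, h]
  rw [hset, testBit_setColorSet (by norm_num)]
  by_cases hm : m = n
  · simp [hm]
  · rw [if_neg (by omega)]; simp [hm]

/-- `x` and `y` encode the same tournament. -/
def SameTournament (r k x y : ℕ) : Prop := ∀ m, r * k ≤ m → x.testBit m = y.testBit m

theorem sameTournament_setColorSet {r k s D : ℕ} (hs : s < k) (hD : D < 2 ^ r) (x : ℕ) :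
    SameTournament r k (setColorSet r s D x) x := fun m hm => by
  have := block_le (r := r) hs
  rw [testBit_setColorSet hD, if_neg (by omega)]

theorem sameTournament_sub_two_pow {r k s i x : ℕ} (hs : s < k) (hi : i < r)
    (hx : x.testBit (r * s + i) = true) :
    SameTournament r k (x - 2 ^ (r * s + i)) x := fun m hm => by
  have := block_le (r := r) hs
  rw [testBit_sub_two_pow hx, decide_eq_true (by omega), Bool.true_and]

/-- The number of entries of a table: an entry is a number whose lowest `r * k` bits are `k` sets of
colors and whose further bits are a tournament on the `r` colors. -/
def tableSize (r k : ℕ) : ℕ := 2 ^ (r * k + r.choose 2)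

theorem SameTournament.lt_tableSize {r k x y : ℕ} (h : SameTournament r k x y)
    (hy : y < tableSize r k) : x < tableSize r k :=
  Nat.lt_pow_two_of_testBit x fun m hm => (h m (by omega)).trans
    (Nat.testBit_lt_two_pow (hy.trans_le (Nat.pow_le_pow_right two_pos hm)))

/-- The arc relation of the tournament on the colors that is encoded by `x`. -/
def Dominates (r k x i j : ℕ) : Prop :=
  i < j ∧ x.testBit (r * k + pairIndex i j) = true ∨
    j < i ∧ x.testBit (r * k + pairIndex j i) = false

theorem SameTournament.dominates_iff {r k x y : ℕ} (h : SameTournament r k x y) (i j : ℕ) :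
    Dominates r k x i j ↔ Dominates r k y i j := by
  rw [Dominates, Dominates, h _ (Nat.le_add_right _ _), h _ (Nat.le_add_right _ _)]

theorem not_dominates_self (r k x i : ℕ) : ¬ Dominates r k x i i := by
  rintro (⟨h, -⟩ | ⟨h, -⟩) <;> exact lt_irrefl _ h

theorem Dominates.asymm {r k x i j : ℕ} (h : Dominates r k x i j) : ¬ Dominates r k x j i := by
  rintro (⟨hlt, hbit⟩ | ⟨hlt, hbit⟩) <;> rcases h with ⟨hlt', hbit'⟩ | ⟨hlt', hbit'⟩
  · omega
  · exact Bool.false_ne_true (hbit'.symm.trans hbit)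
  · exact Bool.false_ne_true (hbit.symm.trans hbit')
  · omega

theorem div_two_pow_mod_two {x n : ℕ} : x / 2 ^ n % 2 = 1 ↔ x.testBit n = true := by
  rw [Nat.testBit_eq_decide_div_mod_eq, decide_eq_true_eq]

theorem not_dominates_of_lt {r k x i j : ℕ} (hij : i < j) :
    ¬ Dominates r k x i j ↔ x / 2 ^ (r * k + pairIndex i j) % 2 = 0 := by
  rw [← Nat.mod_two_ne_one, Ne, div_two_pow_mod_two]
  simp [Dominates, hij, hij.not_gt]

theorem not_dominates_of_gt {r k x i j : ℕ} (hij : i < j) :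
    ¬ Dominates r k x j i ↔ x / 2 ^ (r * k + pairIndex i j) % 2 = 1 := by
  rw [div_two_pow_mod_two]
  simp [Dominates, hij, hij.not_gt]

/-- `c` is a homomorphism into the tournament encoded by `x`, and each vertex `v` has a color
that `x` allows in slot `σ v`. -/
structure Colors (r k x : ℕ) {V : Type} (Arc : V → V → Prop) (σ c : V → ℕ) : Prop where
  lt : ∀ v, c v < r
  mem : ∀ v, x.testBit (r * σ v + c v) = true
  hom : ∀ u v, Arc u v → Dominates r k x (c u) (c v)

/-- `b` is `1` if `P` is true and `0` if `P` is false. -/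
def IsTruthValue (b : ℕ) (P : Prop) : Prop := (P → b = 1) ∧ (¬ P → b = 0)

namespace IsTruthValue

variable {b b' : ℕ} {P P' : Prop}

theorem le_one (h : IsTruthValue b P) : b ≤ 1 := by
  by_cases hP : P
  · exact (h.1 hP).le
  · exact (h.2 hP).le.trans zero_le_one

theorem congr (h : IsTruthValue b P) (hP : P ↔ P') : IsTruthValue b P' := propext hP ▸ h

theorem of_iff [Decidable P] (h : P ↔ P') : IsTruthValue (if P then 1 else 0) P' :=
  ⟨fun hP => if_pos (h.2 hP), fun hP => if_neg (mt h.1 hP)⟩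

theorem eq_one_iff (h : IsTruthValue b P) : b = 1 ↔ P :=
  ⟨fun hb => by_contra fun hP => zero_ne_one ((h.2 hP).symm.trans hb), h.1⟩

theorem pos_iff (h : IsTruthValue b P) : 0 < b ↔ P := by
  rw [← h.eq_one_iff]; have := h.le_one; omega

theorem mul (h : IsTruthValue b P) (h' : IsTruthValue b' P') : IsTruthValue (b * b') (P ∧ P') := by
  refine ⟨fun hP => by rw [h.1 hP.1, h'.1 hP.2], fun hP => ?_⟩
  rcases not_and_or.1 hP with hP | hP
  · rw [h.2 hP, zero_mul]
  · rw [h'.2 hP, mul_zero]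

theorem or (h : IsTruthValue b P) (h' : IsTruthValue b' P') :
    IsTruthValue (if 0 < b + b' then 1 else 0) (P ∨ P') :=
  of_iff (by rw [Nat.add_pos_iff_pos_or_pos, h.pos_iff, h'.pos_iff])

end IsTruthValue

/-- `T` says for which tournaments and sets of colors there is a coloring. -/
def IsTable (r k : ℕ) (T : ℕ → ℕ) {V : Type} (Arc : V → V → Prop) (σ : V → ℕ) : Prop :=
  ∀ x < tableSize r k, IsTruthValue (T x) (∃ c, Colors r k x Arc σ c)

/-- The arcs of a disjoint union. -/
def sumArc {V V' : Type} (Arc : V → V → Prop) (Arc' : V' → V' → Prop) : V ⊕ V' → V ⊕ V' → Prop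
  | Sum.inl u, Sum.inl v => Arc u v
  | Sum.inr u, Sum.inr v => Arc' u v
  | _, _ => False

section Table

variable {r k : ℕ} {T T' : ℕ → ℕ} {V V' : Type} {Arc : V → V → Prop} {Arc' : V' → V' → Prop}
  {σ : V → ℕ} {σ' : V' → ℕ}

theorem isTable_vertex (r k a : ℕ) :
    IsTable r k (fun x => if 0 < colorSet r x a then 1 else 0)
      (fun _ _ : Unit => False) (fun _ => a) := fun x _ => .of_iff <| by
  rw [Nat.pos_iff_ne_zero, Ne, colorSet_eq_zero_iff]
  push Not
  constructor
  · rintro ⟨i, hi, hbit⟩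
    exact ⟨fun _ => i, fun _ => hi, fun _ => by simpa using hbit, fun _ _ h => h.elim⟩
  · rintro ⟨c, hc⟩
    exact ⟨c (), hc.lt (), by simpa using hc.mem ()⟩

theorem IsTable.union (h : IsTable r k T Arc σ) (h' : IsTable r k T' Arc' σ') :
    IsTable r k (fun x => T x * T' x) (sumArc Arc Arc') (Sum.elim σ σ') := by
  intro x hx
  refine ((h x hx).mul (h' x hx)).congr ⟨?_, ?_⟩
  · rintro ⟨⟨c, hc⟩, c', hc'⟩
    refine ⟨Sum.elim c c', Sum.rec hc.lt hc'.lt, Sum.rec hc.mem hc'.mem, ?_⟩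
    rintro (u | u) (v | v) huv
    exacts [hc.hom u v huv, huv.elim, huv.elim, hc'.hom u v huv]
  · rintro ⟨c, hc⟩
    exact ⟨⟨c ∘ Sum.inl, fun v => hc.lt (.inl v), fun v => hc.mem (.inl v),
      fun u v huv => hc.hom (.inl u) (.inl v) huv⟩, c ∘ Sum.inr, fun v => hc.lt (.inr v),
      fun v => hc.mem (.inr v), fun u v huv => hc.hom (.inr u) (.inr v) huv⟩

theorem Colors.congr {τ c : V → ℕ} {x y : ℕ} (h : Colors r k x Arc σ c)
    (hxy : SameTournament r k x y)
    (hslot : ∀ v, ∀ i < r, x.testBit (r * σ v + i) = y.testBit (r * τ v + i)) :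
    Colors r k y Arc τ c where
  lt := h.lt
  mem v := hslot v _ (h.lt v) ▸ h.mem v
  hom u v huv := (hxy.dominates_iff _ _).1 (h.hom u v huv)

theorem IsTable.comp {τ : V → ℕ} {f : ℕ → ℕ} (h : IsTable r k T Arc σ)
    (hf : ∀ x, SameTournament r k (f x) x)
    (hslot : ∀ x v, ∀ i < r, (f x).testBit (r * σ v + i) = x.testBit (r * τ v + i)) :
    IsTable r k (T ∘ f) Arc τ := fun x hx =>
  (h _ ((hf x).lt_tableSize hx)).congr <| exists_congr fun _ =>
    ⟨fun hc => hc.congr (hf x) (hslot x),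
      fun hc => hc.congr (fun m hm => (hf x m hm).symm) fun v i hi => (hslot x v i hi).symm⟩

theorem IsTable.congr {τ : V → ℕ} {Arc'' : V → V → Prop} (h : IsTable r k T Arc σ)
    (hArc : ∀ u v, Arc u v ↔ Arc'' u v) (hτ : ∀ v, σ v = τ v) : IsTable r k T Arc'' τ := by
  obtain rfl : Arc = Arc'' := funext₂ fun u v => propext (hArc u v)
  obtain rfl : σ = τ := funext hτ
  exact h

/-! ### Changing the slots -/

/-- `x` with the color set of slot `s` replaced by that of slot `t`. -/
def copySlot (r s t x : ℕ) : ℕ := setColorSet r s (colorSet r x t) x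

theorem sameTournament_copySlot {s : ℕ} (hs : s < k) (t x : ℕ) :
    SameTournament r k (copySlot r s t x) x :=
  sameTournament_setColorSet hs (colorSet_lt r x t) x

theorem testBit_copySlot {i s u : ℕ} (hi : i < r) (t x : ℕ) :
    (copySlot r s t x).testBit (r * u + i) = x.testBit (r * (if u = s then t else u) + i) := by
  by_cases hu : u = s
  · rw [if_pos hu, hu, copySlot, testBit_setColorSet_self (colorSet_lt r x t) hi,
      testBit_colorSet hi]
  · rw [if_neg hu, copySlot, testBit_setColorSet_of_ne (colorSet_lt r x t) hi (Ne.symm hu)]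

theorem copySlot_copySlot (r s t x : ℕ) : copySlot r s t (copySlot r s t x) = copySlot r s t x := by
  refine Nat.eq_of_testBit_eq fun m => ?_
  rw [copySlot, testBit_setColorSet (colorSet_lt r _ t)]
  split_ifs with hm
  · have hi : m - r * s < r := by omega
    rw [testBit_colorSet hi, testBit_copySlot hi, show m = r * s + (m - r * s) by omega,
      testBit_copySlot hi, if_pos rfl, Nat.add_sub_cancel_left]
    split_ifs with h <;> simp [h]
  · rfl

theorem IsTable.copySlot {s : ℕ} (t : ℕ) (hs : s < k) (h : IsTable r k T Arc σ) :
    IsTable r k (T ∘ copySlot r s t) Arc (fun v => if σ v = s then t else σ v) :=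
  h.comp (sameTournament_copySlot hs t) fun x _ _ hi => testBit_copySlot hi t x

/-- `slot` is injective on the labels in use; `slot a = k` stands for a label `a` not in use. -/
def SlotInj (k : ℕ) (slot : ℕ → ℕ) : Prop :=
  ∀ a < k, ∀ b < k, slot a < k → slot a = slot b → a = b

/-- The entry that encodes the same tournament as `x` and in which the color set of slot `slot a` is
that of slot `a` in `x`, for all labels `a < n` in use. -/
def permute (r k : ℕ) (slot : ℕ → ℕ) (x n : ℕ) : ℕ :=
  x / 2 ^ (r * k) * 2 ^ (r * k) +
    ∑ a ∈ Finset.range n, colorSet r x a * if slot a < k then 2 ^ (r * slot a) else 0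

theorem permute_succ_of_unused {slot : ℕ → ℕ} {n : ℕ} (hn : ¬ slot n < k) (x : ℕ) :
    permute r k slot x (n + 1) = permute r k slot x n := by
  simp [permute, Finset.sum_range_succ, hn]

theorem permute_succ {slot : ℕ → ℕ} {x n : ℕ} (hn : slot n < k)
    (hzero : colorSet r (permute r k slot x n) (slot n) = 0) :
    permute r k slot x (n + 1) =
      setColorSet r (slot n) (colorSet r x n) (permute r k slot x n) := by
  rw [setColorSet, hzero, zero_mul, Nat.sub_zero, permute, permute, Finset.sum_range_succ,
    if_pos hn, ← Nat.add_assoc]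

theorem testBit_permute_zero (slot : ℕ → ℕ) (x m : ℕ) :
    (permute r k slot x 0).testBit m = (decide (r * k ≤ m) && x.testBit m) := by
  rw [permute, Finset.sum_range_zero, Nat.add_zero, Nat.testBit_mul_two_pow,
    Nat.testBit_div_two_pow]
  by_cases hm : r * k ≤ m
  · rw [Nat.sub_add_cancel hm]
  · simp [hm]

theorem SlotInj.colorSet_permute_eq_zero {slot : ℕ → ℕ} (hinj : SlotInj k slot) (x : ℕ) {n s : ℕ}
    (hn : n ≤ k) (hs : s < k) (hne : ∀ a < n, slot a ≠ s) :
    colorSet r (permute r k slot x n) s = 0 := by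
  have hblock := block_le (r := r) hs
  induction n generalizing s with
  | zero =>
    refine colorSet_eq_zero_iff.2 fun i hi => ?_
    rw [testBit_permute_zero, decide_eq_false (by omega), Bool.false_and]
  | succ n ih =>
    by_cases hused : slot n < k
    · have hzero := ih (by omega) hused
        (fun a ha h => ha.ne (hinj a (by omega) n (by omega) (h ▸ hused) h)) (block_le hused)
      have hzero' := colorSet_eq_zero_iff.1 (ih (by omega) hs (fun a ha => hne a (by omega)) hblock)
      refine colorSet_eq_zero_iff.2 fun i hi => ?_
      rw [permute_succ hused hzero, testBit_setColorSet_of_ne (colorSet_lt r x n) hi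
        (hne n (Nat.lt_succ_self n)), hzero' i hi]
    · rw [permute_succ_of_unused hused]
      exact ih (by omega) hs (fun a ha => hne a (by omega)) hblock

theorem SlotInj.permute_succ {slot : ℕ → ℕ} (hinj : SlotInj k slot) (x : ℕ) {n : ℕ} (hn : n < k)
    (hused : slot n < k) : permute r k slot x (n + 1) =
      setColorSet r (slot n) (colorSet r x n) (permute r k slot x n) :=
  OrientedColoring.permute_succ hused <| hinj.colorSet_permute_eq_zero x hn.le hused
    fun a ha h => ha.ne (hinj a (ha.trans hn) n hn (h ▸ hused) h)

theorem SlotInj.sameTournament_permute {slot : ℕ → ℕ} (hinj : SlotInj k slot) (x : ℕ) {n : ℕ}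
    (hn : n ≤ k) : SameTournament r k (permute r k slot x n) x := by
  induction n with
  | zero =>
    intro m hm
    rw [testBit_permute_zero, decide_eq_true hm, Bool.true_and]
  | succ n ih =>
    by_cases hused : slot n < k
    · intro m hm
      rw [hinj.permute_succ x hn hused,
        sameTournament_setColorSet hused (colorSet_lt r x n) _ m hm, ih (by omega) m hm]
    · rw [permute_succ_of_unused hused]
      exact ih (by omega)

theorem SlotInj.testBit_permute {slot : ℕ → ℕ} (hinj : SlotInj k slot) (x : ℕ) {n a i : ℕ}
    (hn : n ≤ k) (ha : a < n) (hused : slot a < k) (hi : i < r) :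
    (permute r k slot x n).testBit (r * slot a + i) = x.testBit (r * a + i) := by
  induction n with
  | zero => exact absurd ha (Nat.not_lt_zero a)
  | succ n ih =>
    by_cases hused' : slot n < k
    · rw [hinj.permute_succ x hn hused']
      rcases eq_or_ne a n with rfl | han
      · rw [testBit_setColorSet_self (colorSet_lt r x a) hi, testBit_colorSet hi]
      · rw [testBit_setColorSet_of_ne (colorSet_lt r x n) hi
          (fun h => han (hinj a (by omega) n (by omega) hused h.symm)), ih (by omega) (by omega)]
    · rw [permute_succ_of_unused hused']
      exact ih (by omega) ((Nat.lt_succ_iff.1 ha).lt_of_ne fun h => hused' (h ▸ hused))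

theorem SlotInj.permute_lt {slot : ℕ → ℕ} (hinj : SlotInj k slot) {x n : ℕ} (hn : n ≤ k)
    (hx : x < tableSize r k) : permute r k slot x n < tableSize r k :=
  (hinj.sameTournament_permute x hn).lt_tableSize hx

theorem IsTable.permute {slot : ℕ → ℕ} {lab : V → ℕ} (hinj : SlotInj k slot)
    (hlab : ∀ v, lab v < k ∧ slot (lab v) < k)
    (h : IsTable r k T Arc (fun v => slot (lab v))) :
    IsTable r k (fun x => T (permute r k slot x k)) Arc lab :=
  h.comp (fun x => hinj.sameTournament_permute x le_rfl) fun x v _ hi =>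
    hinj.testBit_permute x le_rfl (hlab v).1 (hlab v).2 hi

/-! ### Insertion of arcs -/

/-- No two vertices `u` and `v` in the slots `s` and `t` have colors related by `K`. -/
def Avoids (σ : V → ℕ) (s t : ℕ) (K : ℕ → ℕ → Prop) (c : V → ℕ) : Prop :=
  ∀ u v, σ u = s → σ v = t → ¬ K (c u) (c v)

theorem avoids_or_iff {s t i j : ℕ} {K : ℕ → ℕ → Prop} {c : V → ℕ} :
    Avoids σ s t (fun a b => K a b ∨ a = i ∧ b = j) c ↔ Avoids σ s t K c ∧
      ((∀ u, σ u = s → c u ≠ i) ∨ ∀ v, σ v = t → c v ≠ j) := by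
  constructor
  · refine fun h => ⟨fun u v hu hv hK => h u v hu hv (.inl hK), ?_⟩
    by_contra! hcon
    obtain ⟨⟨u, hu, hui⟩, v, hv, hvj⟩ := hcon
    exact h u v hu hv (.inr ⟨hui, hvj⟩)
  · rintro ⟨hK, hij⟩ u v hu hv (hKuv | ⟨hui, hvj⟩)
    · exact hK u v hu hv hKuv
    · exact hij.elim (fun h => h u hu hui) fun h => h v hv hvj

/-- `T` says for which tournaments and sets of colors there is a coloring in which the vertices of
the slots `s` and `t` avoid the pairs of colors in `K`. -/
def IsTableAvoiding (r k : ℕ) (T : ℕ → ℕ) (Arc : V → V → Prop) (σ : V → ℕ) (s t : ℕ)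
    (K : ℕ → ℕ → ℕ → Prop) : Prop :=
  ∀ x < tableSize r k,
    IsTruthValue (T x) (∃ c, Colors r k x Arc σ c ∧ Avoids σ s t (K x) c)

theorem IsTableAvoiding.congr {s t : ℕ} {K K' : ℕ → ℕ → ℕ → Prop}
    (h : IsTableAvoiding r k T Arc σ s t K)
    (hK : ∀ x < tableSize r k, ∀ i < r, ∀ j < r, K x i j ↔ K' x i j) :
    IsTableAvoiding r k T Arc σ s t K' := fun x hx =>
  (h x hx).congr <| exists_congr fun _ => and_congr_right fun hc => forall₂_congr fun u v => by
    rw [hK x hx _ (hc.lt u) _ (hc.lt v)]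

theorem colors_sub_two_pow_iff {x s i : ℕ} {c : V → ℕ} (hs : s < k) (hi : i < r)
    (hx : x.testBit (r * s + i) = true) :
    Colors r k (x - 2 ^ (r * s + i)) Arc σ c ↔
      Colors r k x Arc σ c ∧ ∀ v, σ v = s → c v ≠ i := by
  have hbit := testBit_sub_two_pow hx
  have htour := sameTournament_sub_two_pow hs hi hx
  constructor
  · intro hc
    have hmem v := Bool.and_eq_true_iff.1 (hbit _ ▸ hc.mem v)
    exact ⟨⟨hc.lt, fun v => (hmem v).2, fun u v huv =>
      (htour.dominates_iff _ _).1 (hc.hom u v huv)⟩,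
      fun v hv hvi => of_decide_eq_true (hmem v).1 (by rw [hv, hvi])⟩
  · refine fun ⟨hc, hne⟩ => ⟨hc.lt, fun v => ?_,
      fun u v huv => (htour.dominates_iff _ _).2 (hc.hom u v huv)⟩
    rw [hbit, hc.mem v, Bool.and_true, decide_eq_true_eq]
    intro heq
    obtain ⟨hslot, hcolor⟩ := block_injective (hc.lt v) hi heq
    exact hne v hslot hcolor

/-- The table after the pair of colors with bits `p` and `q` has been forbidden in the tournaments
in which the bit `w` is `z`: at the entries that allow both colors, one of them is dropped. -/
def forbid (p q w z : ℕ) (T : ℕ → ℕ) (x : ℕ) : ℕ :=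
  if x / p % 2 = 1 ∧ x / q % 2 = 1 ∧ x / w % 2 = z then
    if 0 < T (x - p) + T (x - q) then 1 else 0
  else T x

theorem sub_two_pow_div_mod_two {x n : ℕ} (hx : x / 2 ^ n % 2 = 1) :
    (x - 2 ^ n) / 2 ^ n % 2 ≠ 1 := by
  rw [Ne, div_two_pow_mod_two, testBit_sub_two_pow (div_two_pow_mod_two.1 hx)]
  simp

theorem forbid_sub_left {x n q w z : ℕ} (hx : x / 2 ^ n % 2 = 1) (T : ℕ → ℕ) :
    forbid (2 ^ n) q w z T (x - 2 ^ n) = T (x - 2 ^ n) :=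
  if_neg fun h => sub_two_pow_div_mod_two hx h.1

theorem forbid_sub_right {x n p w z : ℕ} (hx : x / 2 ^ n % 2 = 1) (T : ℕ → ℕ) :
    forbid p (2 ^ n) w z T (x - 2 ^ n) = T (x - 2 ^ n) :=
  if_neg fun h => sub_two_pow_div_mod_two hx h.2.1

theorem IsTableAvoiding.drop_color {x s t s' i : ℕ} {K : ℕ → ℕ → ℕ → Prop} (hs' : s' < k)
    (hi : i < r) (hx : x < tableSize r k) (hbit : x.testBit (r * s' + i) = true)
    (hK : ∀ y, SameTournament r k y x → K y = K x)
    (h : IsTableAvoiding r k T Arc σ s t K) :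
    IsTruthValue (T (x - 2 ^ (r * s' + i)))
      (∃ c, (Colors r k x Arc σ c ∧ ∀ v, σ v = s' → c v ≠ i) ∧ Avoids σ s t (K x) c) := by
  have h' := h _ ((Nat.sub_le x (2 ^ (r * s' + i))).trans_lt hx)
  simpa only [colors_sub_two_pow_iff hs' hi hbit,
    hK _ (sameTournament_sub_two_pow hs' hi hbit)] using h'

theorem IsTableAvoiding.forbid {s t i j n z : ℕ} {K : ℕ → ℕ → ℕ → Prop} (hs : s < k) (ht : t < k)
    (hi : i < r) (hj : j < r) (hK : ∀ x y, SameTournament r k x y → K x = K y)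
    (h : IsTableAvoiding r k T Arc σ s t K) :
    IsTableAvoiding r k (forbid (2 ^ (r * s + i)) (2 ^ (r * t + j)) (2 ^ n) z T) Arc σ s t
      (fun x a b => K x a b ∨ x / 2 ^ n % 2 = z ∧ a = i ∧ b = j) := by
  intro x hx
  rw [OrientedColoring.forbid]
  by_cases hcond : x / 2 ^ (r * s + i) % 2 = 1 ∧ x / 2 ^ (r * t + j) % 2 = 1 ∧ x / 2 ^ n % 2 = z
  · rw [if_pos hcond]
    obtain ⟨hp, hq, hw⟩ := hcond
    rw [div_two_pow_mod_two] at hp hq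
    refine ((h.drop_color hs hi hx hp (fun y => hK y x)).or
      (h.drop_color ht hj hx hq fun y => hK y x)).congr ?_
    rw [← exists_or]
    refine exists_congr fun c => ?_
    simp only [hw, true_and, avoids_or_iff]
    tauto
  · rw [if_neg hcond]
    refine (h x hx).congr <| exists_congr fun c => and_congr_right fun hc => ?_
    refine ⟨fun hav u v hu hv => not_or.2 ⟨hav u v hu hv, ?_⟩,
      fun hav u v hu hv => (not_or.1 (hav u v hu hv)).1⟩
    rintro ⟨hw, hui, hvj⟩
    exact hcond ⟨div_two_pow_mod_two.2 (hu ▸ hui ▸ hc.mem u),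
      div_two_pow_mod_two.2 (hv ▸ hvj ▸ hc.mem v), hw⟩

/-- The pairs of colors that are forbidden when the loops over the pairs of colors have reached `j`
and `i`. -/
def Forbidden (r k j i x a b : ℕ) : Prop :=
  ¬ Dominates r k x a b ∧ (a < j ∧ b < j ∨ a < i ∧ b = j ∨ a = j ∧ b < i)

theorem SameTournament.forbidden_eq {x y : ℕ} (h : SameTournament r k x y) (j i : ℕ) :
    Forbidden r k j i x = Forbidden r k j i y := by
  ext a b; rw [Forbidden, Forbidden, h.dominates_iff]

theorem forbidden_succ_iff {i j x a b : ℕ} (hij : i < j) :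
    Forbidden r k j (i + 1) x a b ↔
      (Forbidden r k j i x a b ∨ x / 2 ^ (r * k + pairIndex i j) % 2 = 0 ∧ a = i ∧ b = j) ∨
        x / 2 ^ (r * k + pairIndex i j) % 2 = 1 ∧ a = j ∧ b = i := by
  rw [← not_dominates_of_lt hij, ← not_dominates_of_gt hij]
  constructor
  · rintro ⟨hdom, hlt⟩
    by_cases hab : a = i ∧ b = j
    · exact .inl (.inr ⟨by rwa [hab.1, hab.2] at hdom, hab⟩)
    by_cases hba : a = j ∧ b = i
    · exact .inr ⟨by rwa [hba.1, hba.2] at hdom, hba⟩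
    exact .inl (.inl ⟨hdom, by omega⟩)
  · rintro ((⟨hdom, hlt⟩ | ⟨hdom, rfl, rfl⟩) | ⟨hdom, rfl, rfl⟩)
    · exact ⟨hdom, by omega⟩
    · exact ⟨hdom, by omega⟩
    · exact ⟨hdom, by omega⟩

theorem forbidden_succ_zero_iff {j x a b : ℕ} (hx : x < tableSize r k) :
    Forbidden r k (j + 1) 0 x a b ↔
      Forbidden r k j j x a b ∨ x / tableSize r k % 2 = 0 ∧ a = j ∧ b = j := by
  simp only [Nat.div_eq_of_lt hx, Nat.zero_mod, true_and]
  constructor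
  · rintro ⟨hdom, hlt⟩
    by_cases hab : a = j ∧ b = j
    · exact .inr hab
    · exact .inl ⟨hdom, by omega⟩
  · rintro (⟨hdom, hlt⟩ | ⟨rfl, rfl⟩)
    · exact ⟨hdom, by omega⟩
    · exact ⟨not_dominates_self _ _ _ _, by omega⟩

theorem IsTable.avoiding (h : IsTable r k T Arc σ) (s t : ℕ) :
    IsTableAvoiding r k T Arc σ s t (Forbidden r k 0 0) := fun x hx =>
  (h x hx).congr (exists_congr fun c => by simp [Forbidden, Avoids])

theorem IsTableAvoiding.isTable {s t : ℕ}
    (h : IsTableAvoiding r k T Arc σ s t (Forbidden r k r 0)) :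
    IsTable r k T (fun u v => Arc u v ∨ (σ u = s ∧ σ v = t)) σ := by
  refine fun x hx => (h x hx).congr <| exists_congr fun c => ⟨fun ⟨hc, hav⟩ => ⟨hc.lt, hc.mem, ?_⟩,
    fun hc => ⟨⟨hc.lt, hc.mem, fun u v huv => hc.hom u v (.inl huv)⟩, fun u v hu hv hf =>
      hf.1 (hc.hom u v (.inr ⟨hu, hv⟩))⟩⟩
  rintro u v (huv | ⟨hu, hv⟩)
  · exact hc.hom u v huv
  · by_contra hdom
    exact hav u v hu hv ⟨hdom, .inl ⟨hc.lt u, hc.lt v⟩⟩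

/-! ### The answer -/

/-- The entry of a table for the tournament with the bits of `t` and all colors allowed in all
slots. -/
def fullEntry (r k t : ℕ) : ℕ := 2 ^ (r * k) * t + (2 ^ (r * k) - 1)

theorem testBit_fullEntry (r k t m : ℕ) : (fullEntry r k t).testBit m =
    if m < r * k then true else t.testBit (m - r * k) := by
  rw [fullEntry, Nat.testBit_two_pow_mul_add _ (Nat.sub_one_lt (Nat.two_pow_pos _).ne')]
  split_ifs with h
  · rw [Nat.testBit_two_pow_sub_one, decide_eq_true h]
  · rfl

theorem tableSize_eq (r k : ℕ) : tableSize r k = 2 ^ (r * k) * 2 ^ r.choose 2 := pow_add ..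

theorem fullEntry_lt {t : ℕ} (ht : t < 2 ^ r.choose 2) : fullEntry r k t < tableSize r k := by
  have hpos := Nat.two_pow_pos (r * k)
  have hle := Nat.mul_le_mul_left (2 ^ (r * k)) (Nat.succ_le_of_lt ht)
  rw [Nat.mul_succ] at hle
  rw [tableSize_eq, fullEntry]
  omega

theorem exists_testBit_iff (P : ℕ → Prop) (n : ℕ) :
    ∃ t < 2 ^ n, ∀ m < n, t.testBit m = true ↔ P m := by
  classical
  refine ⟨Nat.ofBits (n := n) fun i => decide (P i), Nat.ofBits_lt_two_pow _, fun m hm => ?_⟩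
  rw [Nat.testBit_ofBits_lt _ _ hm, decide_eq_true_eq]

theorem exists_colors_of_isOrientedColoring {G : Digraph V} {c : V → Fin r}
    (hc : IsOrientedColoring G c) (hσ : ∀ v, σ v < k) :
    ∃ t < 2 ^ r.choose 2, Colors r k (fullEntry r k t) G.Adj σ fun v => c v := by
  obtain ⟨t, ht, hbit⟩ := exists_testBit_iff (fun m => ∃ u v, G.Adj u v ∧ c u < c v ∧
    m = pairIndex (c u) (c v)) (r.choose 2)
  have hadj : ∀ i j : Fin r, i < j →
      ((fullEntry r k t).testBit (r * k + pairIndex i j) = true ↔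
        ∃ u v, G.Adj u v ∧ c u = i ∧ c v = j) := by
    intro i j hij
    rw [testBit_fullEntry, if_neg (by omega), Nat.add_sub_cancel_left,
      hbit _ (pairIndex_lt hij j.2)]
    constructor
    · rintro ⟨u, v, huv, hlt, heq⟩
      obtain ⟨hi, hj⟩ := pairIndex_injective hij hlt heq
      exact ⟨u, v, huv, Fin.ext hi.symm, Fin.ext hj.symm⟩
    · rintro ⟨u, v, huv, rfl, rfl⟩
      exact ⟨u, v, huv, hij, rfl⟩
  refine ⟨t, ht, fun v => (c v).2, fun v => ?_, fun u v huv => ?_⟩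
  · have := block_le (r := r) (hσ v)
    rw [testBit_fullEntry, if_pos (by omega)]
  · rcases lt_or_gt_of_ne (hc.1 u v huv) with hlt | hlt
    · exact .inl ⟨hlt, (hadj _ _ hlt).2 ⟨u, v, huv, rfl, rfl⟩⟩
    · refine .inr ⟨hlt, ?_⟩
      rw [← Bool.not_eq_true, hadj _ _ hlt]
      rintro ⟨x, y, hxy, hx, hy⟩
      exact hc.2 u v x y huv hxy hx.symm hy.symm

theorem Colors.hasOrientedColoring {G : Digraph V} {c : V → ℕ} {x : ℕ}
    (hc : Colors r k x G.Adj σ c) : HasOrientedColoring G r := by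
  refine ⟨fun v => ⟨c v, hc.lt v⟩, fun u v huv heq => ?_, fun u v x y huv hxy hvx huy => ?_⟩
  · have hdom := hc.hom u v huv
    rw [Fin.mk.inj heq] at hdom
    exact not_dominates_self _ _ _ _ hdom
  · have hdom := hc.hom x y hxy
    rw [← Fin.mk.inj hvx, ← Fin.mk.inj huy] at hdom
    exact hdom.asymm (hc.hom u v huv)

theorem IsTable.hasOrientedColoring_iff {G : Digraph V} (hσ : ∀ v, σ v < k)
    (h : IsTable r k T G.Adj σ) :
    HasOrientedColoring G r ↔ ∃ t < 2 ^ r.choose 2, 0 < T (fullEntry r k t) := by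
  constructor
  · rintro ⟨c, hc⟩
    obtain ⟨t, ht, hcol⟩ := exists_colors_of_isOrientedColoring hc hσ
    exact ⟨t, ht, (h _ (fullEntry_lt ht)).pos_iff.2 ⟨_, hcol⟩⟩
  · rintro ⟨t, ht, hT⟩
    obtain ⟨c, hc⟩ := (h _ (fullEntry_lt ht)).pos_iff.1 hT
    exact hc.hasOrientedColoring

end Table

/-! ### Tables with a slot for each label in use -/

/-- A digraph with vertex labels below `k`, represented by a table `T` in terms of slots: the
vertices with label `a` are in slot `slot a`, and `flag (k * s + t)` is nonzero only if all arcs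
from slot `s` to slot `t` are present. -/
structure LazyTable (r k : ℕ) (slot flag T : ℕ → ℕ) {V : Type} (Arc : V → V → Prop)
    (lab : V → ℕ) : Prop where
  slot_le : ∀ a < k, slot a ≤ k
  injective : SlotInj k slot
  lab_lt : ∀ v, lab v < k ∧ slot (lab v) < k
  arc : ∀ u v, flag (k * slot (lab u) + slot (lab v)) ≠ 0 → Arc u v
  table : IsTable r k T Arc (fun v => slot (lab v))

/-- The pairs of slots that are not flagged. -/
def openPairs (k : ℕ) (flag : ℕ → ℕ) : Finset (ℕ × ℕ) :=
  {p ∈ Finset.range k ×ˢ Finset.range k | flag (k * p.1 + p.2) = 0}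

/-- The labels that have a slot. -/
def usedLabels (k : ℕ) (slot : ℕ → ℕ) : Finset ℕ := {a ∈ Finset.range k | slot a < k}

/-- The potential that pays for the insertions of arcs and for the merging of slots. Merging opens
at most `2 * k` pairs again, whence the weight of the labels. -/
def potential (k : ℕ) (slot flag : ℕ → ℕ) : ℕ :=
  (openPairs k flag).card + 3 * k * (usedLabels k slot).card

theorem potential_le (k : ℕ) (slot flag : ℕ → ℕ) : potential k slot flag ≤ 4 * k ^ 2 := by
  have hopen : (openPairs k flag).card ≤ k * k := (Finset.card_filter_le _ _).trans_eq (by simp)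
  have hused : (usedLabels k slot).card ≤ k := (Finset.card_filter_le _ _).trans_eq (by simp)
  unfold potential
  nlinarith

theorem potential_insert {k s t : ℕ} {slot flag : ℕ → ℕ} (hs : s < k) (ht : t < k)
    (hflag : flag (k * s + t) = 0) :
    potential k slot (Function.update flag (k * s + t) 1) + 1 = potential k slot flag := by
  have hopen :
      openPairs k (Function.update flag (k * s + t) 1) = (openPairs k flag).erase (s, t) := by
    ext ⟨u, v⟩
    simp only [openPairs, Finset.mem_filter, Finset.mem_product, Finset.mem_range, Finset.mem_erase,
      ne_eq, Prod.mk.injEq, Function.update_apply]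
    by_cases hst : u = s ∧ v = t
    · simp [hst]
    · constructor
      · rintro ⟨⟨hu, hv⟩, h⟩
        exact ⟨hst, ⟨hu, hv⟩, by rwa [if_neg (mt (block_injective hv ht) hst)] at h⟩
      · rintro ⟨-, ⟨hu, hv⟩, h⟩
        exact ⟨⟨hu, hv⟩, by rwa [if_neg (mt (block_injective hv ht) hst)]⟩
  have hmem : (s, t) ∈ openPairs k flag := by simp [openPairs, hs, ht, hflag]
  have := Finset.card_erase_add_one hmem
  rw [potential, hopen, potential]
  omega

theorem potential_rename {k a b : ℕ} {slot : ℕ → ℕ} (flag : ℕ → ℕ) (ha : a < k) (hs : slot a < k) :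
    potential k (Function.update (Function.update slot b (slot a)) a k) flag ≤
      potential k slot flag := by
  have hused : usedLabels k (Function.update (Function.update slot b (slot a)) a k) ⊆
      insert b ((usedLabels k slot).erase a) := by
    intro c hc
    simp only [usedLabels, Finset.mem_filter, Finset.mem_range, Finset.mem_insert,
      Finset.mem_erase, Function.update_apply] at hc ⊢
    grind
  have hmem : a ∈ usedLabels k slot := by simp [usedLabels, ha, hs]
  have hcard := (Finset.card_le_card hused).trans (Finset.card_insert_le _ _)
  rw [Finset.card_erase_add_one hmem] at hcard
  exact Nat.add_le_add_left (Nat.mul_le_mul_left _ hcard) _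

/-- `flag` with all pairs that involve the slot `t` opened again. -/
def IsCleared (k t : ℕ) (flag flag' : ℕ → ℕ) : Prop :=
  ∀ u < k, ∀ v < k, flag' (k * u + v) = if u = t ∨ v = t then 0 else flag (k * u + v)

theorem potential_merge {k a t : ℕ} {slot flag flag' : ℕ → ℕ} (ha : a < k) (hs : slot a < k)
    (hclear : IsCleared k t flag flag') :
    potential k (Function.update slot a k) flag' + k ≤ potential k slot flag := by
  have hopen : openPairs k flag' ⊆
      openPairs k flag ∪ ({t} ×ˢ Finset.range k ∪ Finset.range k ×ˢ {t}) := by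
    rintro ⟨u, v⟩ h
    simp only [openPairs, Finset.mem_filter, Finset.mem_product, Finset.mem_range,
      Finset.mem_union, Finset.mem_singleton] at h ⊢
    have := hclear u h.1.1 v h.1.2
    grind
  have hused : usedLabels k (Function.update slot a k) ⊆ (usedLabels k slot).erase a := by
    intro c hc
    simp only [usedLabels, Finset.mem_filter, Finset.mem_range, Finset.mem_erase,
      Function.update_apply] at hc ⊢
    grind
  have hmem : a ∈ usedLabels k slot := by simp [usedLabels, ha, hs]
  have hcard : (openPairs k flag').card ≤ (openPairs k flag).card + (k + k) := by
    refine (Finset.card_le_card hopen).trans ((Finset.card_union_le _ _).trans ?_)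
    gcongr
    refine (Finset.card_union_le _ _).trans ?_
    simp
  have hcard' : (usedLabels k (Function.update slot a k)).card + 1 ≤ (usedLabels k slot).card := by
    rw [← Finset.card_erase_add_one hmem]
    exact Nat.add_le_add_right (Finset.card_le_card hused) 1
  unfold potential
  nlinarith

namespace LazyTable

variable {r k a b : ℕ} {slot flag T T' : ℕ → ℕ} {V : Type} {Arc : V → V → Prop} {lab : V → ℕ}

theorem of_isTable (hlab : ∀ v, lab v < k) (hslot : ∀ a < k, slot a = a)
    (hflag : ∀ p < k * k, flag p = 0) (h : IsTable r k T Arc lab) :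
    LazyTable r k slot flag T Arc lab where
  slot_le a ha := (hslot a ha).trans_le ha.le
  injective a ha b hb _ hab := by rwa [hslot a ha, hslot b hb] at hab
  lab_lt v := ⟨hlab v, (hslot _ (hlab v)).trans_lt (hlab v)⟩
  arc u v huv := by
    rw [hslot _ (hlab u), hslot _ (hlab v)] at huv
    exact absurd (hflag _ (by nlinarith [hlab u, hlab v])) huv
  table := h.congr (fun _ _ => Iff.rfl) fun v => (hslot _ (hlab v)).symm

theorem isTable (h : LazyTable r k slot flag T Arc lab) :
    IsTable r k (fun x => T (permute r k slot x k)) Arc lab :=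
  h.table.permute h.injective h.lab_lt

theorem slot_eq_iff (h : LazyTable r k slot flag T Arc lab) (ha : a < k) (v : V) :
    slot (lab v) = slot a ↔ lab v = a :=
  ⟨h.injective _ (h.lab_lt v).1 a ha (h.lab_lt v).2, congrArg slot⟩

theorem arcs_of_skip (h : LazyTable r k slot flag T Arc lab)
    (hskip : ¬ (slot a < k ∧ slot b < k ∧ flag (k * slot a + slot b) = 0)) :
    LazyTable r k slot flag T (fun u v => Arc u v ∨ lab u = a ∧ lab v = b) lab where
  __ := h
  arc u v huv := .inl (h.arc u v huv)
  table := by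
    refine h.table.congr (fun u v => ⟨.inl, ?_⟩) fun _ => rfl
    rintro (huv | ⟨rfl, rfl⟩)
    · exact huv
    · exact h.arc u v fun hflag => hskip ⟨(h.lab_lt u).2, (h.lab_lt v).2, hflag⟩

theorem arcs (h : LazyTable r k slot flag T Arc lab) (ha : a < k) (hb : b < k)
    (hT : IsTable r k T' (fun u v => Arc u v ∨ slot (lab u) = slot a ∧ slot (lab v) = slot b)
      (fun v => slot (lab v))) (hs : slot b < k) :
    LazyTable r k slot (Function.update flag (k * slot a + slot b) 1) T'
      (fun u v => Arc u v ∨ lab u = a ∧ lab v = b) lab where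
  slot_le := h.slot_le
  injective := h.injective
  lab_lt := h.lab_lt
  arc u v huv := by
    rw [Function.update_apply] at huv
    split_ifs at huv with heq
    · have := block_injective (h.lab_lt v).2 hs heq
      exact .inr ⟨(h.slot_eq_iff ha u).1 this.1, (h.slot_eq_iff hb v).1 this.2⟩
    · exact .inl (h.arc u v huv)
  table := hT.congr (fun u v => by rw [h.slot_eq_iff ha, h.slot_eq_iff hb]) fun _ => rfl

theorem relabel_of_skip (h : LazyTable r k slot flag T Arc lab)
    (hskip : ¬ (slot a < k ∧ a ≠ b)) :
    LazyTable r k slot flag T Arc (fun v => if lab v = a then b else lab v) := by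
  have hlab : (fun v => if lab v = a then b else lab v) = lab := by
    funext v
    split_ifs with hv
    · by_contra hba
      exact hskip ⟨hv ▸ (h.lab_lt v).2, fun hab => hba (hv.trans hab).symm⟩
    · rfl
  rwa [hlab]

theorem relabel_rename (h : LazyTable r k slot flag T Arc lab) (ha : a < k) (hb : b < k)
    (hab : a ≠ b) (hs : slot a < k) (ht : ¬ slot b < k) :
    LazyTable r k (Function.update (Function.update slot b (slot a)) a k) flag T Arc
      (fun v => if lab v = a then b else lab v) := by
  have hslot : ∀ v, Function.update (Function.update slot b (slot a)) a k
      (if lab v = a then b else lab v) = slot (lab v) := by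
    intro v
    have := (h.lab_lt v).2
    simp only [Function.update_apply]
    grind
  constructor
  · intro c hc
    simp only [Function.update_apply]
    have := h.slot_le c hc
    grind
  · intro c hc d hd
    have := h.injective c hc d hd
    have := h.injective c hc a ha
    have := h.injective a ha d hd
    simp only [Function.update_apply]
    grind
  · intro v
    rw [hslot]
    exact ⟨by split_ifs; exacts [hb, (h.lab_lt v).1], (h.lab_lt v).2⟩
  · intro u v huv
    rw [hslot, hslot] at huv
    exact h.arc u v huv
  · exact h.table.congr (fun _ _ => Iff.rfl) fun v => (hslot v).symm

theorem relabel_merge {flag' : ℕ → ℕ} (h : LazyTable r k slot flag T Arc lab) (ha : a < k)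
    (hb : b < k) (hab : a ≠ b) (hs : slot a < k) (ht : slot b < k)
    (hT : ∀ x < tableSize r k, T' x = T (OrientedColoring.copySlot r (slot a) (slot b) x))
    (hclear : IsCleared k (slot b) flag flag') :
    LazyTable r k (Function.update slot a k) flag' T' Arc
      (fun v => if lab v = a then b else lab v) := by
  have hslot : ∀ v, Function.update slot a k (if lab v = a then b else lab v) =
      if slot (lab v) = slot a then slot b else slot (lab v) := by
    intro v
    simp only [h.slot_eq_iff ha, Function.update_apply]
    grind
  have hlt : ∀ v, (if slot (lab v) = slot a then slot b else slot (lab v)) < k := fun v => by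
    split_ifs; exacts [ht, (h.lab_lt v).2]
  constructor
  · intro c hc
    simp only [Function.update_apply]
    have := h.slot_le c hc
    grind
  · intro c hc d hd
    have := h.injective c hc d hd
    simp only [Function.update_apply]
    grind
  · intro v
    rw [hslot]
    exact ⟨by split_ifs; exacts [hb, (h.lab_lt v).1], hlt v⟩
  · intro u v huv
    rw [hslot, hslot, hclear _ (hlt u) _ (hlt v)] at huv
    refine h.arc u v ?_
    grind
  · refine fun x hx => ?_
    rw [hT x hx]
    exact ((h.table.copySlot (slot b) hs).congr (fun _ _ => Iff.rfl) fun v => (hslot v).symm) x hx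

end LazyTable

end OrientedColoring

namespace CWExpr

open OrientedColoring

variable {k : ℕ}

instance finite_vertex (X : CWExpr k) : Finite X.Vertex := by
  induction X with
  | vertex a => exact inferInstanceAs (Finite Unit)
  | union X Y hX hY => exact inferInstanceAs (Finite (X.Vertex ⊕ Y.Vertex))
  | arcs _ _ _ _ hX => exact hX
  | relabel _ _ _ hX => exact hX

instance nonempty_vertex (X : CWExpr k) : Nonempty X.Vertex := by
  induction X with
  | vertex a => exact inferInstanceAs (Nonempty Unit)
  | union X Y hX _ => exact hX.map Sum.inl
  | arcs _ _ _ _ hX => exact hX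
  | relabel _ _ _ hX => exact hX

theorem card_vertex_union (X Y : CWExpr k) :
    Nat.card (X.union Y).Vertex = Nat.card X.Vertex + Nat.card Y.Vertex :=
  Nat.card_sum

theorem length_code (X : CWExpr k) : X.code.length = 3 * X.size := by
  induction X <;> simp_all [code, size] <;> ring

theorem arc_union (X Y : CWExpr k) : (X.union Y).Arc = sumArc X.Arc Y.Arc := by
  funext u v; rcases u with u | u <;> rcases v with v | v <;> rfl

/-- The labels as natural numbers. -/
def natLabel (X : CWExpr k) (v : X.Vertex) : ℕ := X.label v

theorem natLabel_lt (X : CWExpr k) (v : X.Vertex) : X.natLabel v < k := (X.label v).isLt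

theorem labels_pos (X : CWExpr k) : 0 < k :=
  Nat.zero_lt_of_lt (X.natLabel_lt (Classical.arbitrary _))

theorem natLabel_union (X Y : CWExpr k) :
    (X.union Y).natLabel = Sum.elim X.natLabel Y.natLabel := by
  funext v; rcases v with v | v <;> rfl

theorem arc_arcs {a b : Fin k} (hab : a ≠ b) (X : CWExpr k) : (X.arcs a b hab).Arc =
    fun u v => X.Arc u v ∨ X.natLabel u = a ∧ X.natLabel v = b := by
  simp only [Arc, natLabel, Fin.ext_iff]; rfl

theorem natLabel_relabel (a b : Fin k) (X : CWExpr k) :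
    (X.relabel a b).natLabel = fun v => if X.natLabel v = a then (b : ℕ) else X.natLabel v := by
  funext v; simp only [natLabel, label, apply_ite Fin.val, Fin.ext_iff]; rfl

theorem Defines.hasOrientedColoring_iff {r : ℕ} {X : CWExpr k} {V : Type} {G : Digraph V}
    (hG : X.Defines G) : HasOrientedColoring (Digraph.mk X.Arc) r ↔ HasOrientedColoring G r := by
  obtain ⟨e, he⟩ := hG
  exact ⟨.of_hom e.symm fun u v huv => (he _ _).1 (by simpa using huv),
    .of_hom e fun u v huv => (he u v).2 huv⟩

theorem Defines.card_vertex {X : CWExpr k} {V : Type} [Fintype V] {G : Digraph V}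
    (hG : X.Defines G) : Nat.card X.Vertex = Fintype.card V := by
  obtain ⟨e, -⟩ := hG
  rw [Nat.card_congr e, Nat.card_eq_fintype_card]

theorem le_of_mem_code {a : ℕ} {X : CWExpr k} (ha : a ∈ X.code) : a ≤ k + 3 := by
  induction X with
  | vertex b => simp [code] at ha; omega
  | union X Y hX hY =>
    simp only [code, List.mem_append, List.mem_cons, List.not_mem_nil, or_false] at ha
    rcases ha with (ha | ha) | ha
    exacts [hX ha, hY ha, by omega]
  | arcs b c _ X hX | relabel b c X hX =>
    simp only [code, List.mem_append, List.mem_cons, List.not_mem_nil, or_false] at ha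
    rcases ha with ha | ha
    exacts [hX ha, by omega]

theorem size_pos (X : CWExpr k) : 0 < X.size := by
  cases X <;> simp [size]

end CWExpr

namespace OrientedColoring

open WordRAM Cmd

/-! ### The program -/

/-- The variables of the program. -/
inductive Var
  | colors | labels | ops | area | colorPow | slotPow | entries
  | pos | kind | fst | snd | base | src | tgt | srcPow | tgtPow | srcBit | tgtBit | pairBit
  | low | high | lowColor | highColor | entry | source | index | answer
  deriving DecidableEq

instance : Fintype Var :=
  ⟨{.colors, .labels, .ops, .area, .colorPow, .slotPow, .entries, .pos, .kind, .fst, .snd, .base,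
    .src, .tgt, .srcPow, .tgtPow, .srcBit, .tgtBit, .pairBit, .low, .high, .lowColor, .highColor,
    .entry, .source, .index, .answer}, by rintro ⟨⟩ <;> decide⟩

/-- The arrays of the program. The array `weight` holds the powers of `2 ^ colors`, the tables are
stacked in `slotTable` (in terms of slots) and `labelTable` (in terms of labels). -/
inductive Arr
  | weight | slot | flag | slotTable | labelTable
  deriving DecidableEq

instance : Fintype Arr :=
  ⟨{.weight, .slot, .flag, .slotTable, .labelTable}, by rintro ⟨⟩ <;> decide⟩

open Var Arr Expr

/-- The expressions of the program. -/
abbrev Term : Type := Expr Var Arr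

/-- The index in `flag` of the pair of slots `s` and `t`. -/
def flagIndex (s t : Term) : Term := labels * s + t

/-- The number `i` of the three numbers of the current operation. -/
def codeWord (i : ℕ) : Term := .input ((3 : Term) * pos + (lit (3 + i) : Term))

/-- Doubles `x`. -/
def double (x : Var) : Cmd Var Arr := assign x ((x : Term) + x)

/-- The bit of `x` with weight `w`. -/
def bit (x w : Term) : Term := x / w % 2

/-- The color set in `x` with weight `w`. -/
def colorSetAt (x w : Term) : Term := x / w % colorPow

/-- The entry `x` of the table in `ρ` on top of the stack. -/
def top (ρ : Arr) (x : Term) : Term := read ρ (base + x)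

/-- The value of `a` if `c` is `1`, and the value of `b` if `c` is `0`. -/
def select (c a b : Term) : Term := c * a + (1 - c) * b

/-- Sets each entry of the table in `ρ` on top of the stack to the value of `e`. -/
def rewriteTable (ρ : Arr) (e : Term) : Cmd Var Arr :=
  forTo entry entries (write ρ ((base : Term) + entry) e)

/-- The condition that both colors with bits `srcBit` and `tgtBit` are allowed in `entry`, and that
its bit `w` is `z`. -/
def forbidCondition (w : Var) (z : ℕ) : Term :=
  bit entry srcBit * bit entry tgtBit * Expr.eq (bit entry w) (lit z)

/-- Forbids the pair of colors with bits `srcBit` and `tgtBit`; this can be done in place since the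
smaller entries that it reads do not change. -/
def forbidColors (w : Var) (z : ℕ) : Cmd Var Arr :=
  rewriteTable slotTable <|
    select (forbidCondition w z)
      (Expr.lt 0
        (top slotTable ((entry : Term) - srcBit) + top slotTable ((entry : Term) - tgtBit)))
      (top slotTable entry)

/-- Forbids the colors with weights `x` in slot `src` and `y` in slot `tgt` together. -/
def forbidPair (x y w : Var) (z : ℕ) : Cmd Var Arr :=
  assign srcBit ((srcPow : Term) * x) ;; assign tgtBit ((tgtPow : Term) * y) ;; forbidColors w z

/-- Forbids the arcs from slot `src` to slot `tgt` that go against the arc of the tournament between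
the colors of weights `low` and `high`. -/
def forbidReversed : Cmd Var Arr :=
  forbidPair low high pairBit 0 ;; forbidPair high low pairBit 1

/-- Restricts the table to the colorings with all arcs from slot `src` to slot `tgt`. -/
def insertArcs : Cmd Var Arr :=
  assign pairBit slotPow ;; assign high 1 ;;
  forTo highColor colors (
    assign low 1 ;;
    forTo lowColor highColor (forbidReversed ;; double low ;; double pairBit) ;;
    forbidPair high high entries 0 ;; double high)

/-- The number `entry` with the color set of slot `tgt` also in slot `src`. -/
def copiedEntry : Term :=
  entry - colorSetAt entry srcPow * srcPow + colorSetAt entry tgtPow * srcPow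

/-- Moves the vertices of slot `src` to slot `tgt`. -/
def mergeSlots : Cmd Var Arr := rewriteTable slotTable (top slotTable copiedEntry)

/-- Removes the flags of all pairs with slot `tgt`. -/
def clearFlags : Cmd Var Arr :=
  forTo index labels (write flag (flagIndex tgt index) 0 ;; write flag (flagIndex index tgt) 0)

/-- Finds the entry of the table in terms of slots that belongs to `entry` in terms of labels. -/
def locate : Cmd Var Arr :=
  assign source (entry / slotPow * slotPow) ;;
  forTo index labels
    (assign source
      ((source : Term) + colorSetAt entry (read weight index) * read weight (read slot index)))

/-- Stores the table on top of the stack in terms of labels. -/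
def flush : Cmd Var Arr :=
  forTo entry entries
    (locate ;; write labelTable ((base : Term) + entry) (top slotTable source))

/-- Makes each label its own slot, without flags. -/
def resetSlots : Cmd Var Arr :=
  forTo index labels (write slot index index) ;; forTo index area (write flag index 0)

/-- Puts the table with the values of `e`, in terms of labels, on top of the stack. -/
def replaceTable (e : Term) : Cmd Var Arr := rewriteTable slotTable e ;; resetSlots

/-- The operation `vertex`. -/
def vertexOp : Cmd Var Arr :=
  flush ;; assign base ((base : Term) + entries) ;; assign srcPow (read weight fst) ;;
  replaceTable (Expr.lt 0 (colorSetAt entry srcPow))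

/-- The operation `union`. -/
def unionOp : Cmd Var Arr :=
  flush ;; assign base ((base : Term) - entries) ;;
  replaceTable (top labelTable entry * top labelTable ((entries : Term) + entry))

/-- Reads the slots of the two labels of an operation. -/
def lookUp : Cmd Var Arr :=
  assign src (read slot fst) ;; assign tgt (read slot snd) ;;
  assign srcPow (read weight src) ;; assign tgtPow (read weight tgt)

/-- The operation `arcs`. -/
def arcsOp : Cmd Var Arr :=
  lookUp ;;
  ite (Expr.lt src labels * Expr.lt tgt labels * Expr.eq (read flag (flagIndex src tgt)) 0)
    (insertArcs ;; write flag (flagIndex src tgt) 1)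
    skip

/-- Moves the vertices of slot `src` to the slot `tgt` of label `snd` if there is one, and otherwise
makes `src` the slot of `snd`. -/
def moveSlot : Cmd Var Arr :=
  ite (Expr.lt tgt labels) (mergeSlots ;; clearFlags) (write slot snd src)

/-- The operation `relabel`. -/
def relabelOp : Cmd Var Arr :=
  lookUp ;;
  ite (Expr.lt src labels * Expr.eq (Expr.eq fst snd) 0) (moveSlot ;; write slot fst labels) skip

/-- Reads one operation of the expression. -/
def fetch : Cmd Var Arr :=
  assign kind (codeWord 0) ;; assign fst (codeWord 1) ;; assign snd (codeWord 2)

/-- Executes the operation that has been read. -/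
def execute : Cmd Var Arr :=
  ite (Expr.eq kind 0) vertexOp
    (ite (Expr.eq kind 1) unionOp (ite (Expr.eq kind 2) arcsOp relabelOp))

/-- Reads and executes one operation of the expression. -/
def step : Cmd Var Arr := fetch ;; execute

/-- Reads the numbers in front of the expression. -/
def readInput : Cmd Var Arr :=
  assign colors (input 0) ;; assign labels (input 1) ;; assign ops (input 2) ;;
  assign area ((labels : Term) * labels)

/-- Computes the number of color sets. -/
def computeColorPow : Cmd Var Arr := assign colorPow 1 ;; forTo index colors (double colorPow)

/-- Computes the weights of the slots. -/
def computeWeights : Cmd Var Arr :=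
  assign slotPow 1 ;;
  forTo index labels (write weight index slotPow ;; assign slotPow ((slotPow : Term) * colorPow))

/-- Computes the size of the tables. -/
def computeEntries : Cmd Var Arr :=
  assign entries slotPow ;; assign high 1 ;;
  forTo index colors (assign entries ((entries : Term) * high) ;; double high)

/-- Sets the parameters. -/
def setParameters : Cmd Var Arr :=
  readInput ;; computeColorPow ;; computeWeights ;; computeEntries

/-- Decides whether there is a coloring for some tournament. -/
def decideTable : Cmd Var Arr :=
  assign high ((entries : Term) / slotPow) ;;
  forTo index high
    (ite (top slotTable ((slotPow : Term) * index + (slotPow - 1))) (assign answer 1) skip)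

/-- The whole program. -/
def program : Cmd Var Arr := setParameters ;; resetSlots ;; forTo pos ops step ;; decideTable

/-- The variables that hold the parameters and the stack pointer. -/
def parameters : List Var := [colors, labels, area, colorPow, slotPow, entries, base]

/-- The store `h` holds the parameters for `r` colors and `k` labels, and there are enough cells for
the arrays up to and including the table on top of the stack. -/
structure Ready (E : Env Arr) (r k : ℕ) (h : Store Var Arr) : Prop where
  colors_eq : h.var colors = r
  labels_eq : h.var labels = k
  area_eq : h.var area = k * k
  colorPow_eq : h.var colorPow = 2 ^ r
  slotPow_eq : h.var slotPow = 2 ^ (r * k)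
  entries_eq : h.var entries = tableSize r k
  weight_eq : ∀ a < k, h.arr weight a = 2 ^ (r * a)
  weight_self : h.arr .weight k = 0
  cells_le : h.var base + tableSize r k + (k + 1) ^ 2 ≤ E.cells

/-! ### Correctness and running time -/

section Ready

variable {E : Env Arr} {r k : ℕ} {h h' : Store Var Arr}

theorem Ready.of_preserves {p : Cmd Var Arr} (hR : Ready E r k h) (hp : p.Preserves h h')
    (hvar : ∀ x ∈ parameters, x ∉ p.assigned) (hw : weight ∉ p.written) : Ready E r k h' := by
  have hx x hx := hp.var x (hvar x hx)
  have hw := hp.arr _ hw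
  have hbase := hx base (by decide)
  exact ⟨(hx _ (by decide)).trans hR.colors_eq, (hx _ (by decide)).trans hR.labels_eq,
    (hx _ (by decide)).trans hR.area_eq, (hx _ (by decide)).trans hR.colorPow_eq,
    (hx _ (by decide)).trans hR.slotPow_eq, (hx _ (by decide)).trans hR.entries_eq,
    fun a ha => hw ▸ hR.weight_eq a ha, hw ▸ hR.weight_self, hbase ▸ hR.cells_le⟩

theorem tableSize_pos (r k : ℕ) : 0 < tableSize r k := pow_pos two_pos _

theorem two_pow_choose_le_tableSize (r k : ℕ) : 2 ^ r.choose 2 ≤ tableSize r k := by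
  rw [tableSize_eq]
  exact Nat.le_mul_of_pos_left _ (Nat.two_pow_pos _)

theorem five_mul_cells_le_bound (E : Env Arr) : 5 * E.cells ≤ E.bound :=
  (Nat.le_add_left _ _).trans E.fits

theorem Ready.ten_le_bound (hR : Ready E r k h) : 10 ≤ E.bound := by
  have := tableSize_pos r k
  have := hR.cells_le
  have := five_mul_cells_le_bound E
  have : 0 < (k + 1) ^ 2 := by positivity
  omega

/-- The table in `ρ` on top of the stack. -/
def topTable (h : Store Var Arr) (ρ : Arr) (x : ℕ) : ℕ := h.arr ρ (h.var base + x)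

@[simp] theorem val_top (ρ : Arr) (x : Term) :
    (top ρ x).val E h = topTable h ρ (x.val E h) := rfl

@[simp] theorem safe_top (ρ : Arr) (x : Term) : (top ρ x).Safe E h ↔
    (True ∧ x.Safe E h ∧ h.var base + x.val E h ≤ E.bound) ∧ h.var base + x.val E h < E.cells :=
  .rfl

@[simp] theorem val_bit (x w : Term) : (bit x w).val E h = x.val E h / w.val E h % 2 := rfl

theorem val_select {c a b : Term} {P : Prop} [Decidable P] (hc : c.val E h = if P then 1 else 0) :
    (select c a b).val E h = if P then a.val E h else b.val E h := by
  split_ifs at hc ⊢ <;> simp [select, hc]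

theorem safe_select {c a b : Term} {P : Prop} [Decidable P] (hsafe : c.Safe E h)
    (hc : c.val E h = if P then 1 else 0) (ha : a.Safe E h) (ha' : a.val E h ≤ E.bound)
    (hb : b.Safe E h) (hb' : b.val E h ≤ E.bound) : (select c a b).Safe E h := by
  have := E.one_le_bound
  split_ifs at hc <;> simp [select, *]

/-- The store in which the entries `0, …, x - 1` of a table have been set to the values of `g`. -/
def rewritten (h : Store Var Arr) (ρ : Arr) (g : ℕ → ℕ) (x : ℕ) : Store Var Arr :=
  ⟨Function.update h.var entry x, Function.update h.arr ρ (fill (h.arr ρ) (h.var base) x g)⟩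

theorem ensures_rewriteTable {ρ : Arr} {e : Term} {g : ℕ → ℕ} (hR : Ready E r k h)
    (hsafe : ∀ x < tableSize r k, e.Safe E (rewritten h ρ g x))
    (hval : ∀ x < tableSize r k, e.val E (rewritten h ρ g x) = g x) :
    (rewriteTable ρ e).Ensures E h fun h' t =>
      (∀ x < tableSize r k, topTable h' ρ x = g x) ∧
        t ≤ tableSize r k * (e.cost + 15) + 3 := by
  rw [← hR.entries_eq] at hsafe hval ⊢
  have hassigned {y : Var} (hy : y ≠ entry) : y ∉ (rewriteTable ρ e).assigned := by
    simpa [rewriteTable, assigned] using hy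
  refine (ensures_fill (ρ := ρ) (b := h.var base) (T := e.cost + 11) (g := g) (by decide)
    (by simp [assigned]) (by simp [assigned]) ?_).frame.mono fun h' t ⟨hpres, harr, ht⟩ =>
      ⟨fun x hx => ?_, ht⟩
  swap
  · rw [topTable, harr, hpres.var base (hassigned (by decide)), fill_add hx]
  intro x hx h' hpres hxi harr
  obtain rfl : h' = rewritten h ρ g x := by
    refine Store.ext (funext fun y => ?_) (funext fun ρ' => ?_)
    · rcases eq_or_ne y entry with rfl | hy
      · simpa [rewritten] using hxi
      · simpa [rewritten, hy] using hpres.var y (hassigned hy)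
    · rcases eq_or_ne ρ' ρ with rfl | hρ
      · simpa [rewritten] using harr
      · simpa [rewritten, hρ] using hpres.arr ρ' (by simpa [written] using hρ)
  have hcells := hR.cells_le
  have hbound := five_mul_cells_le_bound E
  rw [← hR.entries_eq] at hcells
  refine ensures_write ?_ (hsafe x hx) ?_ ⟨?_, ?_⟩
  · simp [rewritten]; omega
  · simp [rewritten]; omega
  · simp only [← hval x hx]; simp [rewritten]
  · simp; omega

theorem sub_two_pow_lt {x n : ℕ} (hx : x / 2 ^ n % 2 = 1) : x - 2 ^ n < x :=
  Nat.sub_lt (Nat.pos_of_ne_zero fun h0 => by simp [h0] at hx) (pow_pos two_pos n)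

theorem forbid_le_one {p q w z x : ℕ} {T : ℕ → ℕ} (hT : T x ≤ 1) : forbid p q w z T x ≤ 1 := by
  rw [forbid]; split_ifs <;> omega

theorem topTable_rewritten (h : Store Var Arr) (ρ : Arr) (g : ℕ → ℕ) (x y : ℕ) :
    topTable (rewritten h ρ g x) ρ y = if y < x then g y else topTable h ρ y := by
  simp [topTable, rewritten, fill]

theorem mod_two_le_one (x : ℕ) : x % 2 ≤ 1 := Nat.le_of_lt_succ (Nat.mod_lt x two_pos)

theorem val_forbidCondition (w : Var) (z : ℕ) : (forbidCondition w z).val E h =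
    if h.var entry / h.var srcBit % 2 = 1 ∧ h.var entry / h.var tgtBit % 2 = 1 ∧
      h.var entry / h.var w % 2 = z then 1 else 0 := by
  rcases Nat.mod_two_eq_zero_or_one (h.var entry / h.var srcBit) with hs | hs <;>
    rcases Nat.mod_two_eq_zero_or_one (h.var entry / h.var tgtBit) with ht | ht <;>
    by_cases hw : h.var entry / h.var w % 2 = z <;>
    simp [forbidCondition, hs, ht, hw]

theorem safe_forbidCondition {w : Var} {z : ℕ} (hE : 2 ≤ E.bound) (hz : z < 2) :
    (forbidCondition w z).Safe E h := by
  have hbits := mul_le_mul' (mod_two_le_one (h.var entry / h.var srcBit))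
    (mod_two_le_one (h.var entry / h.var tgtBit))
  have hcond : (forbidCondition w z).val E h ≤ E.bound := by
    rw [val_forbidCondition]; split_ifs <;> omega
  have hbit (y : Var) : (bit entry y).Safe E h := ⟨⟨trivial, trivial, trivial⟩, hE, trivial⟩
  exact ⟨⟨hbit _, hbit _, hbits.trans E.one_le_bound⟩, ⟨hbit _, hz.le.trans hE, trivial⟩, hcond⟩

theorem ensures_forbidColors {m n l z : ℕ} {w : Var} (hR : Ready E r k h)
    (hsrc : h.var srcBit = 2 ^ m) (htgt : h.var tgtBit = 2 ^ n) (hw : h.var w = 2 ^ l)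
    (hne : w ≠ entry) (hz : z < 2) (hT : ∀ x < tableSize r k, topTable h slotTable x ≤ 1) :
    (forbidColors w z).Ensures E h fun h' t =>
      (∀ x < tableSize r k, topTable h' slotTable x =
        forbid (2 ^ m) (2 ^ n) (2 ^ l) z (topTable h slotTable) x) ∧
      t ≤ tableSize r k * 112 + 3 := by
  set g := forbid (2 ^ m) (2 ^ n) (2 ^ l) z (topTable h slotTable) with hg
  have hle {x y : ℕ} (hx : x < tableSize r k) (hy : y ≤ x) :
      topTable (rewritten h slotTable g x) slotTable y ≤ 1 := by
    have hTy := hT y (hy.trans_lt hx)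
    rw [topTable_rewritten]
    split_ifs
    exacts [forbid_le_one hTy, hTy]
  have hentry x : (rewritten h slotTable g x).var entry = x := by simp [rewritten]
  have hvar x {y : Var} (hy : y ≠ entry) : (rewritten h slotTable g x).var y = h.var y :=
    Function.update_of_ne hy ..
  have hcond x : (forbidCondition w z).val E (rewritten h slotTable g x) =
      if x / 2 ^ m % 2 = 1 ∧ x / 2 ^ n % 2 = 1 ∧ x / 2 ^ l % 2 = z then 1 else 0 := by
    simp [val_forbidCondition, hentry, hvar, hne, hsrc, htgt, hw]
  have hbound := hR.ten_le_bound
  refine (ensures_rewriteTable hR (fun x hx => ?_) fun x hx => ?_).mono fun h' t ht => ⟨ht.1, ?_⟩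
  · have hcells := hR.cells_le
    have hcells' := five_mul_cells_le_bound E
    have hsum := Nat.add_le_add (hle hx (Nat.sub_le x (2 ^ m))) (hle hx (Nat.sub_le x (2 ^ n)))
    refine safe_select (safe_forbidCondition (by omega) hz) (hcond x) ?_ ?_ ?_ ?_
    · simp [hentry, hvar, hsrc, htgt]; omega
    · simp only [val_lt]; split_ifs <;> omega
    · simp [hentry, hvar]; omega
    · simpa [hentry] using (hle hx le_rfl).trans E.one_le_bound
  · rw [val_select (hcond x), hg, forbid, ← hg]
    refine ite_congr rfl (fun hbits => ?_) fun _ => by simp [hentry, topTable_rewritten]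
    simp only [val_lt, val_add, val_top, val_sub, val_var, val_ofNat, hentry, hsrc, htgt,
      hvar x (y := srcBit) (by decide), hvar x (y := tgtBit) (by decide), topTable_rewritten,
      if_pos (sub_two_pow_lt hbits.1), if_pos (sub_two_pow_lt hbits.2.1)]
    rw [hg, forbid_sub_left hbits.1, forbid_sub_right hbits.2.1]
  · simpa [select, forbidCondition, bit, top] using ht.2

end Ready

section Insertion

variable {E : Env Arr} {r k s t : ℕ} {h h' : Store Var Arr}
  {V : Type} {Arc : V → V → Prop} {σ : V → ℕ}

theorem Ready.tableSize_le_bound (hR : Ready E r k h) : tableSize r k ≤ E.bound := by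
  have := hR.cells_le
  have := five_mul_cells_le_bound E
  omega

theorem topTable_of_preserves {p : Cmd Var Arr} {ρ : Arr} (hp : p.Preserves h h')
    (hbase : base ∉ p.assigned) (hρ : ρ ∉ p.written) : topTable h' ρ = topTable h ρ := by
  unfold topTable
  rw [hp.var _ hbase, hp.arr _ hρ]

@[simp] theorem topTable_set {x : Var} (hx : base ≠ x) (ρ : Arr) (a : ℕ) :
    topTable (h.set x a) ρ = topTable h ρ := by
  unfold topTable
  simp [hx]

theorem Ready.set {x : Var} (hR : Ready E r k h) (hx : x ∉ parameters) (a : ℕ) :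
    Ready E r k (h.set x a) :=
  hR.of_preserves (p := assign x (lit a)) ⟨by simp +contextual [assigned], by simp⟩
    (by simp only [assigned]; grind) (by simp [written])

/-- The store `h` also holds the weights of the slots `s` and `t` in `srcPow` and `tgtPow`. -/
structure PairReady (E : Env Arr) (r k s t : ℕ) (h : Store Var Arr) : Prop
    extends Ready E r k h where
  src_lt : s < k
  tgt_lt : t < k
  srcPow_eq : h.var srcPow = 2 ^ (r * s)
  tgtPow_eq : h.var tgtPow = 2 ^ (r * t)

theorem PairReady.of_preserves {p : Cmd Var Arr} (hP : PairReady E r k s t h)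
    (hp : p.Preserves h h') (hvar : ∀ x ∈ srcPow :: tgtPow :: parameters, x ∉ p.assigned)
    (hw : weight ∉ p.written) : PairReady E r k s t h' :=
  ⟨hP.toReady.of_preserves hp (fun x hx => hvar x (by simp [hx])) hw, hP.src_lt, hP.tgt_lt,
    (hp.var _ (hvar _ (by simp))).trans hP.srcPow_eq,
    (hp.var _ (hvar _ (by simp))).trans hP.tgtPow_eq⟩

theorem two_pow_le_tableSize {i : ℕ} (hs : s < k) (hi : i ≤ r) :
    2 ^ (r * s + i) ≤ tableSize r k := by
  have := block_le (r := r) hs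
  exact Nat.pow_le_pow_right two_pos (by omega)

theorem PairReady.ensures_forbidPair {x y w : Var} {i j l z : ℕ} {K : ℕ → ℕ → ℕ → Prop}
    (hP : PairReady E r k s t h) (hi : i < r) (hj : j < r) (hz : z < 2)
    (hx : h.var x = 2 ^ i) (hy : h.var y = 2 ^ j) (hw : h.var w = 2 ^ l)
    (hne : y ≠ srcBit ∧ w ≠ srcBit ∧ w ≠ tgtBit ∧ w ≠ entry)
    (hK : ∀ x y, SameTournament r k x y → K x = K y)
    (h_table : IsTableAvoiding r k (topTable h slotTable) Arc σ s t K) :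
    (forbidPair x y w z).Ensures E h fun h' τ =>
      (forbidPair x y w z).Preserves h h' ∧ PairReady E r k s t h' ∧
      IsTableAvoiding r k (topTable h' slotTable) Arc σ s t
        (fun x a b => K x a b ∨ x / 2 ^ l % 2 = z ∧ a = i ∧ b = j) ∧
      τ ≤ 129 * tableSize r k := by
  obtain ⟨hy', hw₁, hw₂, hw₃⟩ := hne
  have hsafe {u a : ℕ} (hu : u < k) (ha : a < r) : 2 ^ (r * u) * 2 ^ a ≤ E.bound :=
    (pow_add 2 (r * u) a).symm.trans_le
      ((two_pow_le_tableSize hu ha.le).trans hP.tableSize_le_bound)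
  refine Ensures.frame (ensures_seq <| ensures_assign ?_ <| ensures_seq <| ensures_assign ?_ ?_)
    |>.mono fun h' τ ⟨hp, hQ⟩ => ⟨hp, hP.of_preserves hp ?_ ?_, hQ⟩
  · simpa [hP.srcPow_eq, hx] using hsafe hP.src_lt hi
  · simpa [hP.tgtPow_eq, hy, hy'] using hsafe hP.tgt_lt hj
  · set h₁ := (h.set srcBit _).set tgtBit _ with hh₁
    have htop : topTable h₁ slotTable = topTable h slotTable := by simp [hh₁]
    have hR : Ready E r k h₁ := (hP.toReady.set (by decide) _).set (by decide) _
    refine (ensures_forbidColors (m := r * s + i) (n := r * t + j) (l := l) hR ?_ ?_ ?_ hw₃ hz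
      fun x hx => ?_).mono fun h' τ ⟨hT, hτ⟩ => ⟨fun x hx => ?_, ?_⟩
    · simp [hh₁, hP.srcPow_eq, hx, pow_add]
    · simp [hh₁, hP.tgtPow_eq, hy, hy', pow_add]
    · simp [hh₁, hw, hw₁, hw₂]
    · rw [htop]
      exact (h_table x hx).le_one
    · rw [hT x hx, htop]
      exact h_table.forbid hP.src_lt hP.tgt_lt hi hj hK x hx
    · have := tableSize_pos r k
      simp
      omega
  · simp [forbidColors, rewriteTable, assigned, parameters]
  · simp [forbidColors, rewriteTable, written]

theorem PairReady.set {x : Var} (hP : PairReady E r k s t h)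
    (hx : x ∉ srcPow :: tgtPow :: parameters) (a : ℕ) : PairReady E r k s t (h.set x a) :=
  hP.of_preserves (p := assign x (lit a)) ⟨by simp +contextual [assigned], by simp⟩
    (by simp only [assigned]; grind) (by simp [written])

/-- The loop invariant of `insertArcs` when all pairs of colors below `j` have been considered, and
the color `j` with all colors below `i`. -/
structure Inserting (E : Env Arr) (r k s t : ℕ) (Arc : V → V → Prop) (σ : V → ℕ) (j i : ℕ)
    (h : Store Var Arr) : Prop extends PairReady E r k s t h where
  high_eq : h.var high = 2 ^ j
  pairBit_eq : h.var pairBit = 2 ^ (r * k + pairIndex i j)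
  table : IsTableAvoiding r k (topTable h slotTable) Arc σ s t (Forbidden r k j i)

theorem Inserting.set {x : Var} {i j : ℕ} (hI : Inserting E r k s t Arc σ j i h)
    (hx : x ∉ high :: pairBit :: srcPow :: tgtPow :: parameters) (a : ℕ) :
    Inserting E r k s t Arc σ j i (h.set x a) := by
  obtain ⟨hP, hhigh, hpair, htab⟩ := hI
  simp only [List.mem_cons, not_or] at hx
  refine ⟨hP.set (by simpa using hx.2.2) a, ?_, ?_, ?_⟩
  · simpa [Ne.symm hx.1] using hhigh
  · simpa [Ne.symm hx.2.1] using hpair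
  · rwa [topTable_set]
    rintro rfl
    exact hx.2.2.2.2 (by decide)

theorem Inserting.ensures_forbidReversed {i j : ℕ} (hI : Inserting E r k s t Arc σ j i h)
    (hlow : h.var low = 2 ^ i) (hij : i < j) (hj : j < r) :
    forbidReversed.Ensures E h fun h' τ =>
      forbidReversed.Preserves h h' ∧
      PairReady E r k s t h' ∧
      IsTableAvoiding r k (topTable h' slotTable) Arc σ s t (Forbidden r k j (i + 1)) ∧
      τ ≤ 258 * tableSize r k := by
  refine (ensures_seq ?_).frame
  refine (hI.ensures_forbidPair (hij.trans hj) hj two_pos hlow hI.high_eq hI.pairBit_eq (by decide)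
    (fun x y hxy => hxy.forbidden_eq j i) hI.table).mono fun h₁ τ₁ ⟨hp₁, hP₁, htab₁, hτ₁⟩ => ?_
  have hvar {x : Var} (hx : x ∉ (forbidPair low high pairBit 0).assigned) := hp₁.var x hx
  refine (hP₁.ensures_forbidPair hj (hij.trans hj) one_lt_two ((hvar (by decide)).trans hI.high_eq)
    ((hvar (by decide)).trans hlow) ((hvar (by decide)).trans hI.pairBit_eq) (by decide)
    (fun x y hxy => ?_) htab₁).mono fun h₂ τ₂ ⟨_, hP₂, htab₂, hτ₂⟩ =>
      ⟨hP₂, htab₂.congr fun x _ a _ b _ => (forbidden_succ_iff hij).symm, by omega⟩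
  ext a b
  rw [hxy.forbidden_eq, ← not_dominates_of_lt hij, ← not_dominates_of_lt hij, hxy.dominates_iff]

theorem Inserting.ensures_innerRound {i j : ℕ} (hI : Inserting E r k s t Arc σ j i h)
    (hlow : h.var low = 2 ^ i) (hij : i < j) (hj : j < r) :
    (forbidReversed ;; double low ;; double pairBit).Ensures E h fun h' τ =>
      (Inserting E r k s t Arc σ j (i + 1) h' ∧ h'.var low = 2 ^ (i + 1)) ∧
        τ ≤ 272 * tableSize r k := by
  have hE := hI.tableSize_le_bound
  have hpair : 2 ^ (r * k + pairIndex i j + 1) ≤ tableSize r k :=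
    Nat.pow_le_pow_right two_pos (by have := pairIndex_lt hij hj; omega)
  have hlow' : 2 ^ (i + 1) ≤ tableSize r k :=
    (Nat.pow_le_pow_right two_pos (by omega)).trans (two_pow_le_tableSize hI.src_lt le_rfl)
  rw [pow_succ] at hpair hlow'
  refine ensures_seq <| (hI.ensures_forbidReversed hlow hij hj).mono
    fun h₁ τ₁ ⟨hp, hP, htab, hτ₁⟩ => ?_
  have hlow₁ := (hp.var low (by decide)).trans hlow
  have hhigh₁ := (hp.var high (by decide)).trans hI.high_eq
  have hpair₁ := (hp.var pairBit (by decide)).trans hI.pairBit_eq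
  refine ensures_seq <| ensures_assign ?_ <| ensures_assign ?_ ⟨⟨⟨?_, ?_, ?_, ?_⟩, ?_⟩, ?_⟩
  · simp [hlow₁]; omega
  · simpa [hpair₁, ← mul_two] using hpair.trans (by omega)
  · exact (hP.set (by decide) _).set (by decide) _
  · simpa using hhigh₁
  · simp [hpair₁, pairIndex, ← add_assoc, pow_succ, mul_two]
  · simpa using htab
  · simp [hlow₁, pow_succ, mul_two]
  · have := tableSize_pos r k
    simp
    omega

theorem Inserting.ensures_innerLoop {j : ℕ} (hI : Inserting E r k s t Arc σ j 0 h)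
    (hlow : h.var low = 1) (hcolor : h.var highColor = j) (hj : j < r) :
    (forTo lowColor highColor (forbidReversed ;; double low ;; double pairBit)).Ensures E h
      fun h' τ => Inserting E r k s t Arc σ j j h' ∧ τ ≤ j * (276 * tableSize r k) + 3 := by
  refine ensures_forTo (by decide) (by decide) (by decide)
    (fun i h' τ => (Inserting E r k s t Arc σ j i h' ∧ h'.var low = 2 ^ i) ∧
      τ ≤ i * (276 * tableSize r k)) ?_ (fun i hij h₁ τ₁ _ _ ⟨⟨hI₁, hlow₁⟩, hτ₁⟩ => ?_)
    fun h' τ ⟨⟨hI', _⟩, hτ⟩ => ⟨hcolor ▸ hI', by rw [hcolor] at hτ; omega⟩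
  · exact ⟨⟨hI.set (by decide) 0, by simpa using hlow⟩, by simp⟩
  · refine (hI₁.ensures_innerRound hlow₁ (hcolor ▸ hij) hj).mono
      fun h₂ τ₂ ⟨⟨hI₂, hlow₂⟩, hτ₂⟩ => ⟨⟨hI₂.set (by decide) _, by simpa using hlow₂⟩, ?_⟩
    have := tableSize_pos r k
    rw [add_one_mul]
    omega

theorem Inserting.ensures_diagonal {j : ℕ} (hI : Inserting E r k s t Arc σ j j h) (hj : j < r) :
    (forbidPair high high entries 0 ;; double high).Ensures E h fun h' τ =>
      Inserting E r k s t Arc σ (j + 1) 0 h' ∧ τ ≤ 136 * tableSize r k := by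
  have hhigh : 2 ^ (j + 1) ≤ tableSize r k :=
    (Nat.pow_le_pow_right two_pos (by omega)).trans (two_pow_le_tableSize hI.src_lt le_rfl)
  rw [pow_succ] at hhigh
  have hE := hI.tableSize_le_bound
  refine ensures_seq <| (hI.ensures_forbidPair hj hj two_pos hI.high_eq hI.high_eq hI.entries_eq
    (by decide) (fun x y hxy => hxy.forbidden_eq j j) hI.table).mono
      fun h₁ τ₁ ⟨hp, hP, htab, hτ₁⟩ => ?_
  have hhigh₁ := (hp.var high (by decide)).trans hI.high_eq
  have hpair₁ := (hp.var pairBit (by decide)).trans hI.pairBit_eq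
  have htab₁ := htab.congr fun x hx a _ b _ => (forbidden_succ_zero_iff hx).symm
  refine ensures_assign ?_ ⟨⟨hP.set (by decide) _, ?_, ?_, ?_⟩, ?_⟩
  · simp [hhigh₁]; omega
  · simp [hhigh₁, pow_succ, mul_two]
  · simp [hpair₁, pairIndex, choose_two_succ, add_comm]
  · simpa using htab₁
  · have := tableSize_pos r k
    simp
    omega

theorem Inserting.ensures_outerRound {j : ℕ} (hI : Inserting E r k s t Arc σ j 0 h)
    (hcolor : h.var highColor = j) (hj : j < r) :
    (assign low 1 ;; forTo lowColor highColor (forbidReversed ;; double low ;; double pairBit) ;;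
      forbidPair high high entries 0 ;; double high).Ensures E h fun h' τ =>
        Inserting E r k s t Arc σ (j + 1) 0 h' ∧
        τ ≤ r * (276 * tableSize r k) + 142 * tableSize r k := by
  have hE := hI.ten_le_bound
  refine ensures_seq <| ensures_assign (by simp; omega) <| ensures_seq <|
    ((hI.set (x := low) (by decide) 1).ensures_innerLoop (by simp) (by simpa using hcolor) hj).mono
      fun h₁ τ₁ ⟨hI₁, hτ₁⟩ => (hI₁.ensures_diagonal hj).mono fun h₂ τ₂ ⟨hI₂, hτ₂⟩ => ⟨hI₂, ?_⟩
  have := tableSize_pos r k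
  have := Nat.mul_le_mul_right (276 * tableSize r k) hj.le
  simp
  omega

/-- The time unit for a change of a table: there are at most `(r + 1) ^ 2` pairs of colors. -/
def tableTime (r k : ℕ) : ℕ := (r + 1) ^ 2 * tableSize r k

theorem tableSize_le_tableTime (r k : ℕ) : tableSize r k ≤ tableTime r k :=
  Nat.le_mul_of_pos_left _ (by positivity)

theorem PairReady.ensures_insertArcs (hP : PairReady E r k s t h)
    (h_table : IsTable r k (topTable h slotTable) Arc σ) :
    insertArcs.Ensures E h fun h' τ => PairReady E r k s t h' ∧
      IsTable r k (topTable h' slotTable) (fun u v => Arc u v ∨ σ u = s ∧ σ v = t) σ ∧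
      τ ≤ 276 * tableTime r k := by
  have hE := hP.ten_le_bound
  refine ensures_seq <| ensures_assign (by simp) <| ensures_seq <|
    ensures_assign (by simp; omega) ?_
  refine ensures_forTo (by decide) (by decide) (by decide)
    (fun j h' τ => Inserting E r k s t Arc σ j 0 h' ∧
      τ ≤ j * (r * (276 * tableSize r k) + 146 * tableSize r k)) ⟨?_, by simp⟩ ?_ ?_
  · refine Inserting.set ⟨(hP.set (by decide) _).set (by decide) _, ?_, ?_, ?_⟩ (by decide) 0
    · simp
    · simp [hP.slotPow_eq, pairIndex]
    · simpa using h_table.avoiding s t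
  · intro j hj h₁ τ₁ _ hcolor ⟨hI₁, hτ₁⟩
    refine (hI₁.ensures_outerRound hcolor (by simpa [hP.colors_eq] using hj)).mono
      fun h₂ τ₂ ⟨hI₂, hτ₂⟩ => ⟨hI₂.set (by decide) _, ?_⟩
    have := tableSize_pos r k
    rw [add_one_mul]
    omega
  · simp only [Store.set_var, ne_eq, reduceCtorEq, not_false_eq_true, Function.update_of_ne,
      hP.colors_eq]
    refine fun h₁ τ₁ ⟨hI₁, hτ₁⟩ => ⟨hI₁.toPairReady, hI₁.table.isTable, ?_⟩
    have := tableSize_pos r k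
    simp [tableTime]
    nlinarith

end Insertion

section Slots

variable {E : Env Arr} {r k s t : ℕ} {h h' : Store Var Arr}

theorem copySlot_lt (hs : s < k) {x : ℕ} (hx : x < tableSize r k) :
    copySlot r s t x < tableSize r k :=
  (sameTournament_copySlot hs t x).lt_tableSize hx

theorem mul_two_pow_le_tableSize (hs : s < k) (x : ℕ) :
    colorSet r x t * 2 ^ (r * s) ≤ tableSize r k := by
  refine (Nat.mul_le_mul_right _ (colorSet_lt r x t).le).trans ?_
  rw [← pow_add, add_comm]
  exact two_pow_le_tableSize hs le_rfl

theorem PairReady.ensures_mergeSlots (hP : PairReady E r k s t h) :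
    mergeSlots.Ensures E h fun h' τ => PairReady E r k s t h' ∧
      (∀ x < tableSize r k,
        topTable h' slotTable x = topTable h slotTable (copySlot r s t x)) ∧
      τ ≤ 60 * tableSize r k := by
  set g := fun x => topTable h slotTable (copySlot r s t x)
  have hentry x : (rewritten h slotTable g x).var entry = x := by simp [rewritten]
  have hvar x {y : Var} (hy : y ≠ entry) : (rewritten h slotTable g x).var y = h.var y :=
    Function.update_of_ne hy ..
  have hsrc x := (hvar x (y := .srcPow) (by decide)).trans hP.srcPow_eq
  have htgt x := (hvar x (y := .tgtPow) (by decide)).trans hP.tgtPow_eq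
  have hcol x := (hvar x (y := .colorPow) (by decide)).trans hP.colorPow_eq
  have hbase x := hvar x (y := base) (by decide)
  refine (ensures_rewriteTable (g := g) hP.toReady (fun x hx => ?_) fun x _ => ?_).frame.mono
    fun h' τ ⟨hp, hT, hτ⟩ => ⟨hP.of_preserves hp (by decide) (by decide), hT, ?_⟩
  · have hcells := hP.cells_le
    have hbound := five_mul_cells_le_bound E
    have hcopy := copySlot_lt (t := t) hP.src_lt hx
    have hsrc_le := mul_two_pow_le_tableSize (r := r) (t := s) hP.src_lt x
    have htgt_le := mul_two_pow_le_tableSize (r := r) (t := t) hP.src_lt x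
    simp only [copySlot, setColorSet, colorSet] at hcopy hsrc_le htgt_le
    simp [copiedEntry, colorSetAt, hentry, hsrc, htgt, hcol, hbase]
    omega
  · have hval : copiedEntry.val E (rewritten h slotTable g x) = copySlot r s t x := by
      simp [copiedEntry, colorSetAt, copySlot, setColorSet, colorSet, hentry, hsrc, htgt, hcol]
    rw [val_top, hval, topTable_rewritten]
    split_ifs
    · exact congrArg (topTable h slotTable) (copySlot_copySlot r s t x)
    · rfl
  · have := tableSize_pos r k
    simp [top, copiedEntry, colorSetAt] at hτ
    omega

theorem Ready.index_le_bound (hR : Ready E r k h) {u v : ℕ} (hu : u < k) (hv : v < k) :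
    k * u + v < E.cells ∧ k * u + v ≤ E.bound := by
  have := block_le (r := k) hu
  have := hR.cells_le
  have := five_mul_cells_le_bound E
  have : k * k ≤ (k + 1) ^ 2 := by nlinarith
  constructor <;> omega

theorem Ready.ensures_clearFlags (hR : Ready E r k h) (ht : h.var tgt = t) (htk : t < k) :
    clearFlags.Ensures E h fun h' τ => Ready E r k h' ∧
      IsCleared k t (h.arr flag) (h'.arr flag) ∧ τ ≤ 34 * k + 3 := by
  refine (ensures_forTo (by decide) (by decide) (by decide) (fun i h' τ =>
    (∀ u < k, ∀ v < k, h'.arr flag (k * u + v) =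
      if u = t ∧ v < i ∨ v = t ∧ u < i then 0 else h.arr flag (k * u + v)) ∧ τ ≤ i * 34)
    (by simp) (fun i hi h₁ τ₁ hp hi' ⟨hflag, hτ₁⟩ => ?_)
    fun h₁ τ₁ ⟨hflag, hτ₁⟩ => ⟨?_, ?_⟩).frame.mono
      fun h' τ ⟨hp, hQ⟩ => ⟨hR.of_preserves hp (by decide) (by decide), hQ⟩
  · rw [hR.labels_eq] at hi
    have hlabels := (hp.var .labels (by decide)).trans hR.labels_eq
    have htgt := (hp.var .tgt (by decide)).trans ht
    have hti := hR.index_le_bound htk hi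
    have hit := hR.index_le_bound hi htk
    refine ensures_seq <| ensures_write ?_ (by simp) ?_ <| ensures_write ?_ (by simp) ?_ ⟨?_, ?_⟩
    · simp [flagIndex, hlabels, htgt, hi']; omega
    · simp [flagIndex, hlabels, htgt, hi']; omega
    · simp [flagIndex, hlabels, htgt, hi']; omega
    · simp [flagIndex, hlabels, htgt, hi']; omega
    · intro u hu v hv
      have hti_iff : k * u + v = k * t + i ↔ u = t ∧ v = i :=
        ⟨block_injective hv hi, fun ⟨hu, hv⟩ => by rw [hu, hv]⟩
      have hit_iff : k * u + v = k * i + t ↔ u = i ∧ v = t :=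
        ⟨block_injective hv htk, fun ⟨hu, hv⟩ => by rw [hu, hv]⟩
      simp [flagIndex, hlabels, htgt, hi', Function.update_apply, hti_iff, hit_iff, hflag u hu v hv]
      grind
    · simp [flagIndex]; omega
  · intro u hu v hv
    rw [hflag u hu v hv, hR.labels_eq]
    grind
  · rw [hR.labels_eq] at hτ₁
    omega

theorem permute_succ_eq_add (r k : ℕ) (slot : ℕ → ℕ) (x n : ℕ) : permute r k slot x (n + 1) =
    permute r k slot x n + colorSet r x n * if slot n < k then 2 ^ (r * slot n) else 0 := by
  rw [permute, Finset.sum_range_succ, ← add_assoc, ← permute]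

theorem Ready.weight_slot (hR : Ready E r k h) {a : ℕ} (ha : h.arr slot a ≤ k) :
    h.arr weight (h.arr slot a) = if h.arr slot a < k then 2 ^ (r * h.arr slot a) else 0 := by
  split_ifs with hlt
  · exact hR.weight_eq _ hlt
  · rw [le_antisymm ha (not_lt.mp hlt), hR.weight_self]

theorem Ready.le_of_le (hR : Ready E r k h) {a : ℕ} (ha : a ≤ k) : a < E.cells ∧ a ≤ E.bound := by
  have := hR.cells_le
  have := five_mul_cells_le_bound E
  have : k < (k + 1) ^ 2 := by nlinarith
  constructor <;> omega

theorem Ready.ensures_locate (hR : Ready E r k h) (hslot : ∀ a < k, h.arr slot a ≤ k)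
    (hinj : SlotInj k (h.arr slot)) (hx : h.var entry < tableSize r k) :
    locate.Ensures E h fun h' τ =>
      h'.var source = permute r k (h.arr slot) (h.var entry) k ∧ τ ≤ 38 * k + 13 := by
  have hE := hR.tableSize_le_bound
  refine ensures_seq <| ensures_assign ?_ ?_
  · have := Nat.div_mul_le_self (h.var entry) (2 ^ (r * k))
    simp [hR.slotPow_eq]
    omega
  refine ensures_forTo (by decide) (by decide) (by decide) (fun i h' τ =>
    h'.var source = permute r k (h.arr slot) (h.var entry) i ∧ τ ≤ i * 38) ?_
    (fun i hi h₁ τ₁ hp hi' ⟨hsource, hτ₁⟩ => ?_) fun h₁ τ₁ ⟨hsource, hτ₁⟩ => ⟨?_, ?_⟩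
  · simp [permute, hR.slotPow_eq]
  · replace hi : i < k := by simpa [hR.labels_eq] using hi
    have hR₁ : Ready E r k h₁ := (hR.set (by decide) _).of_preserves hp (by decide) (by decide)
    have hentry : h₁.var entry = h.var entry := by simpa using hp.var entry (by decide)
    have harr : h₁.arr slot = h.arr slot := by simpa using hp.arr slot (by decide)
    have hcell := hR.le_of_le hi.le
    have hcell' := hR.le_of_le (hslot i hi)
    have hnext := (hinj.permute_lt (n := i + 1) hi hx).le.trans hE
    have hcolor : (colorSetAt entry (read weight index)).val E h₁ =
        colorSet r (h.var entry) i := by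
      simp [colorSetAt, hentry, hi', hR₁.weight_eq i hi, hR₁.colorPow_eq, colorSet]
    have hweight : (read weight (read slot index) : Term).val E h₁ =
        if h.arr slot i < k then 2 ^ (r * h.arr slot i) else 0 := by
      simpa [hi', harr] using hR₁.weight_slot (by rw [harr]; exact hslot i hi)
    rw [permute_succ_eq_add] at hnext
    refine ensures_assign ?_ ⟨?_, ?_⟩
    · rw [safe_add, safe_mul, val_mul, hcolor, hweight]
      simp [colorSetAt, hsource, hi', harr, -mul_ite]
      omega
    · simp [permute_succ_eq_add, hcolor, hweight, hsource]
    · simp [colorSetAt]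
      omega
  · simpa [hR.labels_eq] using hsource
  · simp [hR.labels_eq] at hτ₁ ⊢
    omega

theorem Ready.ensures_flush (hR : Ready E r k h) (hslot : ∀ a < k, h.arr slot a ≤ k)
    (hinj : SlotInj k (h.arr slot)) :
    flush.Ensures E h fun h' τ => Ready E r k h' ∧
      h'.arr labelTable = fill (h.arr labelTable) (h.var base) (tableSize r k)
        (fun x => topTable h slotTable (permute r k (h.arr slot) x k)) ∧
      τ ≤ 42 * ((k + 1) * tableSize r k) := by
  refine (ensures_fill (ρ := labelTable) (b := h.var base) (T := 38 * k + 35)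
    (g := fun x => topTable h slotTable (permute r k (h.arr slot) x k)) (by decide) (by decide)
    (by decide) fun x hx h₁ hp hentry _ => ?_).frame.mono fun h' τ ⟨hp, hfill, hτ⟩ =>
      ⟨hR.of_preserves hp (by decide) (by decide), by rwa [hR.entries_eq] at hfill, ?_⟩
  · rw [hR.entries_eq, ← hentry] at hx
    have hR₁ := hR.of_preserves hp (by decide) (by decide)
    have harr : h₁.arr slot = h.arr slot := hp.arr slot (by decide)
    have hbase : h₁.var base = h.var base := hp.var base (by decide)
    refine ensures_seq <| (hR₁.ensures_locate (harr ▸ hslot) (harr ▸ hinj) hx).frame.mono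
      fun h₂ τ₂ ⟨hp₂, hsource, hτ₂⟩ => ?_
    have hsource_lt := hinj.permute_lt le_rfl hx
    have hbase₂ := (hp₂.var base (by decide)).trans hbase
    have hentry₂ := (hp₂.var entry (by decide))
    have htop : topTable h₂ slotTable = topTable h slotTable :=
      (topTable_of_preserves hp₂ (by decide) (by decide)).trans
        (topTable_of_preserves hp (by decide) (by decide))
    have hcells := hR.cells_le
    have hbound := five_mul_cells_le_bound E
    rw [harr] at hsource
    refine ensures_write ?_ ?_ ?_ ⟨?_, ?_⟩
    · simp [hbase₂, hentry₂]; omega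
    · simp [hbase₂, hsource]; omega
    · simp [hbase₂, hentry₂]; omega
    · simp [hbase₂, hentry₂, htop, hsource, hentry, hp₂.arr labelTable (by decide)]
    · simp [top]; omega
  · have := tableSize_pos r k
    rw [hR.entries_eq] at hτ
    nlinarith

theorem ensures_resetSlots (hlabels : h.var labels = k) (harea : h.var area = k * k)
    (hcells : (k + 1) ^ 2 ≤ E.cells) :
    resetSlots.Ensures E h fun h' τ =>
      (∀ a < k, h'.arr slot a = a) ∧ (∀ p < k * k, h'.arr flag p = 0) ∧
        τ ≤ 30 * (k + 1) ^ 2 := by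
  have hbound := five_mul_cells_le_bound E
  have hk : k ≤ (k + 1) ^ 2 ∧ k * k ≤ (k + 1) ^ 2 := by constructor <;> nlinarith
  refine ensures_seq <| (ensures_fill (ρ := slot) (b := 0) (T := 10) (g := id) (by decide)
    (by decide) (by decide) fun i hi h₁ _ hi' _ => ?_).frame.mono
      fun h₁ τ₁ ⟨hp₁, hslot, hτ₁⟩ => ?_
  · refine ensures_write (by simp) (by simp) ?_ ⟨by simp [hi'], by simp⟩
    simp
    omega
  have harea₁ := (hp₁.var area (by decide)).trans harea
  refine (ensures_fill (ρ := flag) (b := 0) (T := 9) (g := fun _ => 0) (by decide)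
    (by decide) (by decide) fun i hi h₂ _ hi' _ => ?_).frame.mono
      fun h₂ τ₂ ⟨hp₂, hflag, hτ₂⟩ => ⟨fun a ha => ?_, fun p hp => ?_, ?_⟩
  · refine ensures_write (by simp) (by simp) ?_ ⟨by simp [hi'], by simp⟩
    simp
    omega
  · rw [hp₂.arr slot (by decide), hslot]
    simpa using fill_add (f := h.arr slot) (b := 0) (g := id) (hlabels ▸ ha)
  · rw [hflag]
    simpa using fill_add (f := h₁.arr flag) (b := 0) (g := fun _ => 0) (harea₁ ▸ hp)
  · rw [hlabels] at hτ₁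
    rw [harea₁] at hτ₂
    nlinarith

end Slots

section Flush

variable {E : Env Arr} {r k a b : ℕ} {h h' : Store Var Arr}
  {V : Type} {Arc : V → V → Prop} {lab : V → ℕ}

/-- The store `h` is ready, and its slots make sense for the table on top of the stack. -/
structure Flushable (E : Env Arr) (r k : ℕ) (h : Store Var Arr) : Prop
    extends Ready E r k h where
  slot_le : ∀ a < k, h.arr slot a ≤ k
  injective : SlotInj k (h.arr slot)

/-- The table on top of the stack, with the slots and flags, is a lazy table of the labeled
digraph with arcs `Arc` and labels `lab`. -/
structure HoldsTable (E : Env Arr) (r k : ℕ) (h : Store Var Arr) (Arc : V → V → Prop)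
    (lab : V → ℕ) : Prop extends Ready E r k h where
  lazyTable : LazyTable r k (h.arr slot) (h.arr flag) (topTable h slotTable) Arc lab

theorem HoldsTable.flushable (hT : HoldsTable E r k h Arc lab) : Flushable E r k h :=
  ⟨hT.toReady, hT.lazyTable.slot_le, hT.lazyTable.injective⟩

/-- The table on top of the stack in terms of labels. -/
def tableByLabels (r k : ℕ) (h : Store Var Arr) (x : ℕ) : ℕ :=
  topTable h slotTable (permute r k (h.arr slot) x k)

/-- The time that insertions of arcs and mergings of slots may still take before the next table is
made. -/
def pendingTime (r k : ℕ) (h : Store Var Arr) : ℕ :=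
  276 * (tableTime r k * potential k (h.arr slot) (h.arr flag))

theorem Ready.put {ρ : Arr} (hR : Ready E r k h) (hρ : weight ≠ ρ) (i a : ℕ) :
    Ready E r k (h.put ρ i a) :=
  hR.of_preserves (p := write ρ (lit i) (lit a)) ⟨by simp, by simp +contextual [written]⟩
    (by simp [assigned]) (by simpa [written] using hρ)

@[simp] theorem topTable_put {ρ ρ' : Arr} (hρ : ρ ≠ ρ') (i a : ℕ) :
    topTable (h.put ρ' i a) ρ = topTable h ρ := by
  unfold topTable
  simp [hρ]

theorem HoldsTable.of_preserves {p : Cmd Var Arr} (hT : HoldsTable E r k h Arc lab)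
    (hp : p.Preserves h h') (hvar : ∀ x ∈ parameters, x ∉ p.assigned) (hw : p.written = []) :
    HoldsTable E r k h' Arc lab ∧ pendingTime r k h' = pendingTime r k h := by
  have harr ρ : h'.arr ρ = h.arr ρ := hp.arr ρ (by simp [hw])
  refine ⟨⟨hT.toReady.of_preserves hp hvar (by simp [hw]), ?_⟩, by simp only [pendingTime, harr]⟩
  rw [topTable_of_preserves hp (hvar _ (by decide)) (by simp [hw]), harr, harr]
  exact hT.lazyTable

theorem HoldsTable.ensures_lookUp (hT : HoldsTable E r k h Arc lab) (ha : h.var fst = a)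
    (hb : h.var snd = b) (hak : a < k) (hbk : b < k) :
    lookUp.Ensures E h fun h' t => HoldsTable E r k h' Arc lab ∧
      h'.var src = h'.arr slot a ∧ h'.var tgt = h'.arr slot b ∧
      (h'.arr slot a < k → h'.arr slot b < k →
        PairReady E r k (h'.arr slot a) (h'.arr slot b) h') ∧
      t + pendingTime r k h' = pendingTime r k h + 40 := by
  have ha' := hT.le_of_le hak.le
  have hb' := hT.le_of_le hbk.le
  have hsa := hT.le_of_le (hT.lazyTable.slot_le a hak)
  have hsb := hT.le_of_le (hT.lazyTable.slot_le b hbk)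
  suffices lookUp.Ensures E h fun h' t => h'.var src = h.arr slot a ∧ h'.var tgt = h.arr slot b ∧
      h'.var srcPow = h.arr weight (h.arr slot a) ∧
      h'.var tgtPow = h.arr weight (h.arr slot b) ∧ t = 40 from
    this.frame.mono fun h' t ⟨hp, hs, ht, hsp, htp, hτ⟩ => by
      obtain ⟨hT', hpending⟩ := hT.of_preserves hp (by decide) (by decide)
      rw [hp.arr slot (by decide)]
      exact ⟨hT', hs, ht, fun hsk htk => ⟨hT'.toReady, hsk, htk, hsp.trans (hT.weight_eq _ hsk),
        htp.trans (hT.weight_eq _ htk)⟩, by omega⟩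
  refine ensures_seq <| ensures_assign ?_ <| ensures_seq <| ensures_assign ?_ <|
    ensures_seq <| ensures_assign ?_ <| ensures_assign ?_ ⟨?_, ?_, ?_, ?_, rfl⟩
  · simpa [ha] using ha'.1
  · simpa [hb] using hb'.1
  · simpa [ha] using hsa.1
  · simpa [hb] using hsb.1
  all_goals simp [ha, hb]

theorem HoldsTable.safe_flagIndex (hT : HoldsTable E r k h Arc lab) (hak : a < k) (hbk : b < k)
    (hs : h.var src = h.arr slot a) (ht : h.var tgt = h.arr slot b) :
    (flagIndex src tgt).Safe E h ∧
      (flagIndex src tgt).val E h = k * h.arr slot a + h.arr slot b ∧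
      k * h.arr slot a + h.arr slot b < E.cells := by
  have := hT.cells_le
  have := five_mul_cells_le_bound E
  have := hT.lazyTable.slot_le b hbk
  have := Nat.mul_le_mul_left k (hT.lazyTable.slot_le a hak)
  have : k * k + k < (k + 1) ^ 2 := by nlinarith
  refine ⟨?_, ?_, by omega⟩ <;> simp [flagIndex, hT.labels_eq, hs, ht]
  omega

theorem pendingTime_insert {s t : ℕ} (hs : s < k) (ht : t < k) (hflag : h.arr flag (k * s + t) = 0)
    (hslot : h'.arr slot = h.arr slot)
    (hflag' : h'.arr flag = Function.update (h.arr flag) (k * s + t) 1) :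
    pendingTime r k h' + 276 * tableTime r k = pendingTime r k h := by
  rw [pendingTime, pendingTime, hslot, hflag', ← potential_insert hs ht hflag]
  ring

theorem HoldsTable.ensures_insertMissing (hT : HoldsTable E r k h Arc lab) (hak : a < k)
    (hbk : b < k) (hs : h.var src = h.arr slot a) (ht : h.var tgt = h.arr slot b)
    (hP : PairReady E r k (h.arr slot a) (h.arr slot b) h)
    (hopen : h.arr flag (k * h.arr slot a + h.arr slot b) = 0) :
    (insertArcs ;; write flag (flagIndex src tgt) 1).Ensures E h fun h' t =>
      HoldsTable E r k h' (fun u v => Arc u v ∨ lab u = a ∧ lab v = b) lab ∧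
        t + pendingTime r k h' ≤ pendingTime r k h + 15 := by
  refine ensures_seq <| (hP.ensures_insertArcs hT.lazyTable.table).frame.mono
    fun h₁ τ₁ ⟨hp, hP₁, htable, hτ₁⟩ => ?_
  have hslot : h₁.arr slot = h.arr slot := hp.arr _ (by decide)
  have hflag : h₁.arr flag = h.arr flag := hp.arr _ (by decide)
  have hle := hP.index_le_bound hP.src_lt hP.tgt_lt
  have hindex : (flagIndex src tgt).val E h₁ = k * h.arr slot a + h.arr slot b := by
    simp [flagIndex, hP₁.labels_eq, hp.var src (by decide), hp.var tgt (by decide), hs, ht]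
  have hpending := pendingTime_insert (h := h) (r := r)
    (h' := h₁.put flag (k * h.arr slot a + h.arr slot b) 1) hP.src_lt hP.tgt_lt hopen
    (by simpa using hslot) (by simp [hflag])
  refine ensures_write ?_ ?_ ?_ ⟨⟨hP₁.toReady.put (by decide) _ _, ?_⟩, ?_⟩
  · rw [← hindex] at hle
    exact ⟨⟨trivial, trivial, (Nat.le_add_right _ _).trans hle.2⟩, trivial, hle.2⟩
  · exact hT.ten_le_bound.trans' (by norm_num)
  · exact hindex.trans_lt hle.1
  · simpa [hslot, hflag, hindex] using hT.lazyTable.arcs hak hbk htable hP.tgt_lt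
  · rw [hindex, val_ofNat]
    simp [flagIndex]
    omega

theorem HoldsTable.ensures_arcsOp (hT : HoldsTable E r k h Arc lab) (ha : h.var fst = a)
    (hb : h.var snd = b) (hak : a < k) (hbk : b < k) :
    arcsOp.Ensures E h fun h' t =>
      HoldsTable E r k h' (fun u v => Arc u v ∨ lab u = a ∧ lab v = b) lab ∧
        t + pendingTime r k h' ≤ pendingTime r k h + 100 := by
  refine ensures_seq <| (hT.ensures_lookUp ha hb hak hbk).mono
    fun h₁ τ₁ ⟨hT₁, hs, ht, hP, hτ₁⟩ => ?_
  obtain ⟨hsafe, hindex, hcells⟩ := hT₁.safe_flagIndex hak hbk hs ht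
  refine ensures_ite ?_ (fun hcond => ?_) fun hcond =>
    ensures_skip ⟨⟨hT₁.toReady, hT₁.lazyTable.arcs_of_skip ?_⟩, ?_⟩
  · have := E.one_le_bound
    simp [hsafe, hindex, hcells]
    grind
  · obtain ⟨hopen, htk, hsk⟩ : h₁.arr flag (k * h₁.arr slot a + h₁.arr slot b) = 0 ∧
        h₁.arr slot b < k ∧ h₁.arr slot a < k := by
      simpa [hT₁.labels_eq, hs, ht, hindex] using hcond
    refine (hT₁.ensures_insertMissing hak hbk hs ht (hP hsk htk) hopen).mono
      fun h₂ τ₂ ⟨hT₂, hτ₂⟩ => ⟨hT₂, ?_⟩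
    simp [flagIndex]
    omega
  · rintro ⟨hsk, htk, hopen⟩
    simp [hT₁.labels_eq, hs, ht, hindex, hsk, htk, hopen] at hcond
  · simp [flagIndex]
    omega

theorem pendingTime_merge {t : ℕ} (hak : a < k) (hsk : h.arr slot a < k)
    (hslot : h'.arr slot = Function.update (h.arr slot) a k)
    (hclear : IsCleared k t (h.arr flag) (h'.arr flag)) :
    60 * tableSize r k + 34 * k + pendingTime r k h' ≤ pendingTime r k h := by
  have hpotential := potential_merge hak hsk hclear
  have hS := tableSize_pos r k
  have hU := tableSize_le_tableTime r k
  rw [← hslot] at hpotential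
  have := Nat.mul_le_mul_left (tableTime r k) hpotential
  rw [pendingTime, pendingTime]
  nlinarith

theorem HoldsTable.ensures_merge (hT : HoldsTable E r k h Arc lab) (hak : a < k) (hbk : b < k)
    (hab : a ≠ b) (ht : h.var tgt = h.arr slot b)
    (hP : PairReady E r k (h.arr slot a) (h.arr slot b) h) :
    (mergeSlots ;; clearFlags).Ensures E h fun h' t =>
      HoldsTable E r k (h'.put slot a k) Arc (fun v => if lab v = a then b else lab v) ∧
        t + pendingTime r k (h'.put slot a k) ≤ pendingTime r k h + 3 := by
  refine ensures_seq <| hP.ensures_mergeSlots.frame.mono fun h₁ τ₁ ⟨hp₁, hP₁, htable, hτ₁⟩ => ?_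
  have ht₁ := (hp₁.var tgt (by decide)).trans ht
  refine (hP₁.ensures_clearFlags ht₁ hP.tgt_lt).frame.mono
    fun h₂ τ₂ ⟨hp₂, hR₂, hclear, hτ₂⟩ => ?_
  have hslot : h₂.arr slot = h.arr slot := (hp₂.arr _ (by decide)).trans (hp₁.arr _ (by decide))
  rw [hp₁.arr flag (by decide)] at hclear
  rw [← topTable_of_preserves hp₂ (by decide) (by decide)] at htable
  refine ⟨⟨hR₂.put (by decide) _ _, ?_⟩, ?_⟩
  · simpa [hslot] using hT.lazyTable.relabel_merge hak hbk hab hP.src_lt hP.tgt_lt htable hclear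
  · have := pendingTime_merge (r := r) (h' := h₂.put slot a k) hak hP.src_lt (by simp [hslot])
      (by simpa using hclear)
    omega

theorem pendingTime_rename (hak : a < k) (hsk : h.arr slot a < k)
    (hslot : h'.arr slot = Function.update (Function.update (h.arr slot) b (h.arr slot a)) a k)
    (hflag : h'.arr flag = h.arr flag) : pendingTime r k h' ≤ pendingTime r k h := by
  rw [pendingTime, pendingTime, hslot, hflag]
  gcongr
  exact potential_rename _ hak hsk

theorem HoldsTable.ensures_rename (hT : HoldsTable E r k h Arc lab) (hak : a < k) (hbk : b < k)
    (hab : a ≠ b) (hb : h.var snd = b) (hs : h.var src = h.arr slot a) (hsk : h.arr slot a < k)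
    (htk : ¬ h.arr slot b < k) :
    (write slot snd src).Ensures E h fun h' t =>
      HoldsTable E r k (h'.put slot a k) Arc (fun v => if lab v = a then b else lab v) ∧
        t + pendingTime r k (h'.put slot a k) ≤ pendingTime r k h + 10 := by
  refine ensures_write trivial trivial ?_ ⟨⟨(hT.toReady.put ?_ _ _).put ?_ _ _, ?_⟩, ?_⟩
  · simpa [hb] using (hT.le_of_le hbk.le).1
  · decide
  · decide
  · simpa [hb, hs] using hT.lazyTable.relabel_rename hak hbk hab hsk htk
  · have := pendingTime_rename (r := r) (b := b) (h := h)
      (h' := (h.put slot b (h.arr slot a)).put slot a k) hak hsk (by simp) (by simp)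
    simp [hb, hs]
    omega

theorem HoldsTable.ensures_moveSlot (hT : HoldsTable E r k h Arc lab) (hak : a < k) (hbk : b < k)
    (hab : a ≠ b) (hb : h.var snd = b) (hs : h.var src = h.arr slot a)
    (ht : h.var tgt = h.arr slot b) (hsk : h.arr slot a < k)
    (hP : h.arr slot b < k → PairReady E r k (h.arr slot a) (h.arr slot b) h) :
    moveSlot.Ensures E h fun h' t =>
      HoldsTable E r k (h'.put slot a k) Arc (fun v => if lab v = a then b else lab v) ∧
        t + pendingTime r k (h'.put slot a k) ≤ pendingTime r k h + 16 := by
  refine ensures_ite (by simp) (fun htgt => ?_) fun htgt => ?_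
  · have htk : h.arr slot b < k := by simpa [hT.labels_eq, ht] using htgt
    refine (hT.ensures_merge hak hbk hab ht (hP htk)).mono fun h' τ ⟨hT', hτ⟩ => ⟨hT', ?_⟩
    simp
    omega
  · have htk : ¬ h.arr slot b < k := by simpa [hT.labels_eq, ht] using htgt
    refine (hT.ensures_rename hak hbk hab hb hs hsk htk).mono fun h' τ ⟨hT', hτ⟩ => ⟨hT', ?_⟩
    simp
    omega

theorem HoldsTable.ensures_relabelOp (hT : HoldsTable E r k h Arc lab) (ha : h.var fst = a)
    (hb : h.var snd = b) (hak : a < k) (hbk : b < k) :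
    relabelOp.Ensures E h fun h' t =>
      HoldsTable E r k h' Arc (fun v => if lab v = a then b else lab v) ∧
        t + pendingTime r k h' ≤ pendingTime r k h + 100 := by
  refine ensures_seq <| (hT.ensures_lookUp ha hb hak hbk).frame.mono
    fun h₁ τ₁ ⟨hp, hT₁, hs, ht, hP, hτ₁⟩ => ?_
  have ha₁ : h₁.var fst = a := (hp.var _ (by decide)).trans ha
  have hb₁ : h₁.var snd = b := (hp.var _ (by decide)).trans hb
  refine ensures_ite ?_ (fun hcond => ?_) fun hcond =>
    ensures_skip ⟨⟨hT₁.toReady, hT₁.lazyTable.relabel_of_skip (b := b) ?_⟩, ?_⟩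
  · have := E.one_le_bound
    simp
    grind
  · obtain ⟨hab, hsk⟩ : a ≠ b ∧ h₁.arr slot a < k := by
      simpa [hT₁.labels_eq, hs, ha₁, hb₁] using hcond
    refine ensures_seq <| (hT₁.ensures_moveSlot hak hbk hab hb₁ hs ht hsk (hP hsk)).frame.mono
      fun h₂ τ₂ ⟨hp₂, hT₂, hτ₂⟩ => ensures_write trivial trivial ?_ ?_
    all_goals
      have ha₂ : h₂.var fst = a := (hp₂.var _ (by decide)).trans ha₁
      have hk₂ : h₂.var labels = k := (hp₂.var _ (by decide)).trans hT₁.labels_eq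
    · simpa [ha₂] using (hT₁.le_of_le hak.le).1
    · simp only [val_var, ha₂, hk₂]
      refine ⟨hT₂, ?_⟩
      simp
      omega
  · rintro ⟨hsk, hab⟩
    simp [hT₁.labels_eq, hs, ha₁, hb₁, hsk, hab] at hcond
  · simp
    omega

end Flush

section Operations

variable {E : Env Arr} {r k a m : ℕ} {h h' : Store Var Arr}
  {V V' : Type} {Arc : V → V → Prop} {lab : V → ℕ} {Arc' : V' → V' → Prop} {lab' : V' → ℕ}

/-- A bound for the time for an operation that makes a new table, together with the pending time of
this table. -/
def newTableTime (r k : ℕ) : ℕ := 1400 * ((k + 1) ^ 2 * tableTime r k)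

theorem time_le_newTableTime (r k : ℕ) :
    42 * ((k + 1) * tableSize r k) + 41 * tableSize r k + 100 +
      (30 * (k + 1) ^ 2 + 276 * (tableTime r k * (4 * k ^ 2))) ≤ newTableTime r k := by
  have hU := tableSize_le_tableTime r k
  have hpos : 1 ≤ tableTime r k := (tableSize_pos r k).trans_le hU
  rw [newTableTime]
  have h₁ : (k + 1) * tableSize r k ≤ (k + 1) ^ 2 * tableTime r k := by
    gcongr
    nlinarith
  have h₂ : tableTime r k * k ^ 2 ≤ (k + 1) ^ 2 * tableTime r k := by
    rw [mul_comm]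
    gcongr
    omega
  have h₃ : (k + 1) ^ 2 ≤ (k + 1) ^ 2 * tableTime r k := Nat.le_mul_of_pos_right _ hpos
  have h₄ : tableSize r k ≤ (k + 1) * tableSize r k := Nat.le_mul_of_pos_left _ (by omega)
  have h₅ : 1 ≤ (k + 1) ^ 2 := Nat.one_le_pow _ _ (by omega)
  nlinarith

theorem Ready.set_base (hR : Ready E r k h) (hm : m + tableSize r k + (k + 1) ^ 2 ≤ E.cells) :
    Ready E r k (h.set base m) where
  __ := hR
  colors_eq := by simpa using hR.colors_eq
  labels_eq := by simpa using hR.labels_eq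
  area_eq := by simpa using hR.area_eq
  colorPow_eq := by simpa using hR.colorPow_eq
  slotPow_eq := by simpa using hR.slotPow_eq
  entries_eq := by simpa using hR.entries_eq
  cells_le := by simpa using hm

theorem Ready.ensures_resetSlots (hR : Ready E r k h) (hlab : ∀ v, lab v < k)
    (hT : IsTable r k (topTable h slotTable) Arc lab) :
    resetSlots.Ensures E h fun h' t => HoldsTable E r k h' Arc lab ∧
      t + pendingTime r k h' ≤ 30 * (k + 1) ^ 2 + 276 * (tableTime r k * (4 * k ^ 2)) := by
  have hcells := hR.cells_le
  refine (OrientedColoring.ensures_resetSlots hR.labels_eq hR.area_eq (by omega)).frame.mono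
    fun h' t ⟨hp, hslot, hflag, ht⟩ =>
      ⟨⟨hR.of_preserves hp (by decide) (by decide), ?_⟩, Nat.add_le_add ht ?_⟩
  · rw [topTable_of_preserves hp (by decide) (by decide)]
    exact .of_isTable hlab hslot hflag hT
  · exact Nat.mul_le_mul_left _ (Nat.mul_le_mul_left _ (potential_le ..))

theorem Ready.ensures_replaceTable {e : Term} {g : ℕ → ℕ} (hR : Ready E r k h)
    (hlab : ∀ v, lab v < k) (hg : IsTable r k g Arc lab)
    (hsafe : ∀ x < tableSize r k, e.Safe E (rewritten h slotTable g x))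
    (hval : ∀ x < tableSize r k, e.val E (rewritten h slotTable g x) = g x) :
    (replaceTable e).Ensures E h fun h' t => HoldsTable E r k h' Arc lab ∧
      t + pendingTime r k h' ≤ tableSize r k * (e.cost + 15) + 3 +
        (30 * (k + 1) ^ 2 + 276 * (tableTime r k * (4 * k ^ 2))) := by
  refine ensures_seq <| (ensures_rewriteTable hR hsafe hval).frame.mono
    fun h₁ t₁ ⟨hp, htable, ht₁⟩ => ?_
  have hR₁ := hR.of_preserves hp (by simp [parameters, rewriteTable, assigned])
    (by simp [rewriteTable, written])
  refine (hR₁.ensures_resetSlots hlab fun x hx => (htable x hx).symm ▸ hg x hx).mono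
    fun h' t ⟨hT, ht⟩ => ⟨hT, by omega⟩

theorem Flushable.ensures_vertexOp (hF : Flushable E r k h) (ha : h.var fst = a) (hak : a < k)
    (hcells : h.var base + 2 * tableSize r k + (k + 1) ^ 2 ≤ E.cells) :
    vertexOp.Ensures E h fun h' t =>
      HoldsTable E r k h' (fun _ _ => False) (fun _ : Unit => a) ∧
      h'.var base = h.var base + tableSize r k ∧
      h'.arr labelTable =
        fill (h.arr labelTable) (h.var base) (tableSize r k) (tableByLabels r k h) ∧
      t + pendingTime r k h' + 70 ≤ newTableTime r k := by
  refine ensures_seq <| (hF.ensures_flush hF.slot_le hF.injective).frame.mono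
    fun h₁ τ₁ ⟨hp₁, hR₁, hflush, hτ₁⟩ => ?_
  have hbase₁ : h₁.var base = h.var base := hp₁.var _ (by decide)
  have ha₁ : h₁.var fst = a := (hp₁.var _ (by decide)).trans ha
  have hbound := five_mul_cells_le_bound E
  have hcell := hF.le_of_le hak.le
  refine ensures_seq <| ensures_assign ?_ <| ensures_seq <| ensures_assign ?_ ?_
  · simp [hbase₁, hR₁.entries_eq]; omega
  · simpa [ha₁] using hcell.1
  have hR₂ := (hR₁.set_base (m := h.var base + tableSize r k) (by omega)).set (x := srcPow)
    (by decide) (2 ^ (r * a))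
  simp only [val_add, val_var, hbase₁, hR₁.entries_eq, val_read, Store.set_var, Store.set_arr,
    ha₁, ne_eq, reduceCtorEq, not_false_eq_true, Function.update_of_ne, hR₁.weight_eq a hak]
  refine (hR₂.ensures_replaceTable (fun _ => hak) (isTable_vertex r k a) (fun x _ => ?_)
    fun x _ => ?_).frame.mono fun h' t ⟨hp, hT, ht⟩ => ⟨hT, ?_, ?_, ?_⟩
  · simp [colorSetAt, rewritten]
  · exact if_congr (by simp [colorSetAt, rewritten, colorSet, hR₁.colorPow_eq]) rfl rfl
  · simpa using hp.var base (by decide)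
  · exact (hp.arr labelTable (by decide)).trans hflush
  · have := time_le_newTableTime r k
    simp [colorSetAt] at ht ⊢
    omega

theorem HoldsTable.ensures_unionOp (hT : HoldsTable E r k h Arc' lab')
    (hbase : h.var base = m + tableSize r k) (hlab : ∀ v, lab v < k)
    (hX : IsTable r k (fun x => h.arr labelTable (m + x)) Arc lab) :
    unionOp.Ensures E h fun h' t =>
      HoldsTable E r k h' (sumArc Arc Arc') (Sum.elim lab lab') ∧ h'.var base = m ∧
      (∀ i < m + tableSize r k, h'.arr labelTable i = h.arr labelTable i) ∧
      t + pendingTime r k h' + 70 ≤ newTableTime r k := by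
  have hF := hT.flushable
  have hY := hT.lazyTable.isTable
  refine ensures_seq <| (hF.ensures_flush hF.slot_le hF.injective).frame.mono
    fun h₁ τ₁ ⟨hp₁, hR₁, hflush, hτ₁⟩ => ?_
  have hbase₁ : h₁.var base = m + tableSize r k := (hp₁.var _ (by decide)).trans hbase
  have hX₁ x (hx : x < tableSize r k) : h₁.arr labelTable (m + x) = h.arr labelTable (m + x) := by
    rw [hflush, fill_of_lt (by omega)]
  have hY₁ x (hx : x < tableSize r k) :
      h₁.arr labelTable (m + (tableSize r k + x)) = tableByLabels r k h x := by
    rw [hflush, ← add_assoc, ← hbase, fill_add hx, tableByLabels]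
  have hbound := five_mul_cells_le_bound E
  have hcells := hT.cells_le
  refine ensures_seq <| ensures_assign ?_ ?_
  · simp
  have hR₂ := hR₁.set_base (m := m) (by omega)
  simp only [val_sub, val_var, hbase₁, hR₁.entries_eq, Nat.add_sub_cancel]
  refine (hR₂.ensures_replaceTable (Sum.rec hlab fun v => (hT.lazyTable.lab_lt v).1)
    (hX.union hY) (fun x hx => ?_)
    fun x hx => ?_).frame.mono fun h' t ⟨hp, hT, ht⟩ => ⟨hT, ?_, fun i hi => ?_, ?_⟩
  · have hle : h.arr labelTable (m + x) * tableByLabels r k h x ≤ 1 :=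
      mul_le_mul' (hX x hx).le_one (hY x hx).le_one
    have := E.one_le_bound
    simp [rewritten, topTable, hR₁.entries_eq, hX₁ x hx, hY₁ x hx]
    omega
  · simp [topTable, rewritten, hX₁ x hx, hY₁ x hx, tableByLabels, hR₁.entries_eq]
  · simpa using hp.var base (by decide)
  · rw [hp.arr labelTable (by decide)]
    exact (congrFun hflush i).trans (fill_of_lt (hbase ▸ hi))
  · have := time_le_newTableTime r k
    simp [top] at ht ⊢
    omega

end Operations

section Evaluation

variable {E : Env Arr} {r k a m : ℕ} {h h' : Store Var Arr}
  {V V' : Type} {Arc : V → V → Prop} {lab : V → ℕ} {Arc' : V' → V' → Prop} {lab' : V' → ℕ}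

/-- From operation number `p` on, the input continues with the word `w`. -/
def Encodes (E : Env Arr) (p : ℕ) (w : List ℕ) : Prop :=
  ∀ i (hi : i < w.length), 3 * p + (3 + i) < E.inputLength ∧ E.input (3 * p + (3 + i)) = w[i]

theorem Encodes.append {p n : ℕ} {u v : List ℕ} (hu : u.length = 3 * n)
    (hw : Encodes E p (u ++ v)) : Encodes E p u ∧ Encodes E (p + n) v := by
  refine ⟨fun i hi => ?_, fun i hi => ?_⟩
  · have := hw i (by simp; omega)
    rwa [List.getElem_append_left hi] at this
  · have := hw (u.length + i) (by simpa using hi)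
    simp only [List.getElem_append_right (Nat.le_add_right ..), Nat.add_sub_cancel_left] at this
    rwa [show 3 * (p + n) + (3 + i) = 3 * p + (3 + (u.length + i)) by omega]

theorem ensures_fetch {c a b : ℕ} (hcode : Encodes E (h.var pos) [c, a, b]) :
    fetch.Ensures E h fun h' t =>
      h'.var kind = c ∧ h'.var fst = a ∧ h'.var snd = b ∧ t = 27 := by
  have hc := hcode 0 (by simp)
  have ha := hcode 1 (by simp)
  have hb := hcode 2 (by simp)
  have := E.fits
  simp only [Nat.reduceAdd, List.getElem_cons_zero, List.getElem_cons_succ] at hc ha hb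
  refine ensures_seq <| ensures_assign ?_ <| ensures_seq <| ensures_assign ?_ <|
    ensures_assign ?_ ⟨?_, ?_, ?_, ?_⟩ <;> simp [codeWord, hc.2, ha.2, hb.2]
  all_goals omega

/-- The command that executes the operations of the given kind. -/
def operation : ℕ → Cmd Var Arr
  | 0 => vertexOp
  | 1 => unionOp
  | 2 => arcsOp
  | _ => relabelOp

theorem ensures_execute {c : ℕ} {Q : Store Var Arr → ℕ → Prop} (hE : 2 ≤ E.bound)
    (hc : h.var kind = c)
    (hop : (operation c).Ensures E h fun h' t => ∀ t₀ ≤ 15, Q h' (t₀ + t)) :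
    execute.Ensures E h Q := by
  have hsafe (n : ℕ) (hn : n ≤ 2) : (Expr.eq kind (lit n) : Term).Safe E h := by
    simpa using hn.trans hE
  have htrue {n : ℕ} (hn : c = n) : (Expr.eq kind (lit n) : Term).val E h ≠ 0 := by
    simp [hc, hn]
  have hfalse {n : ℕ} (hn : c ≠ n) : (Expr.eq kind (lit n) : Term).val E h = 0 := by
    simp [hc, hn]
  refine ensures_ite (hsafe 0 (by omega)) (fun h₀ => ?_) fun h₀ =>
    ensures_ite (hsafe 1 (by omega)) (fun h₁ => ?_) fun h₁ =>
    ensures_ite (hsafe 2 (by omega)) (fun h₂ => ?_) fun h₂ => ?_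
  · obtain rfl : c = 0 := by_contra fun hn => h₀ (hfalse hn)
    exact hop.mono fun h' t hQ => hQ _ (by simp)
  · obtain rfl : c = 1 := by_contra fun hn => h₁ (hfalse hn)
    exact hop.mono fun h' t hQ => by simpa [← add_assoc] using hQ _ (by simp)
  · obtain rfl : c = 2 := by_contra fun hn => h₂ (hfalse hn)
    exact hop.mono fun h' t hQ => by simpa [← add_assoc] using hQ _ (by simp)
  · have hop' : relabelOp.Ensures E h fun h' t => ∀ t₀ ≤ 15, Q h' (t₀ + t) := by
      match c with
      | 0 => exact absurd h₀ (htrue rfl)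
      | 1 => exact absurd h₁ (htrue rfl)
      | 2 => exact absurd h₂ (htrue rfl)
      | _ + 3 => exact hop
    exact hop'.mono fun h' t hQ => by simpa [← add_assoc] using hQ _ (by simp)

theorem ensuresRounds_step {c a b : ℕ} {Q : Store Var Arr → ℕ → Prop}
    (hcode : Encodes E (h.var pos) [c, a, b])
    (hop : ∀ h₁, fetch.Preserves h h₁ → h₁.var fst = a → h₁.var snd = b →
      (operation c).Ensures E h₁ fun h' t =>
        ∀ t' ≤ t + 46, Q (h'.set pos (h.var pos + 1)) t') :
    EnsuresRounds E pos step 1 h Q := by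
  have hlen := (hcode 0 (by simp)).1
  have hfits := E.fits
  refine ensuresRounds_one <| ensures_seq <| (ensures_fetch hcode).frame.mono
    fun h₁ t₁ ⟨hp, hc, ha, hb, ht₁⟩ => ?_
  exact ensures_execute (by omega) hc <| (hop h₁ hp ha hb).mono fun h' t hQ t₀ ht₀ =>
    hQ _ (by omega)

/-- The store `h'` is the result of evaluating the expression `X`, starting with the store `h`: the
table of `X` is pushed on the stack, and the table of `h` is stored below it in terms of labels. -/
structure Evaluated (E : Env Arr) (r : ℕ) (X : CWExpr k) (h h' : Store Var Arr) : Prop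
    extends HoldsTable E r k h' X.Arc X.natLabel where
  base_eq : h'.var base = h.var base + tableSize r k
  pos_eq : h'.var pos = h.var pos + X.size
  labelTable_eq : ∀ i < h.var base + tableSize r k, h'.arr labelTable i =
    fill (h.arr labelTable) (h.var base) (tableSize r k) (tableByLabels r k h) i

/-- A bound for the time for the evaluation of `X`. -/
noncomputable def evaluationTime (r : ℕ) (X : CWExpr k) : ℕ :=
  200 * X.size + 2 * (Nat.card X.Vertex * newTableTime r k)

/-- Whenever an expression occurs in the input, some rounds of the main loop evaluate it. -/
def Evaluates (E : Env Arr) (r : ℕ) (X : CWExpr k) : Prop :=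
  ∀ h : Store Var Arr, Flushable E r k h → Encodes E (h.var pos) X.code →
    h.var base + (Nat.card X.Vertex + 1) * tableSize r k + (k + 1) ^ 2 ≤ E.cells →
    EnsuresRounds E pos step X.size h fun h' t => Evaluated E r X h h' ∧
      t + pendingTime r k h' + newTableTime r k ≤ evaluationTime r X

theorem HoldsTable.set {x : Var} (hT : HoldsTable E r k h Arc lab) (hx : x ∉ parameters) (a : ℕ) :
    HoldsTable E r k (h.set x a) Arc lab :=
  ⟨hT.toReady.set hx a, by
    have hbase : base ≠ x := by rintro rfl; exact hx (by decide)
    simpa [topTable_set, hbase] using hT.lazyTable⟩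

theorem Flushable.of_preserves {p : Cmd Var Arr} (hF : Flushable E r k h)
    (hp : p.Preserves h h') (hvar : ∀ x ∈ parameters, x ∉ p.assigned) (hw : p.written = []) :
    Flushable E r k h' where
  toReady := hF.toReady.of_preserves hp hvar (by simp [hw])
  slot_le := by simpa only [hp.arr slot (by simp [hw])] using hF.slot_le
  injective := by simpa only [hp.arr slot (by simp [hw])] using hF.injective

theorem tableByLabels_of_preserves {p : Cmd Var Arr} (hp : p.Preserves h h')
    (hbase : base ∉ p.assigned) (hw : p.written = []) :
    tableByLabels r k h' = tableByLabels r k h := by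
  funext x
  simp only [tableByLabels, topTable, hp.arr _ (hw ▸ List.not_mem_nil), hp.var _ hbase]

theorem evaluates_vertex (a : Fin k) : Evaluates E r (.vertex a) := by
  intro h hF hcode hcells
  have hcard : Nat.card (CWExpr.vertex a).Vertex = 1 := Nat.card_unique (α := Unit)
  rw [hcard] at hcells
  rw [evaluationTime, hcard]
  refine ensuresRounds_step hcode fun h₁ hp ha _ => ?_
  have hbase₁ := hp.var base (by decide)
  refine ((hF.of_preserves hp (by decide) rfl).ensures_vertexOp ha a.isLt
    (by rw [hbase₁]; omega)).mono fun h' t ⟨hT, hbase, hfill, ht⟩ t' ht' =>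
      ⟨⟨hT.set (by decide) _, ?_, by simp [CWExpr.size], fun i _ => ?_⟩, ?_⟩
  · simpa [hbase₁] using hbase
  · rw [tableByLabels_of_preserves hp (by decide) rfl, hp.arr labelTable (by decide), hbase₁]
      at hfill
    exact congrFun hfill i
  · simp only [pendingTime, Store.set_arr, CWExpr.size] at ht ⊢
    omega

theorem Evaluated.ensures_unionOp {X Y : CWExpr k} {h₁ h₂ h₃ : Store Var Arr}
    (hX : Evaluated E r X h h₁) (hY : Evaluated E r Y h₁ h₂) (hp : fetch.Preserves h₂ h₃) :
    unionOp.Ensures E h₃ fun h' t => Evaluated E r (X.union Y) h (h'.set pos (h₂.var pos + 1)) ∧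
      t + pendingTime r k h' + 70 ≤ newTableTime r k := by
  obtain ⟨hT₃, -⟩ := hY.toHoldsTable.of_preserves hp (by decide) rfl
  have hbase₃ : h₃.var base = h₁.var base + tableSize r k :=
    (hp.var base (by decide)).trans hY.base_eq
  have hlabel₃ i (hi : i < h₁.var base + tableSize r k) :=
    hp.arr labelTable (by decide) ▸ hY.labelTable_eq i hi
  have hX₃ : IsTable r k (fun x => h₃.arr labelTable (h₁.var base + x)) X.Arc X.natLabel := by
    intro x hx
    simpa [hlabel₃ _ (Nat.add_lt_add_left hx _), fill_add hx, tableByLabels]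
      using hX.lazyTable.isTable x hx
  refine (hT₃.ensures_unionOp hbase₃ X.natLabel_lt hX₃).mono
    fun h' t ⟨hT, hbase, hfill, ht⟩ => ⟨⟨?_, ?_, ?_, fun i hi => ?_⟩, ht⟩
  · rw [CWExpr.arc_union, CWExpr.natLabel_union]
    exact hT.set (by decide) _
  · simpa [hbase] using hX.base_eq
  · simp [CWExpr.size, hX.pos_eq, hY.pos_eq]; ring
  · have := hX.base_eq
    rw [Store.set_arr, hfill i (by omega), hlabel₃ i (by omega), fill_of_lt (by omega)]
    exact hX.labelTable_eq i hi

theorem evaluates_union {X Y : CWExpr k} (hX : Evaluates E r X) (hY : Evaluates E r Y) :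
    Evaluates E r (X.union Y) := by
  intro h hF hcode hcells
  obtain ⟨hcode, hcop⟩ := Encodes.append (n := X.size + Y.size)
    (by simp [CWExpr.length_code, mul_add]) hcode
  obtain ⟨hcX, hcY⟩ := Encodes.append X.length_code hcode
  have hXpos : 0 < Nat.card X.Vertex := Nat.card_pos
  have hYpos : 0 < Nat.card Y.Vertex := Nat.card_pos
  have hS := tableSize_pos r k
  rw [CWExpr.card_vertex_union] at hcells
  refine ensuresRounds_add <| ensuresRounds_add <| (hX h hF hcX ?_).mono fun h₁ t₁ ⟨hX₁, ht₁⟩ =>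
    (hY h₁ hX₁.flushable ?_ ?_).mono fun h₂ t₂ ⟨hY₂, ht₂⟩ =>
      ensuresRounds_step (c := 1) (a := 0) (b := 0) ?_ fun h₃ hp _ _ => ?_
  · nlinarith
  · rwa [hX₁.pos_eq]
  · rw [hX₁.base_eq]; nlinarith
  · rwa [hY₂.pos_eq, hX₁.pos_eq, add_assoc]
  refine (hX₁.ensures_unionOp hY₂ hp).mono fun h' t ⟨hT, ht⟩ t' ht' => ⟨hT, ?_⟩
  simp only [pendingTime, Store.set_arr, evaluationTime, CWExpr.size,
    CWExpr.card_vertex_union, add_mul _ _ (newTableTime r k)] at *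
  omega

theorem Evaluates.of_update {X X' : CWExpr k} {c a b : ℕ} (hX : Evaluates E r X)
    (hsize : X'.size = X.size + 1) (hcode : X'.code = X.code ++ [c, a, b])
    (hcard : Nat.card X'.Vertex = Nat.card X.Vertex) (hbase : base ∉ (operation c).assigned)
    (hlabel : labelTable ∉ (operation c).written)
    (hop : ∀ h, HoldsTable E r k h X.Arc X.natLabel → h.var fst = a → h.var snd = b →
      (operation c).Ensures E h fun h' t => HoldsTable E r k h' X'.Arc X'.natLabel ∧
        t + pendingTime r k h' ≤ pendingTime r k h + 100) : Evaluates E r X' := by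
  intro h hF hcode' hcells
  rw [hcode] at hcode'
  rw [hsize, evaluationTime, hsize, hcard]
  obtain ⟨hcX, hcop⟩ := Encodes.append X.length_code hcode'
  refine ensuresRounds_add <| (hX h hF hcX (hcard ▸ hcells)).mono fun h₁ t₁ ⟨hX₁, ht₁⟩ => ?_
  rw [← hX₁.pos_eq] at hcop
  refine ensuresRounds_step hcop fun h₂ hp ha hb => ?_
  obtain ⟨hT₂, hpending⟩ := hX₁.toHoldsTable.of_preserves hp (by decide) rfl
  refine (hop h₂ hT₂ ha hb).frame.mono fun h' t ⟨hp', hT, ht⟩ t' ht' =>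
      ⟨⟨hT.set (by decide) _, ?_, ?_, fun i hi => ?_⟩, ?_⟩
  · simpa [hp'.var _ hbase, hp.var base (by decide)] using hX₁.base_eq
  · simp [hsize, hX₁.pos_eq]; ring
  · simpa [hp'.arr _ hlabel, hp.arr labelTable (by decide)] using hX₁.labelTable_eq i hi
  · simp only [pendingTime, Store.set_arr, evaluationTime] at *
    omega

theorem evaluates_arcs {a b : Fin k} (hab : a ≠ b) {X : CWExpr k} (hX : Evaluates E r X) :
    Evaluates E r (X.arcs a b hab) := by
  refine hX.of_update (c := 2) (a := a) (b := b) rfl rfl rfl (by decide) (by decide)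
    fun h hT ha hb => ?_
  rw [CWExpr.arc_arcs]
  exact hT.ensures_arcsOp ha hb a.isLt b.isLt

theorem evaluates_relabel (a b : Fin k) {X : CWExpr k} (hX : Evaluates E r X) :
    Evaluates E r (X.relabel a b) := by
  refine hX.of_update (c := 3) (a := a) (b := b) rfl rfl rfl (by decide) (by decide)
    fun h hT ha hb => ?_
  rw [CWExpr.natLabel_relabel]
  exact hT.ensures_relabelOp ha hb a.isLt b.isLt

theorem evaluates (E : Env Arr) (r : ℕ) (X : CWExpr k) : Evaluates E r X := by
  induction X with
  | vertex a => exact evaluates_vertex a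
  | union X Y hX hY => exact evaluates_union hX hY
  | arcs a b hab X hX => exact evaluates_arcs hab hX
  | relabel a b X hX => exact evaluates_relabel a b hX

end Evaluation

section Program

variable {E : Env Arr} {r k : ℕ} {h h' : Store Var Arr} {X : CWExpr k}

/-- The environment `E` holds the input for `X` and `r` colors. -/
structure HasInput (E : Env Arr) (r : ℕ) (X : CWExpr k) : Prop where
  two_lt_inputLength : 2 < E.inputLength
  input_zero : E.input 0 = r
  input_one : E.input 1 = k
  input_two : E.input 2 = X.size
  encodes : Encodes E 0 X.code

theorem HasInput.ensures_readInput (hX : HasInput E r X) (hcells : (k + 1) ^ 2 ≤ E.cells) :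
    readInput.Ensures E h fun h' t => h'.var colors = r ∧ h'.var labels = k ∧
      h'.var ops = X.size ∧ h'.var area = k * k ∧ t ≤ 20 := by
  have hbound := five_mul_cells_le_bound E
  have hlen := hX.two_lt_inputLength
  have hfits := E.fits
  refine ensures_seq <| ensures_assign ?_ <| ensures_seq <| ensures_assign ?_ <|
    ensures_seq <| ensures_assign ?_ <| ensures_assign ?_ ⟨?_, ?_, ?_, ?_, ?_⟩ <;>
    simp [hX.input_zero, hX.input_one, hX.input_two]
  · omega
  · omega
  · omega
  · nlinarith

theorem ensures_computeColorPow (hr : h.var colors = r) (hbound : 2 ^ r ≤ E.bound) :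
    computeColorPow.Ensures E h fun h' t => h'.var colorPow = 2 ^ r ∧ t ≤ 20 * (r + 1) := by
  have hrounds a : (h.set colorPow a).var colors = r := by simp [hr]
  refine ensures_seq <| ensures_assign (by simpa using E.one_le_bound) <|
    ensures_forTo (by decide) (by decide) (by decide)
      (fun i h' t => h'.var colorPow = 2 ^ i ∧ t ≤ 20 * i) (by simp)
      (fun i hi h' t _ _ ⟨hpow, ht⟩ => ?_) fun h' t ⟨hpow, ht⟩ => ?_
  · rw [hrounds] at hi
    have hle : 2 ^ (i + 1) ≤ 2 ^ r := Nat.pow_le_pow_right two_pos hi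
    refine ensures_assign ?_ ⟨?_, ?_⟩
    · simp [hpow]; omega
    · simp [hpow]; ring
    · simp; omega
  · rw [hrounds] at hpow ht
    simp
    omega

theorem ensures_computeWeights (hk : h.var labels = k) (hpow : h.var colorPow = 2 ^ r)
    (hweight : h.arr weight k = 0) (hcells : k ≤ E.cells) (hbound : 2 ^ (r * k) ≤ E.bound) :
    computeWeights.Ensures E h fun h' t => h'.var slotPow = 2 ^ (r * k) ∧
      (∀ a < k, h'.arr weight a = 2 ^ (r * a)) ∧ h'.arr weight k = 0 ∧ t ≤ 30 * (k + 1) := by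
  have hrounds a : (h.set slotPow a).var labels = k := by simp [hk]
  refine ensures_seq <| ensures_assign (by simpa using E.one_le_bound) <|
    ensures_forTo (by decide) (by decide) (by decide)
      (fun i h' t => h'.var slotPow = 2 ^ (r * i) ∧ (∀ a < i, h'.arr weight a = 2 ^ (r * a)) ∧
        h'.arr weight k = 0 ∧ t ≤ 30 * i) (by simp [hweight])
      (fun i hi h' t hp hidx ⟨hslot, hw, hwk, ht⟩ => ?_) fun h' t ⟨hslot, hw, hwk, ht⟩ => ?_
  · rw [hrounds] at hi
    have hcolor : h'.var colorPow = 2 ^ r := by simp [hp.var colorPow (by decide), hpow]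
    have hle : 2 ^ (r * i) * 2 ^ r ≤ 2 ^ (r * k) := by
      rw [← pow_add, ← mul_add_one]
      gcongr <;> omega
    refine ensures_seq <| ensures_write (by simp) (by simp) (by simp [hidx]; omega) <|
      ensures_assign ?_ ⟨?_, fun a ha => ?_, ?_, ?_⟩
    · simp [hslot, hcolor]; omega
    · simp [hslot, hcolor, mul_add_one, pow_add]
    · rcases Nat.lt_succ_iff_lt_or_eq.1 ha with ha | rfl
      · simp [hidx, ha.ne, hw a ha]
      · simp [hidx, hslot]
    · simp [hidx, hi.ne', hwk]
    · simp; omega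
  · rw [hrounds] at hslot hw ht
    refine ⟨hslot, hw, hwk, ?_⟩
    simp
    omega

theorem ensures_computeEntries (hr : h.var colors = r) (hslot : h.var slotPow = 2 ^ (r * k))
    (hpow : 2 ^ r ≤ E.bound) (hbound : tableSize r k ≤ E.bound) :
    computeEntries.Ensures E h fun h' t =>
      h'.var entries = tableSize r k ∧ t ≤ 30 * (r + 1) := by
  have hrounds a b : ((h.set entries a).set high b).var colors = r := by simp [hr]
  refine ensures_seq <| ensures_assign (by simp) <| ensures_seq <|
    ensures_assign (by simpa using E.one_le_bound) <|
    ensures_forTo (by decide) (by decide) (by decide)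
      (fun i h' t => h'.var high = 2 ^ i ∧ h'.var entries = 2 ^ (r * k + i.choose 2) ∧
        t ≤ 30 * i) (by simp [hslot])
      (fun i hi h' t _ _ ⟨hhigh, hentries, ht⟩ => ?_) fun h' t ⟨_, hentries, ht⟩ => ?_
  · rw [hrounds] at hi
    have hhigh_le : 2 ^ (i + 1) ≤ 2 ^ r := Nat.pow_le_pow_right two_pos hi
    have hchoose : (i + 1).choose 2 ≤ r.choose 2 := Nat.choose_le_choose 2 hi
    have hentries_le : 2 ^ (r * k + (i + 1).choose 2) ≤ tableSize r k :=
      Nat.pow_le_pow_right two_pos (by omega)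
    have hmul : 2 ^ (r * k + i.choose 2) * 2 ^ i = 2 ^ (r * k + (i + 1).choose 2) := by
      rw [← pow_add, choose_two_succ]
      ring
    refine ensures_seq <| ensures_assign ?_ <| ensures_assign ?_ ⟨?_, ?_, ?_⟩
    · simp [hentries, hhigh, hmul]; omega
    · simp [hhigh]; omega
    · simp [hhigh]; ring
    · simp [hentries, hhigh, hmul]
    · simp; omega
  · rw [hrounds] at hentries ht
    refine ⟨hentries, ?_⟩
    simp
    omega

theorem HasInput.ensures_setParameters (hX : HasInput E r X) (hk : 0 < k)
    (hcells : h.var base + tableSize r k + (k + 1) ^ 2 ≤ E.cells) (hweight : h.arr weight k = 0) :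
    setParameters.Ensures E h fun h' t =>
      Ready E r k h' ∧ h'.var ops = X.size ∧ t ≤ 120 * ((r + 1) * (k + 1)) := by
  have hbound := five_mul_cells_le_bound E
  have hrk : r ≤ r * k := Nat.le_mul_of_pos_right r hk
  have hpow : 2 ^ r ≤ tableSize r k := Nat.pow_le_pow_right two_pos (by omega)
  have hslotPow : 2 ^ (r * k) ≤ tableSize r k := Nat.pow_le_pow_right two_pos (by omega)
  have hsq : k ≤ (k + 1) ^ 2 := by nlinarith
  refine ensures_seq <| (hX.ensures_readInput (by omega)).frame.mono
    fun h₁ t₁ ⟨hp₁, hr₁, hk₁, hops₁, harea₁, ht₁⟩ => ?_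
  refine ensures_seq <| (ensures_computeColorPow hr₁ (by omega)).frame.mono
    fun h₂ t₂ ⟨hp₂, hcolor₂, ht₂⟩ => ?_
  have hk₂ := (hp₂.var labels (by decide)).trans hk₁
  have hweight₂ : h₂.arr weight k = 0 := by
    rw [hp₂.arr _ (by decide), hp₁.arr _ (by decide), hweight]
  refine ensures_seq <| (ensures_computeWeights hk₂ hcolor₂ hweight₂ (by omega)
    (by omega)).frame.mono fun h₃ t₃ ⟨hp₃, hslot₃, hw₃, hwk₃, ht₃⟩ => ?_
  have hvar₃ x (hx₂ : x ∉ computeColorPow.assigned) (hx₃ : x ∉ computeWeights.assigned) :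
      h₃.var x = h₁.var x := (hp₃.var x hx₃).trans (hp₂.var x hx₂)
  have hr₃ := (hvar₃ colors (by decide) (by decide)).trans hr₁
  refine (ensures_computeEntries hr₃ hslot₃ (by omega) (by omega)).frame.mono
    fun h' t₄ ⟨hp₄, hentries, ht₄⟩ => ⟨⟨?_, ?_, ?_, ?_, ?_, hentries, ?_, ?_, ?_⟩, ?_, ?_⟩
  · rw [hp₄.var _ (by decide), hr₃]
  · rw [hp₄.var _ (by decide), hp₃.var _ (by decide), hk₂]
  · rw [hp₄.var _ (by decide), hvar₃ _ (by decide) (by decide), harea₁]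
  · rw [hp₄.var _ (by decide), hp₃.var _ (by decide), hcolor₂]
  · rw [hp₄.var _ (by decide), hslot₃]
  · rwa [hp₄.arr _ (by decide)]
  · rwa [hp₄.arr _ (by decide)]
  · rwa [hp₄.var _ (by decide), hvar₃ _ (by decide) (by decide), hp₁.var _ (by decide)]
  · rw [hp₄.var _ (by decide), hvar₃ _ (by decide) (by decide), hops₁]
  · have hr : r + 1 ≤ (r + 1) * (k + 1) := Nat.le_mul_of_pos_right _ k.succ_pos
    have hk : k + 1 ≤ (r + 1) * (k + 1) := Nat.le_mul_of_pos_left _ r.succ_pos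
    omega

theorem Ready.ensures_resetSlots_flushable (hR : Ready E r k h) :
    resetSlots.Ensures E h fun h' t => Flushable E r k h' ∧ t ≤ 30 * (k + 1) ^ 2 := by
  have hcells := hR.cells_le
  refine (OrientedColoring.ensures_resetSlots hR.labels_eq hR.area_eq (by omega)).frame.mono
    fun h' t ⟨hp, hslot, _, ht⟩ => ⟨⟨hR.of_preserves hp (by decide) (by decide), ?_, ?_⟩, ht⟩
  · exact fun a ha => (hslot a ha).le.trans ha.le
  · exact fun a ha b hb _ hab => by rwa [hslot a ha, hslot b hb] at hab

theorem Ready.ensures_decideTable (hR : Ready E r k h) (hanswer : h.var answer = 0) :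
    decideTable.Ensures E h fun h' t =>
      IsTruthValue (h'.var answer)
        (∃ x < 2 ^ r.choose 2, 0 < topTable h slotTable (fullEntry r k x)) ∧
      t ≤ 50 * tableSize r k := by
  have hpos : 0 < 2 ^ (r * k) := by positivity
  have hdiv : h.var entries / h.var slotPow = 2 ^ r.choose 2 := by
    rw [hR.entries_eq, hR.slotPow_eq, tableSize_eq, Nat.mul_div_cancel_left _ hpos]
  have hcells := hR.cells_le
  have hbound := five_mul_cells_le_bound E
  refine ensures_seq <| ensures_assign (by simp) ?_
  simp only [val_div, val_var, hdiv]
  refine ensures_forTo (by decide) (by decide) (by decide) (fun i h' t =>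
      IsTruthValue (h'.var answer) (∃ x < i, 0 < topTable h slotTable (fullEntry r k x)) ∧
      t ≤ 30 * i) ⟨⟨by simp, by simp [hanswer]⟩, by simp⟩
    (fun i hi h' t hp hidx ⟨hanswer', ht⟩ => ?_) fun h' t ⟨hanswer', ht⟩ => ⟨?_, ?_⟩
  · have hlt := fullEntry_lt (k := k) (by simpa using hi)
    have hslot : h'.var slotPow = 2 ^ (r * k) := by
      simpa [hp.var slotPow (by decide)] using hR.slotPow_eq
    have htop : topTable h' slotTable = topTable h slotTable :=
      (topTable_of_preserves hp (by decide) (by decide)).trans (by simp [topTable_set])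
    have hval_entry : (top slotTable ((slotPow : Term) * index + (slotPow - 1))).val E h' =
        topTable h slotTable (fullEntry r k i) := by
      simp [htop, fullEntry, hslot, hidx]
    have hbase : h'.var base = h.var base := by simp [hp.var base (by decide)]
    simp only [Nat.exists_lt_succ_right]
    refine ensures_ite ?_ (fun hval => ensures_assign (by simpa using E.one_le_bound) ⟨?_, ?_⟩)
      fun hval => ensures_skip ⟨?_, ?_⟩
    · simp [hslot, hidx, hbase]
      rw [fullEntry] at hlt
      omega
    · rw [hval_entry] at hval
      simpa using ⟨fun _ => rfl, fun hne => absurd (Or.inr (Nat.pos_of_ne_zero hval)) hne⟩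
    · simp [top]; omega
    · rw [hval_entry] at hval
      simpa [hval] using hanswer'
    · simp [top]; omega
  · simpa using hanswer'
  · have := two_pow_choose_le_tableSize r k
    have := tableSize_pos r k
    simp at ht ⊢
    omega

theorem HasInput.ensures_evaluation (hX : HasInput E r X) (hF : Flushable E r k h)
    (hops : h.var ops = X.size)
    (hcells : h.var base + (Nat.card X.Vertex + 1) * tableSize r k + (k + 1) ^ 2 ≤ E.cells) :
    (forTo pos ops step).Ensures E h fun h' t => HoldsTable E r k h' X.Arc X.natLabel ∧
      t + newTableTime r k ≤ evaluationTime r X + 3 := by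
  have hF₀ : Flushable E r k (h.set pos 0) :=
    ⟨hF.toReady.set (by decide) 0, hF.slot_le, hF.injective⟩
  refine ensures_forTo_of_rounds (by decide) (by decide) (by decide) ?_
  rw [hops]
  exact (evaluates E r X _ hF₀ (by simpa using hX.encodes) (by simpa using hcells)).mono
    fun h' t ⟨hT, ht⟩ => ⟨hT.toHoldsTable, by omega⟩

theorem succ_le_tableTime (r k : ℕ) : r + 1 ≤ tableTime r k :=
  (Nat.le_self_pow two_ne_zero _).trans (Nat.le_mul_of_pos_right _ (tableSize_pos r k))

theorem tableSize_le_mul_tableTime (r k : ℕ) : tableSize r k ≤ (k + 1) ^ 2 * tableTime r k :=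
  (tableSize_le_tableTime r k).trans (Nat.le_mul_of_pos_left _ (by positivity))

theorem succ_sq_le_mul_tableTime (r k : ℕ) : (k + 1) ^ 2 ≤ (k + 1) ^ 2 * tableTime r k :=
  Nat.le_mul_of_pos_right _ (Nat.zero_lt_of_lt (succ_le_tableTime r k))

theorem initialization_le_newTableTime (r k : ℕ) : 120 * ((r + 1) * (k + 1)) + 30 * (k + 1) ^ 2 +
    50 * tableSize r k + 3 ≤ newTableTime r k := by
  have hrk : (r + 1) * (k + 1) ≤ (k + 1) ^ 2 * tableTime r k := by
    rw [mul_comm]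
    exact Nat.mul_le_mul (Nat.le_self_pow two_ne_zero _) (succ_le_tableTime r k)
  have hk := succ_sq_le_mul_tableTime r k
  have hS := tableSize_le_mul_tableTime r k
  have hpos : 0 < (k + 1) ^ 2 := by positivity
  rw [newTableTime]
  omega

theorem HasInput.ensures_program (hX : HasInput E r X)
    (hcells : (Nat.card X.Vertex + 1) * tableSize r k + (k + 1) ^ 2 ≤ E.cells) :
    program.Ensures E ⟨fun _ => 0, fun _ _ => 0⟩ fun h' t =>
      IsTruthValue (h'.var answer) (HasOrientedColoring (Digraph.mk X.Arc) r) ∧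
        t ≤ evaluationTime r X := by
  have hS : tableSize r k ≤ (Nat.card X.Vertex + 1) * tableSize r k :=
    Nat.le_mul_of_pos_left _ (Nat.succ_pos _)
  have hinit := initialization_le_newTableTime r k
  refine ensures_seq <| (hX.ensures_setParameters X.labels_pos
    (by simpa using by omega) rfl).frame.mono fun h₁ t₁ ⟨hp₁, hR₁, hops₁, ht₁⟩ => ?_
  refine ensures_seq <| hR₁.ensures_resetSlots_flushable.frame.mono
    fun h₂ t₂ ⟨hp₂, hF₂, ht₂⟩ => ?_
  have hbase₂ : h₂.var base = 0 := by rw [hp₂.var _ (by decide), hp₁.var _ (by decide)]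
  refine ensures_seq <| (hX.ensures_evaluation hF₂ ((hp₂.var _ (by decide)).trans hops₁)
    (by simpa [hbase₂] using hcells)).frame.mono fun h₃ t₃ ⟨hp₃, hT₃, ht₃⟩ => ?_
  have hanswer₃ : h₃.var answer = 0 := by
    rw [hp₃.var _ (by decide), hp₂.var _ (by decide), hp₁.var _ (by decide)]
  refine (hT₃.ensures_decideTable hanswer₃).mono fun h' t ⟨hanswer, ht⟩ => ⟨?_, by omega⟩
  exact hanswer.congr
    (hT₃.lazyTable.table.hasOrientedColoring_iff fun v => (hT₃.lazyTable.lab_lt v).2).symm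

end Program

section Cost

variable {k : ℕ}

theorem choose_two_add_two_mul_le (r : ℕ) : r.choose 2 + 2 * r ≤ r * r + 2 := by
  rcases Nat.lt_or_ge r 3 with hr | hr
  · interval_cases r <;> decide
  · have hsq : r * (r - 1) = r * r - r := by rw [Nat.mul_sub, mul_one]
    have : 3 * r ≤ r * r := Nat.mul_le_mul_right r hr
    rw [Nat.choose_two_right, hsq]
    omega

theorem tableTime_le (r k : ℕ) : tableTime r k ≤ 4 * 2 ^ (r * (r + k)) := by
  have hr : (r + 1) ^ 2 ≤ 2 ^ (2 * r) := by
    rw [mul_comm, pow_mul]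
    exact Nat.pow_le_pow_left Nat.lt_two_pow_self 2
  calc tableTime r k ≤ 2 ^ (2 * r) * 2 ^ (r * k + r.choose 2) := Nat.mul_le_mul_right _ hr
    _ = 2 ^ (r * k + (r.choose 2 + 2 * r)) := by rw [← pow_add]; ring_nf
    _ ≤ 2 ^ (r * k + (r * r + 2)) :=
      Nat.pow_le_pow_right two_pos (Nat.add_le_add_left (choose_two_add_two_mul_le r) _)
    _ = 4 * 2 ^ (r * (r + k)) := by ring

/-- The bound of the theorem for time and words, up to a constant factor. -/
noncomputable def cost (r : ℕ) (X : CWExpr k) : ℕ :=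
  X.size + Nat.card X.Vertex * k ^ 2 * 2 ^ (r * (r + k))

theorem card_mul_tableTime_le_cost (r : ℕ) (X : CWExpr k) :
    Nat.card X.Vertex * ((k + 1) ^ 2 * tableTime r k) + 16 * X.size ≤ 16 * cost r X := by
  have hk := X.labels_pos
  have hsq : (k + 1) ^ 2 ≤ 4 * k ^ 2 := by nlinarith
  calc Nat.card X.Vertex * ((k + 1) ^ 2 * tableTime r k) + 16 * X.size
      ≤ Nat.card X.Vertex * (4 * k ^ 2 * (4 * 2 ^ (r * (r + k)))) + 16 * X.size := by
        gcongr
        exact tableTime_le r k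
    _ = 16 * cost r X := by rw [cost]; ring

theorem evaluationTime_le_cost (r : ℕ) (X : CWExpr k) :
    evaluationTime r X + 7 ≤ 45000 * cost r X := by
  have hcost := card_mul_tableTime_le_cost r X
  have hsize := X.size_pos
  rw [evaluationTime, newTableTime, Nat.mul_left_comm _ 1400]
  omega

/-- The number of cells that the program needs for each array. -/
noncomputable def neededCells (r : ℕ) (X : CWExpr k) : ℕ :=
  (Nat.card X.Vertex + 1) * tableSize r k + (k + 1) ^ 2

theorem neededCells_add_le_cost (r : ℕ) (X : CWExpr k) :
    neededCells r X + r + k + X.size ≤ 100 * cost r X := by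
  have hcost := card_mul_tableTime_le_cost r X
  have hcard : 0 < Nat.card X.Vertex := Nat.card_pos
  have hle {a : ℕ} (ha : a ≤ (k + 1) ^ 2 * tableTime r k) :
      a ≤ Nat.card X.Vertex * ((k + 1) ^ 2 * tableTime r k) :=
    ha.trans (Nat.le_mul_of_pos_left _ hcard)
  have hnS := Nat.mul_le_mul_left (Nat.card X.Vertex) (tableSize_le_mul_tableTime r k)
  have hS := hle (tableSize_le_mul_tableTime r k)
  have hk := hle (succ_sq_le_mul_tableTime r k)
  have hr := hle ((Nat.le_of_succ_le (succ_le_tableTime r k)).trans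
    (Nat.le_mul_of_pos_left _ (by positivity)))
  have hkk : k + 1 ≤ (k + 1) ^ 2 := Nat.le_self_pow two_ne_zero _
  rw [neededCells, Nat.succ_mul]
  omega

theorem length_ocnInput (r : ℕ) (X : CWExpr k) : (ocnInput r X).length = 3 * X.size + 3 := by
  simp [ocnInput, X.length_code]

theorem getD_ocnInput_le_cost (r : ℕ) (X : CWExpr k) (i : ℕ) :
    (ocnInput r X).getD i 0 ≤ 45000 * cost r X := by
  have hcells := neededCells_add_le_cost r X
  have hsize := X.size_pos
  have hmem_le {a : ℕ} (ha : a ∈ ocnInput r X) : a ≤ 45000 * cost r X := by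
    simp only [ocnInput, List.mem_cons] at ha
    rcases ha with rfl | rfl | rfl | hcode
    · omega
    · omega
    · omega
    · have := CWExpr.le_of_mem_code hcode
      omega
  rcases lt_or_ge i (ocnInput r X).length with hi | hi
  · rw [List.getD_eq_getElem _ _ hi]
    exact hmem_le (List.getElem_mem hi)
  · rw [List.getD_eq_default _ _ hi]
    exact Nat.zero_le _

/-- The environment of a run of the program on the input for `r` and `X`. -/
noncomputable def inputEnv (r : ℕ) (X : CWExpr k) : Env Arr where
  bound := 45000 * cost r X
  inputLength := (ocnInput r X).length
  input i := (ocnInput r X).getD i 0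
  cells := neededCells r X
  one_le_bound := by
    have hcells := neededCells_add_le_cost r X
    have hsize := X.size_pos
    omega
  fits := by
    have hcells := neededCells_add_le_cost r X
    have hsize := X.size_pos
    have hcard : Fintype.card Arr = 5 := rfl
    rw [length_ocnInput, hcard]
    omega

theorem hasInput_inputEnv (r : ℕ) (X : CWExpr k) : HasInput (inputEnv r X) r X where
  two_lt_inputLength := by simp [inputEnv, ocnInput]
  input_zero := rfl
  input_one := rfl
  input_two := rfl
  encodes i hi := by simp [inputEnv, ocnInput, Nat.add_comm 3, hi]

theorem answers_program (r : ℕ) (X : CWExpr k) :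
    Answers (45000 * cost r X) (program.decider .answer) (ocnInput r X) (45000 * cost r X)
      (HasOrientedColoring (Digraph.mk X.Arc) r) :=
  Cmd.Ensures.answers (E := inputEnv r X)
    (((hasInput_inputEnv r X).ensures_program le_rfl).mono fun _ _ ⟨hanswer, ht⟩ =>
      ⟨hanswer.1, hanswer.2, (Nat.add_le_add_right ht 7).trans (evaluationTime_le_cost r X)⟩)
    (length_ocnInput r X) rfl (fun _ _ => rfl) (getD_ocnInput_le_cost r X)

end Cost

end OrientedColoring

theorem theorem6p9 :
    ∃ (P : WordRAM.Prog) (C : ℕ), ∀ (k r : ℕ) (X : CWExpr k) (V : Type) [Fintype V]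
      (G : Digraph V), X.Defines G →
        WordRAM.Answers
          (C * (X.size + Fintype.card V * k ^ 2 * 2 ^ (r * (r + k)))) P (ocnInput r X)
          (C * (X.size + Fintype.card V * k ^ 2 * 2 ^ (r * (r + k))))
          (HasOrientedColoring G r) := by
  refine ⟨OrientedColoring.program.decider .answer, 45000, fun k r X V _ G hG => ?_⟩
  have hcard : Nat.card X.Vertex = Fintype.card V := hG.card_vertex
  rw [← hcard, ← hG.hasOrientedColoring_iff]
  exact OrientedColoring.answers_program r X
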